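/- **Setting.** Let $d\ge 1$, $\mathcal D=[0,1]^d$, and let $k$ be a stationary kernel on $\mathbb R^d$ with $k\le 1$ whose Fourier transform decomposes, $k(x,y)=\int_{\mathbb R^d}\cos(\omega^\top(x-y))\prod_{j=1}^d p_j(\omega_j)\,d\omega$, with the Gaussian factors $p_j(\omega)=a_j e^{-\nu_j^2\omega^2/2}$ ($a_j,\nu_j>0$) for which quadrature Fourier features are defined. Let $B\ge0$, $\rho,\lambda>0$. In round $t=1,\dots,T$ ($T\ge2$) user $t$ presents a nonempty compact set $\mathcal D_t\subset\mathcal D$ (the sequence is fixed in advance), the algorithm picks $x_t\in\mathcal D_t$ and sees $y_t=f(x_t)+\varepsilon_t$, where the $\varepsilon_t$ are independent, zero-mean and sub-Gaussian with variance proxy $\rho^2$, and $f$ lies in the RKHS of $k$ on $\mathcal D$ with norm at most $B$. The pseudoregret is $\mathfrak R(T)=\sum_{t}(\max_{x\in\mathcal D_t}f(x)-f(x_t))$. Let $\gamma_T=\sup_{A\subset\mathcal D,|A|=T}\big(H(y_A)-H(y_A\mid f)\big)$, with $H$ the differential entropy, for $f\sim GP(0,\rho^2k)$ and $y_A=f_A+\varepsilon_A$,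 $\varepsilon_A\sim N(0,\rho^2I)$. **Features.** Let $\bar m=\lceil 6\ln T\rceil$, $m=2\bar m^d$, and let $s$ run over the $\bar m$ zeros of the probabilists' Hermite polynomial $He_{\bar m}$, with weights $w(s)=\bar m!\sqrt{2\pi}/(\bar m\,He_{\bar m-1}(s))^2$. For each $(s_1,\dots,s_d)$ the map $\Phi:\mathcal D\to\mathbb R^m$ has the two coordinates $\big(\prod_j\frac{a_j}{\nu_j}w(s_j)\big)^{1/2}\cos(\sum_j s_jx_j/\nu_j)$ and the same with $\sin$. Let $\epsilon=\sup_{x,y\in\mathcal D}|k(x,y)-\Phi(x)^\top\Phi(y)|$. **Algorithm.** Let $0<\alpha\le1$, $\beta,\zeta\in(0,1)$, $n=1+\lceil\log_2T\rceil$, $\sigma>0$, $\Lambda=\sigma\sqrt{2n}\,(4\sqrt m+2\sqrt{2\ln(2T/\zeta)})$ and $\kappa=\sigma\sqrt{n/\Lambda}\,(\sqrt m+\sqrt{2\ln(2T/\zeta)})$. A binary tree with $n$ levels stores at each node the sum of the matrices $[\Phi(x_i),y_i]^\top[\Phi(x_i),y_i]$ over its leaves $i$, plus $(\upsilon+\upsilon^\top)/\sqrt2$,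 where $\upsilon\in\mathbb R^{(m+1)\times(m+1)}$ has i.i.d. $N(0,\sigma^2)$ entries, independent over the nodes. In round $t$, let $\widetilde N_t$ be the sum of the values at the nodes of the dyadic decomposition of $\{1,\dots,t-1\}$, $\widetilde\Sigma_t$ its upper left $m\times m$ block plus $2\Lambda I$, and $\widetilde u_t$ the first $m$ entries of its last column. With $V_t=\widetilde\Sigma_t+\lambda I$ and $\widetilde\theta_t=V_t^{-1}\widetilde u_t$, the algorithm plays a maximizer $x_t$ over $\mathcal D_t$, with any fixed measurable tie-breaking rule, of $\langle\widetilde\theta_t,\Phi(x)\rangle+\beta_t^{1/2}\rho\|\Phi(x)\|_{V_t^{-1}}$, where $$\beta_t^{1/2}=B\sqrt{\tfrac{3\Lambda+\lambda}{\rho^2}}+\frac{tB\epsilon}{\rho\sqrt\Lambda}+\frac\kappa\rho+\sqrt{\log\det\Big(\frac{\widetilde\Sigma_t+\lambda I}{\lambda+\Lambda}\Big)+2\ln\frac2\zeta}.$$ **Claim.** Let $\sigma_{\alpha,\beta}=\frac4\alpha\sqrt{n\,(1+B^2+2\rho^2\ln(8/\beta))\ln(10/\beta)}$. 1. For every $\sigma\ge\sigma_{\alpha,\beta}$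 the algorithm is $(\alpha,\beta)$-jointly differentially private: if two sequences of users differ only in the $t$-th user (its decision set and its reward), where every user's reward at $x$ has mean in $[-B,B]$ and zero-mean sub-Gaussian noise with variance proxy $\rho^2$ (independent over users), then for every measurable set $E$ of sequences of actions with the $t$-th omitted, $\mathbb P((x_i)_{i\ne t}\in E)\le e^\alpha\,\mathbb P'((x_i)_{i\ne t}\in E)+\beta$. 2. With $\sigma=\sigma_{\alpha,\beta}$, with probability at least $1-\zeta$, $$\mathfrak R(T)\le C\sqrt{T\gamma_T}\left((\ln T)^{\frac{d+2}4}\Big(\frac1\alpha\log\frac1\beta\log\frac1\zeta\Big)^{\frac12}+(\ln T)^{\frac{d+1}2}\right).$$ Here, for each $q<1$, the constant $C$ depends only on $d,a,\nu,B,\rho,\lambda,q$ and serves all $T\ge2$, all $\alpha\in(0,1]$ and $\beta,\zeta\in(0,q]$, all tie-breaking rules, all $f$ and all environments as above. -/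

import Mathlib

open MeasureTheory ProbabilityTheory TopologicalSpace

noncomputable section

namespace PrivateGPBandit

/-! ### Domain, kernel and spectral density -/

/-- The domain `[0,1]^d`. -/
abbrev Cube (d : ℕ) : Type := ↥(Set.Icc (0 : Fin d → ℝ) 1)

/-- `k` is a stationary kernel on `ℝ^d`, bounded above by `1`, that is the Fourier integral
`k(x,y) = ∫ cos(ω·(x-y)) p(ω) dω` of the product density `p(ω) = ∏ j, p_j(ω_j)`. -/
structure IsDecomposable {d : ℕ} (k : (Fin d → ℝ) → (Fin d → ℝ) → ℝ)
    (p : Fin d → ℝ → ℝ) : Prop where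
  le_one : ∀ x y, k x y ≤ 1
  nonneg : ∀ j w, 0 ≤ p j w
  integrable : ∀ j, Integrable (p j)
  fourier : ∀ x y, k x y =
    ∫ w : Fin d → ℝ, (∏ j, p j (w j)) * Real.cos (∑ j, w j * (x j - y j))

/-- The Gaussian spectral densities `p_j(w) = a_j exp(-ν_j² w² / 2)`. -/
def gaussianSpectrum {d : ℕ} (a ν : Fin d → ℝ) (j : Fin d) (w : ℝ) : ℝ :=
  a j * Real.exp (-((ν j) ^ 2 * w ^ 2) / 2)

/-! ### Quadrature Fourier features -/

/-- The Gauss–Hermite nodes: the real zeros of the `n`-th (probabilists') Hermite polynomial. -/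
def hermiteNodes (n : ℕ) : Finset ℝ :=
  ((Polynomial.hermite n).map (Int.castRingHom ℝ)).roots.toFinset

/-- The Gauss–Hermite weight for `∫ g(s) exp(-s²/2) ds` at the node `s`. -/
def hermiteWeight (n : ℕ) (s : ℝ) : ℝ :=
  (n.factorial : ℝ) * √(2 * Real.pi) /
    ((n : ℝ) ^ 2 * (Polynomial.aeval s (Polynomial.hermite (n - 1))) ^ 2)

/-- Feature indices: a point of the `d`-fold product grid of nodes, and a choice of cosine (`true`)
or sine (`false`); there are `2 n^d` of them. -/
abbrev FeatIdx (d n : ℕ) : Type := (Fin d → ↥(hermiteNodes n)) × Bool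

/-- Quadrature Fourier features. The nodes for the density `a_j exp(-ν_j² w²/2)` are `s / ν_j`, with
weights `(a_j / ν_j) * hermiteWeight n s`. -/
def qff {d : ℕ} (a ν : Fin d → ℝ) (n : ℕ) (x : Fin d → ℝ) (i : FeatIdx d n) : ℝ :=
  √(∏ j, a j / ν j * hermiteWeight n (i.1 j)) *
    (if i.2 then Real.cos (∑ j, (i.1 j : ℝ) / ν j * x j)
      else Real.sin (∑ j, (i.1 j : ℝ) / ν j * x j))

/-! ### Maximum information gain -/

/-- Differential entropy of a distribution on a Euclidean space. -/
def diffEntropy {ι : Type} [Fintype ι] (μ : Measure (EuclideanSpace ℝ ι)) : ℝ :=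
  -∫ y, Real.log (μ.rnDeriv volume y).toReal ∂μ

/-- The Gram matrix of a finite set of points. -/
def gram {d : ℕ} (k : (Fin d → ℝ) → (Fin d → ℝ) → ℝ) (A : Finset (Cube d)) :
    Matrix ↥A ↥A ℝ :=
  Matrix.of fun x y => k (x : Cube d) (y : Cube d)

/-- `H(y_A) - H(y_A | f)` for `f ∼ GP(0, ρ² k)`, `y_A = f_A + ε_A` and independent
`ε_A ∼ N(0, ρ² I)`. -/
def infoGain {d : ℕ} (k : (Fin d → ℝ) → (Fin d → ℝ) → ℝ) (ρ : ℝ) (A : Finset (Cube d)) : ℝ :=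
  diffEntropy (multivariateGaussian 0 (ρ ^ 2 • gram k A + ρ ^ 2 • 1)) -
    ∫ v, diffEntropy (multivariateGaussian v (ρ ^ 2 • (1 : Matrix ↥A ↥A ℝ)))
      ∂(multivariateGaussian 0 (ρ ^ 2 • gram k A))

/-- The maximum information gain `γ_T`. -/
def maxInfoGain {d : ℕ} (k : (Fin d → ℝ) → (Fin d → ℝ) → ℝ) (ρ : ℝ) (T : ℕ) : ℝ :=
  sSup {r : ℝ | ∃ A : Finset (Cube d), A.card = T ∧ r = infoGain k ρ A}

/-! ### Parameters of the algorithm -/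

/-- The inputs of the algorithm: horizon `T`, kernel `k` with spectral parameters `a`, `ν`, norm
bound `B`, noise parameter `ρ`, regularizer `reg`, privacy noise scale `σ`, failure
probability `ζ`. -/
structure Params (d : ℕ) where
  T : ℕ
  k : (Fin d → ℝ) → (Fin d → ℝ) → ℝ
  a : Fin d → ℝ
  ν : Fin d → ℝ
  B : ℝ
  ρ : ℝ
  reg : ℝ
  σ : ℝ
  ζ : ℝ

namespace Params

variable {d : ℕ} (P : Params d)

/-- Number of quadrature nodes per coordinate, `6 log T` rounded up. -/
def order : ℕ := ⌈6 * Real.log P.T⌉₊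

/-- Number of features, `2 (6 log T)^d` with `6 log T` rounded up. -/
def m : ℕ := 2 * P.order ^ d

/-- Indices of the features used. -/
abbrev Idx : Type := FeatIdx d P.order

/-- The feature map. -/
def feat (x : Cube d) : P.Idx → ℝ := qff P.a P.ν P.order x

/-- The uniform approximation error of the features. -/
def ε : ℝ := ⨆ xy : Cube d × Cube d, |P.k xy.1 xy.2 - P.feat xy.1 ⬝ᵥ P.feat xy.2|

/-- Number of levels of the binary tree, `1 + ⌈log₂ T⌉`. -/
def depth : ℕ := 1 + Nat.clog 2 P.T

/-- The spectral scale `Λ` of the shifted noise: `λ_min = Λ` and `λ_max = 3 Λ`. -/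
def Lam : ℝ :=
  P.σ * √(2 * P.depth) * (4 * √P.m + 2 * √(2 * Real.log (2 * P.T / P.ζ)))

/-- The bound `κ` on the norm of the vector noise. -/
def κ : ℝ :=
  P.σ * √(P.depth / P.Lam) * (√P.m + √(2 * Real.log (2 * P.T / P.ζ)))

/-- The confidence multiplier `β_t^{1/2}` at round `t` (counted from `1`), computed from the
perturbed matrix `S`. -/
def sqrtBeta (t : ℕ) (S : Matrix P.Idx P.Idx ℝ) : ℝ :=
  P.B * √((3 * P.Lam + P.reg) / P.ρ ^ 2) + t * P.B * P.ε / (P.ρ * √P.Lam) + P.κ / P.ρ +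
    √(Real.log ((P.reg + P.Lam)⁻¹ • (S + P.reg • (1 : Matrix P.Idx P.Idx ℝ))).det
      + 2 * Real.log (2 / P.ζ))

/-- The acquisition function `⟨θ, Φ(x)⟩ + b ρ ‖Φ(x)‖_{V⁻¹}`. -/
def ucb (θ : P.Idx → ℝ) (V : Matrix P.Idx P.Idx ℝ) (b : ℝ) (x : Cube d) : ℝ :=
  θ ⬝ᵥ P.feat x + b * (P.ρ * √(P.feat x ⬝ᵥ V⁻¹.mulVec (P.feat x)))

/-- A measurable rule returning a maximizer of the acquisition function over the decision set. -/
structure ArgmaxRule where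
  pick : NonemptyCompacts (Cube d) → (P.Idx → ℝ) → (P.Idx → P.Idx → ℝ) → ℝ → Cube d
  pick_mem : ∀ D θ V b, pick D θ V b ∈ D
  pick_max : ∀ D θ V b, ∀ x ∈ D,
    P.ucb θ (Matrix.of V) b x ≤ P.ucb θ (Matrix.of V) b (pick D θ V b)
  measurable_pick : ∀ D, Measurable
    fun q : (P.Idx → ℝ) × (P.Idx → P.Idx → ℝ) × ℝ => pick D q.1 q.2.1 q.2.2

/-! ### The tree-based privatizer -/

/-- Nodes of the tree: `(l, j)` is the `j`-th node of level `l`, whose leaves are the rounds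
`j 2^l, …, (j+1) 2^l - 1` (rounds counted from `0`). -/
abbrev Node : Type := Fin P.depth × Fin P.T

/-- One noise matrix of size `(m+1) × (m+1)` for every node. -/
abbrev TreeNoise : Type := P.Node → (P.Idx ⊕ Unit) → (P.Idx ⊕ Unit) → ℝ

/-- The row `[Φ(x), y]`. -/
def datum (z : Cube d × ℝ) : P.Idx ⊕ Unit → ℝ := Sum.elim (P.feat z.1) fun _ => z.2

/-- The value stored at a node: the sum of `[Φ(x_i), y_i]ᵀ[Φ(x_i), y_i]` over its leaves, plus
the symmetrized noise `(υᵀ + υ)/√2` of the node. -/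
def nodeValue (N : P.TreeNoise) {t : ℕ} (h : Fin t → Cube d × ℝ) (q : P.Node) :
    Matrix (P.Idx ⊕ Unit) (P.Idx ⊕ Unit) ℝ :=
  (∑ i : Fin t, if (i : ℕ) / 2 ^ (q.1 : ℕ) = q.2 then
      Matrix.vecMulVec (P.datum (h i)) (P.datum (h i)) else 0)
    + (1 / √2) • ((Matrix.of (N q)).transpose + Matrix.of (N q))

/-- The private prefix sum over the first `t` rounds: the sum of the values at the nodes of the
dyadic decomposition of `{0, …, t-1}`, one node for every nonzero binary digit of `t`. -/
def treeSum (N : P.TreeNoise) {t : ℕ} (h : Fin t → Cube d × ℝ) :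
    Matrix (P.Idx ⊕ Unit) (P.Idx ⊕ Unit) ℝ :=
  ∑ q : P.Node, if t.testBit q.1 = true ∧ (q.2 : ℕ) + 1 = t / 2 ^ (q.1 : ℕ) then
    P.nodeValue N h q else 0

/-- The released matrix, with its noise shifted by `2 Λ I`. -/
def privSigma (N : P.TreeNoise) {t : ℕ} (h : Fin t → Cube d × ℝ) : Matrix P.Idx P.Idx ℝ :=
  (P.treeSum N h).toBlocks₁₁ + (2 * P.Lam) • 1

/-- The released vector. -/
def privU (N : P.TreeNoise) {t : ℕ} (h : Fin t → Cube d × ℝ) : P.Idx → ℝ :=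
  fun i => P.treeSum N h (Sum.inl i) (Sum.inr ())

/-! ### The server -/

/-- The action chosen after the history `h` of `t` rounds, in the decision set `D`. -/
def action (R : P.ArgmaxRule) (N : P.TreeNoise) {t : ℕ} (h : Fin t → Cube d × ℝ)
    (D : NonemptyCompacts (Cube d)) : Cube d :=
  let S := P.privSigma N h
  let V := S + P.reg • (1 : Matrix P.Idx P.Idx ℝ)
  R.pick D (V⁻¹.mulVec (P.privU N h)) V (P.sqrtBeta (t + 1) S)

end Params

/-! ### Users and runs -/

/-- The data of one user: a decision set, and a random reward `y = meanReward x + e` with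
`e ∼ noise`. A fixed reward is the case of a constant mean and a noise that is a point mass
at `0`. -/
structure User (d : ℕ) where
  decisionSet : NonemptyCompacts (Cube d)
  meanReward : Cube d → ℝ
  measurable_meanReward : Measurable meanReward
  noise : ProbabilityMeasure ℝ

/-- The reward noise is zero-mean sub-Gaussian with variance proxy `ρ²`. -/
def User.SubGaussianNoise {d : ℕ} (ρ : ℝ) (u : User d) : Prop :=
  HasSubgaussianMGF id (Real.toNNReal (ρ ^ 2)) (u.noise : Measure ℝ)

/-- The reward has mean in `[-B, B]` and `ρ`-sub-Gaussian noise. -/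
def User.Admissible {d : ℕ} (B ρ : ℝ) (u : User d) : Prop :=
  (∀ x, |u.meanReward x| ≤ B) ∧ u.SubGaussianNoise ρ

namespace Params

variable {d : ℕ} (P : Params d)

/-- The history of actions and rewards of the first `t` rounds, as a function of the tree noise
`N` and of the reward noise `e`. -/
def history (R : P.ArgmaxRule) (S : Fin P.T → User d) (N : P.TreeNoise) (e : Fin P.T → ℝ) :
    (t : ℕ) → t ≤ P.T → Fin t → Cube d × ℝ
  | 0, _ => Fin.elim0
  | t + 1, ht =>
    let h := history R S N e t (Nat.le_of_succ_le ht)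
    let u := S ⟨t, ht⟩
    let x := P.action R N h u.decisionSet
    Fin.snoc (α := fun _ => Cube d × ℝ) h (x, u.meanReward x + e ⟨t, ht⟩)

/-- The randomness of a run: tree noise and reward noise. -/
abbrev Sample : Type := P.TreeNoise × (Fin P.T → ℝ)

/-- The tree noise has independent `N(0, σ²)` entries and is independent of the reward noise. -/
def sampleMeasure (S : Fin P.T → User d) : Measure P.Sample :=
  (Measure.pi fun _ => Measure.pi fun _ => Measure.pi fun _ =>
      gaussianReal 0 (Real.toNNReal (P.σ ^ 2))).prod
    (Measure.pi fun i => ((S i).noise : Measure ℝ))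

/-- The sequence of actions of a run. -/
def actions (R : P.ArgmaxRule) (S : Fin P.T → User d) (ω : P.Sample) (i : Fin P.T) : Cube d :=
  (P.history R S ω.1 ω.2 P.T le_rfl i).1

/-- `(α, β)`-joint differential privacy under continual observation: if two sequences of
admissible users differ only in the `t`-th user, then the distributions of the actions of all
rounds other than `t` are `(α, β)`-close. -/
def IsJDP (R : P.ArgmaxRule) (α β : ℝ) : Prop :=
  ∀ (t : Fin P.T) (S S' : Fin P.T → User d),
    (∀ i, (S i).Admissible P.B P.ρ) → (∀ i, (S' i).Admissible P.B P.ρ) →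
    (∀ i, i ≠ t → S i = S' i) →
    ∀ E : Set ({i : Fin P.T // i ≠ t} → Cube d), MeasurableSet E →
      (P.sampleMeasure S).real {ω | (fun i : {i // i ≠ t} => P.actions R S ω i) ∈ E} ≤
        Real.exp α *
          (P.sampleMeasure S').real {ω | (fun i : {i // i ≠ t} => P.actions R S' ω i) ∈ E} + β

/-- The pseudoregret `∑_t (max_{x ∈ D_t} f(x) - f(x_t))`. -/
def regret (R : P.ArgmaxRule) (S : Fin P.T → User d) (f : Cube d → ℝ) (ω : P.Sample) : ℝ :=
  ∑ t, (sSup (f '' ((S t).decisionSet : Set (Cube d))) - f (P.actions R S ω t))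

end Params

/-- The noise scale for `(α, β)`-joint differential privacy with horizon `T`. -/
def privacyScale (T : ℕ) (B ρ α β : ℝ) : ℝ :=
  4 * √((1 + Nat.clog 2 T : ℕ) * (1 + B ^ 2 + 2 * ρ ^ 2 * Real.log (8 / β)) *
    Real.log (10 / β)) / α

end PrivateGPBandit

end

open PrivateGPBandit

noncomputable section
namespace PrivateGPBandit
open Polynomial

/-! ### Gauss–Hermite quadrature -/

/-! Privacy. User `t` reaches the other users only through the tree nodes that contain leaf `t`, at
most one per level. Replacing the datum of round `t` changes each of these nodes by the same matrix,
and adding the difference to their Gaussian noise reproduces all other actions exactly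
(`Params.actionAt_add_treeShift`). A node is read only after all its leaves are past, so the
required shift is determined by the noise at the remaining nodes. Given that noise the shift is
deterministic, and the Cameron–Martin formula with a Chernoff bound for the log-density
(`HasGaussianShift.lintegral_comp_add_le`) gives indistinguishability. The shift is short because
features have norm at most one and rewards are truncated: the reward noise of user `t` is large only
with probability `β/4` in each world.

Regret. Gauss–Hermite quadrature with `6 log T` nodes per coordinate has error `O(T⁻¹²)`, so the
kernel is almost the inner product of the features. The reward `f` is not linear in the features,
but kernel ridge regression on the finitely many points that matter yields a linear function close
to it with almost the same norm (`exists_approx`). With probability at least `1 - ζ` all tree noise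
matrices have spectral norm at most `Λ`, the noise vectors are short, and the reward noise obeys a
self-normalized bound (`Params.measure_not_goodRun_le`). Then `V_t` dominates the design matrix with
regularizer `λ + Λ`, the private estimator is within its confidence ellipsoid up to a tiny slack
(`Params.sqrt_quad_estimate_sub_le`), and optimism bounds the regret of a round by twice the width
of the played point.

By Cauchy–Schwarz and the elliptical potential argument the widths sum to at most the multiplier
times `√(T log det(1 + ΦΦᵀ))` up to a constant. Sylvester's identity and the kernel approximation
turn this determinant into that of `1 + K`, whose logarithm is at most `2 γ_T`
(`log_det_le_maxInfoGain`). The multiplier is of order `√Λ + √(m log T + log(1/ζ))`. Since `Λ` is of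
order `σ √n (√m + √log(T/ζ))` and `σ` of order `√(log T) log(1/β)/α`, the first term gives the
private rate and `√(m log T)` the nonprivate one. -/

theorem integrable_eval_mul_gaussian (p : ℝ[X]) :
    Integrable fun x : ℝ => p.eval x * Real.exp (-x ^ 2 / 2) := by
  induction p using Polynomial.induction_on' with
  | add p q hp hq =>
    simp only [eval_add, add_mul]
    exact hp.add hq
  | monomial n a =>
    have h := integrable_rpow_mul_exp_neg_mul_sq (b := 1 / 2) (by norm_num)
      (s := (n : ℝ)) (by have : (0 : ℝ) ≤ n := n.cast_nonneg; linarith)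
    simp only [eval_monomial, mul_assoc]
    refine (h.congr (.of_forall fun x => ?_)).const_mul a
    simp only [Real.rpow_natCast]
    congr 2
    ring

/-- The Gaussian moment functional `p ↦ ∫ p(x) exp(-x²/2) dx`. -/
def gaussInt : ℝ[X] →ₗ[ℝ] ℝ where
  toFun p := ∫ x : ℝ, p.eval x * Real.exp (-x ^ 2 / 2)
  map_add' p q := by
    simp only [eval_add, add_mul]
    exact integral_add (integrable_eval_mul_gaussian p) (integrable_eval_mul_gaussian q)
  map_smul' c p := by
    simp only [eval_smul, smul_eq_mul, mul_assoc, RingHom.id_apply]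
    exact integral_const_mul c _

theorem gaussInt_apply (p : ℝ[X]) :
    gaussInt p = ∫ x : ℝ, p.eval x * Real.exp (-x ^ 2 / 2) := rfl

theorem gaussInt_one : gaussInt 1 = √(2 * Real.pi) := by
  rw [gaussInt_apply]
  have h := integral_gaussian (1 / 2)
  simp only [eval_one, one_mul]
  rw [show 2 * Real.pi = Real.pi / (1 / 2) by ring, ← h]
  congr 1
  ext x
  congr 1
  ring

/-- Integration by parts: the derivative of `p(x) exp(-x²/2)` has integral zero. -/
theorem gaussInt_X_mul (p : ℝ[X]) : gaussInt (X * p) = gaussInt (derivative p) := by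
  have hd : ∀ x : ℝ, HasDerivAt (fun x : ℝ => p.eval x * Real.exp (-x ^ 2 / 2))
      ((derivative p - X * p).eval x * Real.exp (-x ^ 2 / 2)) x := by
    intro x
    have h1 : HasDerivAt (fun x : ℝ => -x ^ 2 / 2) (-x) x := by
      refine ((hasDerivAt_pow 2 x).neg.div_const 2).congr_deriv ?_
      norm_num
      ring
    refine ((p.hasDerivAt x).mul h1.exp).congr_deriv ?_
    simp only [eval_sub, eval_mul, eval_X]
    ring
  have h := integral_eq_zero_of_hasDerivAt_of_integrable hd (integrable_eval_mul_gaussian _)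
    (integrable_eval_mul_gaussian _)
  rw [← gaussInt_apply, map_sub] at h
  linarith

theorem gaussInt_pos {p : ℝ[X]} (hp : p ≠ 0) (h : ∀ x, 0 ≤ p.eval x) : 0 < gaussInt p := by
  rw [gaussInt_apply, integral_pos_iff_support_of_nonneg
    (fun x => mul_nonneg (h x) (Real.exp_pos _).le) (integrable_eval_mul_gaussian p)]
  have hs : Function.support (fun x : ℝ => p.eval x * Real.exp (-x ^ 2 / 2)) =
      (↑p.roots.toFinset : Set ℝ)ᶜ := by
    ext x
    simp [Function.mem_support, Real.exp_ne_zero, hp]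
  rw [hs]
  have h0 : volume (↑p.roots.toFinset : Set ℝ) = 0 := (Finset.finite_toSet _).measure_zero _
  have : volume ((↑p.roots.toFinset : Set ℝ)ᶜ) ≠ 0 := by
    intro h1
    have := measure_union_null h0 h1
    simp at this
  exact pos_iff_ne_zero.mpr this

/-- The Hermite polynomial with real coefficients. -/
abbrev hermiteR (n : ℕ) : ℝ[X] := (hermite n).map (Int.castRingHom ℝ)

theorem hermiteR_succ (n : ℕ) :
    hermiteR (n + 1) = X * hermiteR n - derivative (hermiteR n) := by
  simp [hermiteR, hermite_succ, derivative_map]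

theorem hermiteR_monic (n : ℕ) : (hermiteR n).Monic := (hermite_monic n).map _

theorem natDegree_hermiteR (n : ℕ) : (hermiteR n).natDegree = n := by
  rw [(hermite_monic n).natDegree_map, natDegree_hermite]

theorem derivative_hermiteR_succ (n : ℕ) :
    derivative (hermiteR (n + 1)) = (n + 1 : ℝ[X]) * hermiteR n := by
  induction n with
  | zero => simp [hermiteR]
  | succ n ih =>
    rw [hermiteR_succ (n + 1)]
    simp only [derivative_sub, derivative_mul, derivative_X, ih]
    rw [hermiteR_succ n]
    simp
    ring

/-- The recursion `He_{n+1} = X He_n - He_n'` and integration by parts trade one Hermite degree for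
one derivative of `p`. Orthogonality to lower degrees and the norm of `He_n` both follow. -/
theorem gaussInt_hermiteR_mul (n : ℕ) (p : ℝ[X]) :
    gaussInt (hermiteR n * p) = gaussInt (derivative^[n] p) := by
  induction n generalizing p with
  | zero => simp [hermiteR]
  | succ n ih =>
    have h : hermiteR (n + 1) * p = X * (hermiteR n * p) - derivative (hermiteR n) * p := by
      rw [hermiteR_succ]; ring
    rw [h, map_sub, gaussInt_X_mul, derivative_mul, map_add, Function.iterate_succ_apply, ← ih]
    ring

theorem gaussInt_hermiteR_mul_of_lt {n : ℕ} {p : ℝ[X]} (hp : p.natDegree < n) :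
    gaussInt (hermiteR n * p) = 0 := by
  rw [gaussInt_hermiteR_mul, iterate_derivative_eq_zero hp, map_zero]

theorem gaussInt_hermiteR_mul_monic {n : ℕ} {p : ℝ[X]} (hp : p.Monic) (hn : p.natDegree = n) :
    gaussInt (hermiteR n * p) = n.factorial * √(2 * Real.pi) := by
  have h : derivative^[n] p = C (n.factorial : ℝ) := by
    ext k
    rw [coeff_iterate_derivative, coeff_C]
    rcases Nat.eq_zero_or_pos k with rfl | hk
    · have : p.coeff n = 1 := by rw [← hn]; exact hp
      simp [this, Nat.descFactorial_self]
    · rw [coeff_eq_zero_of_natDegree_lt (by omega)]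
      simp [hk.ne']
  rw [gaussInt_hermiteR_mul, h, ← mul_one (C _), C_mul', map_smul, gaussInt_one, smul_eq_mul]

theorem pos_or_neg_of_roots_eq_zero {g : ℝ[X]} (hg : g ≠ 0) (h : g.roots = 0) :
    (∀ x, 0 < g.eval x) ∨ ∀ x, g.eval x < 0 := by
  have hne : ∀ x, g.eval x ≠ 0 := fun x hx => by
    have : x ∈ g.roots := (mem_roots hg).mpr hx
    simp [h] at this
  by_contra hcon
  push Not at hcon
  obtain ⟨⟨x, hx⟩, ⟨y, hy⟩⟩ := hcon
  obtain ⟨z, hz⟩ := mem_range_of_exists_le_of_exists_ge g.continuous ⟨x, hx⟩ ⟨y, hy⟩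
  exact hne z hz

/-- The Hermite polynomial of degree `n` has `n` distinct real roots. -/
theorem card_hermiteNodes (n : ℕ) : (hermiteNodes n).card = n := by
  have hp0 : hermiteR n ≠ 0 := (hermiteR_monic n).ne_zero
  have hle : (hermiteNodes n).card ≤ n :=
    (Multiset.toFinset_card_le _).trans ((card_roots' _).trans (natDegree_hermiteR n).le)
  by_contra hne
  have hlt : (hermiteNodes n).card < n := lt_of_le_of_ne hle hne
  obtain ⟨g, hg, -, hroots⟩ := exists_prod_multiset_X_sub_C_mul (hermiteR n)
  have hg0 : g ≠ 0 := by rintro rfl; simp at hg; exact hp0 hg.symm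
  -- `r` collects the real roots of odd multiplicity. With fewer than `n` roots it has degree below
  -- `n`, so `He_n r` has Gaussian integral zero. But all real roots of `He_n r` have even
  -- multiplicity, so it has constant sign, which is impossible.
  set O := (hermiteNodes n).filter fun s => Odd ((hermiteR n).roots.count s) with hO
  set r : ℝ[X] := ∏ s ∈ O, (X - C s) with hr
  have hrm : r.Monic := monic_prod_of_monic _ _ fun s _ => monic_X_sub_C s
  have hrd : r.natDegree < n := by
    rw [hr, natDegree_prod_of_monic _ _ fun s _ => monic_X_sub_C s]
    simp only [natDegree_X_sub_C, Finset.sum_const, smul_eq_mul, mul_one]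
    exact (Finset.card_filter_le _ _).trans_lt hlt
  set c : ℝ[X] := ∏ s ∈ hermiteNodes n,
    (X - C s) ^ ((hermiteR n).roots.count s + if Odd ((hermiteR n).roots.count s) then 1 else 0)
    with hc
  have hfac : hermiteR n * r = c * g := by
    rw [hc, hr, hO, Finset.prod_filter]
    simp only [pow_add]
    rw [Finset.prod_mul_distrib]
    have hg' := hg
    rw [Finset.prod_multiset_map_count] at hg'
    nth_rewrite 1 [← hg']
    have : ∀ s, (X - C s : ℝ[X]) ^ (if Odd ((hermiteR n).roots.count s) then 1 else 0) =
        if Odd ((hermiteR n).roots.count s) then (X - C s) else 1 := by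
      intro s; split_ifs <;> simp
    simp only [this]
    change _ = (∏ s ∈ (hermiteR n).roots.toFinset, _) * (∏ s ∈ (hermiteR n).roots.toFinset, _) * g
    change _ * (∏ s ∈ (hermiteR n).roots.toFinset, _) = _
    ring
  have hcpos : ∀ x, 0 ≤ c.eval x := by
    intro x
    rw [hc, eval_prod]
    refine Finset.prod_nonneg fun s _ => ?_
    rw [eval_pow]
    refine Even.pow_nonneg ?_ _
    split_ifs with h
    · exact h.add_one
    · simpa using h
  have hz := gaussInt_hermiteR_mul_of_lt hrd
  have hc0 : c ≠ 0 := by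
    rintro h
    rw [h, zero_mul] at hfac
    exact mul_ne_zero hp0 hrm.ne_zero hfac
  rw [hfac] at hz
  rcases pos_or_neg_of_roots_eq_zero hg0 hroots with h | h
  · refine (gaussInt_pos (mul_ne_zero hc0 hg0) fun x => ?_).ne' hz
    rw [eval_mul]
    exact mul_nonneg (hcpos x) (h x).le
  · refine (gaussInt_pos (mul_ne_zero hc0 (neg_ne_zero.mpr hg0)) fun x => ?_).ne' ?_
    · rw [eval_mul, eval_neg]
      exact mul_nonneg (hcpos x) (neg_pos.mpr (h x)).le
    · rw [mul_neg, map_neg, hz, neg_zero]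

theorem mem_hermiteNodes {n : ℕ} {s : ℝ} : s ∈ hermiteNodes n ↔ (hermiteR n).eval s = 0 := by
  rw [hermiteNodes, Multiset.mem_toFinset, mem_roots (hermiteR_monic n).ne_zero]
  rfl

/-- Exactness of the interpolatory rule at the Gauss nodes on polynomials of degree below `2n`. -/
theorem gaussInt_eq_sum_basis {n : ℕ} {p : ℝ[X]} (hp : p.natDegree < 2 * n) :
    gaussInt p = ∑ s ∈ hermiteNodes n,
      gaussInt (Lagrange.basis (hermiteNodes n) id s) * p.eval s := by
  have hm := hermiteR_monic n
  have hn : 0 < n := by omega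
  -- Divide by `He_n`: the quotient has degree below `n` and is orthogonal to `He_n`, while the
  -- remainder has the values of `p` at the nodes and equals its own interpolant.
  set u := p /ₘ hermiteR n with hu
  set r := p %ₘ hermiteR n with hr
  have hpr : r + hermiteR n * u = p := modByMonic_add_div p (hermiteR n)
  have hud : u.natDegree < n := by
    rw [hu, natDegree_divByMonic p hm, natDegree_hermiteR]; omega
  have hrd : r.degree < (hermiteNodes n).card := by
    rw [card_hermiteNodes]
    refine (degree_modByMonic_lt p hm).trans_le ?_
    rw [degree_eq_natDegree hm.ne_zero, natDegree_hermiteR]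
  have hr2 := Lagrange.eq_interpolate (s := hermiteNodes n) (v := id) (f := r)
    Function.injective_id.injOn hrd
  have hL : gaussInt p = gaussInt r := by
    rw [← hpr, map_add, gaussInt_hermiteR_mul_of_lt hud, add_zero]
  rw [hL, hr2, Lagrange.interpolate_apply, map_sum]
  refine Finset.sum_congr rfl fun s hs => ?_
  have he : p.eval s = r.eval s := by
    rw [← hpr, eval_add, eval_mul, mem_hermiteNodes.mp hs, zero_mul, add_zero]
  rw [he, C_mul', map_smul, smul_eq_mul, mul_comm]
  rfl

theorem aeval_hermite_eq (n : ℕ) (s : ℝ) : aeval s (hermite n) = (hermiteR n).eval s := by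
  rw [hermiteR, eval_map, aeval_def]
  rfl

/-- Exactness is tested on `He_{n-1} · He_n / (X - s)`, which vanishes at every node but `s`. Its
integral is `(n-1)! √(2π)` since the second factor is monic of degree `n-1`, and at `s` that factor
equals `He_n'(s) = n He_{n-1}(s)`. -/
theorem gaussInt_basis_eq_hermiteWeight {n : ℕ} {s : ℝ} (hs : s ∈ hermiteNodes n) :
    gaussInt (Lagrange.basis (hermiteNodes n) id s) = hermiteWeight n s := by
  obtain ⟨k, rfl⟩ : ∃ k, n = k + 1 := by
    refine ⟨n - 1, ?_⟩
    have := Finset.card_pos.mpr ⟨s, hs⟩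
    rw [card_hermiteNodes] at this
    omega
  obtain ⟨g, hg⟩ := dvd_iff_isRoot.mpr (show IsRoot (hermiteR (k + 1)) s from mem_hermiteNodes.mp hs)
  have hgm : g.Monic := (monic_X_sub_C s).of_mul_monic_left (hg ▸ hermiteR_monic (k + 1))
  have hgd : g.natDegree = k := by
    have := congrArg natDegree hg
    rw [natDegree_hermiteR, (monic_X_sub_C s).natDegree_mul hgm, natDegree_X_sub_C] at this
    omega
  have hev : g.eval s = (k + 1) * (hermiteR k).eval s := by
    have h := congrArg (fun p => (derivative p).eval s) hg
    simp only [derivative_hermiteR_succ, derivative_mul, derivative_sub, derivative_X,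
      derivative_C, eval_mul, eval_add, eval_sub, eval_X, eval_C, sub_self, zero_mul, add_zero,
      sub_zero, one_mul, eval_natCast, eval_one] at h
    exact h.symm
  have hdeg : (hermiteR k * g).natDegree < 2 * (k + 1) := by
    rw [(hermiteR_monic k).natDegree_mul hgm, natDegree_hermiteR, hgd]; omega
  have h1 := gaussInt_eq_sum_basis hdeg
  rw [gaussInt_hermiteR_mul_monic hgm hgd, Finset.sum_eq_single_of_mem s hs] at h1
  · rw [eval_mul, hev] at h1
    have hne : (hermiteR k).eval s ≠ 0 := by
      intro h0
      rw [h0] at h1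
      have : 0 < (k.factorial : ℝ) * √(2 * Real.pi) := by positivity
      rw [h1] at this
      simp at this
    rw [hermiteWeight, aeval_hermite_eq, Nat.add_sub_cancel, Nat.factorial_succ]
    push_cast
    field_simp
    linarith
  · intro b hb hbs
    have h2 := mem_hermiteNodes.mp hb
    rw [hg, eval_mul, eval_sub, eval_X, eval_C] at h2
    rw [eval_mul, (mul_eq_zero.mp h2).resolve_left (sub_ne_zero.mpr hbs), mul_zero, mul_zero]

/-- Gauss–Hermite quadrature is exact on polynomials of degree below `2n`. -/
theorem gaussInt_eq_sum_hermiteWeight {n : ℕ} {p : ℝ[X]} (hp : p.natDegree < 2 * n) :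
    gaussInt p = ∑ s ∈ hermiteNodes n, hermiteWeight n s * p.eval s := by
  rw [gaussInt_eq_sum_basis hp]
  exact Finset.sum_congr rfl fun s hs => by rw [gaussInt_basis_eq_hermiteWeight hs]

theorem hermiteWeight_nonneg (n : ℕ) (s : ℝ) : 0 ≤ hermiteWeight n s := by
  unfold hermiteWeight
  positivity

theorem sum_hermiteWeight {n : ℕ} (hn : 0 < n) :
    ∑ s ∈ hermiteNodes n, hermiteWeight n s = √(2 * Real.pi) := by
  have h := gaussInt_eq_sum_hermiteWeight (n := n) (p := 1) (by simp; omega)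
  simpa [gaussInt_one] using h.symm

/-- The quadrature underestimates the moment of order `2n`. -/
theorem sum_hermiteWeight_pow_le (n : ℕ) :
    ∑ s ∈ hermiteNodes n, hermiteWeight n s * s ^ (2 * n) ≤ gaussInt (X ^ (2 * n)) := by
  have hm := hermiteR_monic n
  have hmm : (hermiteR n ^ 2).Monic := hm.pow 2
  have hd2 : (hermiteR n ^ 2).natDegree = 2 * n := by rw [hm.natDegree_pow, natDegree_hermiteR]
  rcases Nat.eq_zero_or_pos n with rfl | hn
  · have : hermiteNodes 0 = ∅ := Finset.card_eq_zero.mp (card_hermiteNodes 0)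
    simp [this, gaussInt_one]
  -- The rule is exact on `X^{2n} - He_n²`, which agrees with `X^{2n}` at the nodes. The defect is
  -- the integral of `He_n²`, which is positive.
  have hd : (X ^ (2 * n) - hermiteR n ^ 2 : ℝ[X]).natDegree < 2 * n := by
    have := degree_sub_lt_left (p := (X ^ (2 * n) : ℝ[X])) (q := hermiteR n ^ 2)
      (by rw [degree_eq_natDegree hmm.ne_zero, hd2, degree_X_pow]) (by simp)
      (by rw [hmm.leadingCoeff, leadingCoeff_X_pow])
    rw [degree_X_pow] at this
    rcases eq_or_ne (X ^ (2 * n) - hermiteR n ^ 2 : ℝ[X]) 0 with h0 | h0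
    · rw [h0, natDegree_zero]; omega
    · exact (natDegree_lt_iff_degree_lt h0).mpr (by exact_mod_cast this)
  have h := gaussInt_eq_sum_hermiteWeight hd
  rw [map_sub] at h
  have hpos : 0 < gaussInt (hermiteR n ^ 2) :=
    gaussInt_pos hmm.ne_zero fun x => by rw [eval_pow]; positivity
  have hs : ∑ s ∈ hermiteNodes n, hermiteWeight n s * (X ^ (2 * n) - hermiteR n ^ 2 : ℝ[X]).eval s =
      ∑ s ∈ hermiteNodes n, hermiteWeight n s * s ^ (2 * n) := by
    refine Finset.sum_congr rfl fun s hs => ?_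
    rw [eval_sub, eval_pow, eval_pow, mem_hermiteNodes.mp hs]
    simp
  linarith

theorem gaussInt_X_pow_even (n : ℕ) :
    gaussInt (X ^ (2 * n)) / (2 * n).factorial = √(2 * Real.pi) / (2 ^ n * n.factorial) := by
  induction n with
  | zero => simp [gaussInt_one]
  | succ n ih =>
    have h : gaussInt (X ^ (2 * (n + 1))) = (2 * n + 1) * gaussInt (X ^ (2 * n)) := by
      rw [show 2 * (n + 1) = 2 * n + 1 + 1 by ring, pow_succ', gaussInt_X_mul, derivative_X_pow,
        C_mul', map_smul, smul_eq_mul]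
      push_cast
      rfl
    rw [h, show 2 * (n + 1) = 2 * n + 1 + 1 by ring, Nat.factorial_succ, Nat.factorial_succ,
      Nat.factorial_succ, pow_succ]
    push_cast
    have e : gaussInt (X ^ (2 * n)) = √(2 * Real.pi) / (2 ^ n * n.factorial) * (2 * n).factorial := by
      rw [← ih]; field_simp
    rw [e]
    field_simp
    ring

/-- Taylor's bound for `exp (c x)` on `x ≥ 0`, for `c` purely imaginary of modulus one. -/
theorem norm_exp_mul_sub_sum_le {c : ℂ} (hc : c.re = 0) (hc1 : ‖c‖ = 1) (n : ℕ) {x : ℝ}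
    (hx : 0 ≤ x) :
    ‖Complex.exp (c * x) - ∑ k ∈ Finset.range n, (c * x) ^ k / k.factorial‖ ≤
      x ^ n / n.factorial := by
  induction n generalizing x with
  | zero => simp [Complex.norm_exp, hc]
  | succ n ih =>
    -- The derivative of one Taylor remainder is `c` times the previous one, so the bound integrates
    -- from `0`, where the remainder vanishes.
    have hd : ∀ y : ℝ, HasDerivAt
        (fun y : ℝ => Complex.exp (c * y) - ∑ k ∈ Finset.range (n + 1), (c * y) ^ k / k.factorial)
        (c * (Complex.exp (c * y) - ∑ k ∈ Finset.range n, (c * y) ^ k / k.factorial)) y := by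
      intro y
      have h1 : HasDerivAt (fun y : ℝ => c * (y : ℂ)) c y := by
        simpa using (Complex.ofRealCLM.hasDerivAt (x := y)).const_mul c
      have h2 : HasDerivAt (fun y : ℝ => ∑ k ∈ Finset.range (n + 1), (c * (y : ℂ)) ^ k / k.factorial)
          (∑ k ∈ Finset.range (n + 1), k * (c * (y : ℂ)) ^ (k - 1) * c / k.factorial) y :=
        HasDerivAt.fun_sum fun k _ => (h1.fun_pow k).div_const (k.factorial : ℂ)
      refine (h1.cexp.sub h2).congr_deriv ?_
      rw [Finset.sum_range_succ', mul_sub, Finset.mul_sum]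
      simp only [Nat.cast_zero, zero_mul, zero_div, add_zero]
      refine congrArg₂ _ (mul_comm _ _) (Finset.sum_congr rfl fun k _ => ?_)
      rw [Nat.factorial_succ, Nat.add_sub_cancel]
      have : ((k : ℂ) + 1) ≠ 0 := by exact_mod_cast Nat.succ_ne_zero k
      push_cast
      field_simp
    have hB : ∀ y : ℝ, HasDerivAt (fun y : ℝ => y ^ (n + 1) / ((n + 1).factorial : ℝ))
        (y ^ n / n.factorial) y := by
      intro y
      refine ((hasDerivAt_pow (n + 1) y).div_const _).congr_deriv ?_
      rw [Nat.factorial_succ, Nat.add_sub_cancel]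
      push_cast
      field_simp
    refine image_norm_le_of_norm_deriv_right_le_deriv_boundary (a := 0) (b := x)
      (fun y _ => (hd y).continuousAt.continuousWithinAt) (fun y _ => (hd y).hasDerivWithinAt)
      ?_ hB (fun y hy => ?_) ⟨hx, le_rfl⟩
    · simp [Finset.sum_range_succ']
    · rw [norm_mul, hc1, one_mul]
      exact ih hy.1

theorem norm_exp_I_mul_sub_sum_le (n : ℕ) (x : ℝ) :
    ‖Complex.exp (Complex.I * x) - ∑ k ∈ Finset.range n, (Complex.I * x) ^ k / k.factorial‖ ≤
      |x| ^ n / n.factorial := by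
  rcases le_total 0 x with hx | hx
  · simpa [abs_of_nonneg hx] using
      norm_exp_mul_sub_sum_le (c := Complex.I) (by simp) (by simp) n hx
  · have := norm_exp_mul_sub_sum_le (c := -Complex.I) (by simp) (by simp) n (neg_nonneg.mpr hx)
    rw [abs_of_nonpos hx]
    simpa using this

/-- Error of Gauss–Hermite quadrature for the characteristic function. -/
theorem norm_integral_exp_sub_sum_le (n : ℕ) (u : ℝ) :
    ‖(∫ x : ℝ, Complex.exp (Complex.I * (u * x : ℝ)) * (Real.exp (-x ^ 2 / 2) : ℝ)) -
        ∑ s ∈ hermiteNodes n, (hermiteWeight n s : ℂ) * Complex.exp (Complex.I * (u * s : ℝ))‖ ≤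
      2 * √(2 * Real.pi) * (u ^ 2 / 2) ^ n / n.factorial := by
  -- `A` is the Taylor remainder after degree `2n - 1`. The Taylor polynomial is integrated exactly
  -- by the rule, so only `A` matters. Its integral and its quadrature sum are both bounded through
  -- the moment of order `2n`, whence the factor `2`.
  set A : ℝ → ℂ := fun x => Complex.exp (Complex.I * (u * x : ℝ)) -
    ∑ k ∈ Finset.range (2 * n), (Complex.I * (u * x : ℝ)) ^ k / k.factorial with hA
  have hAb : ∀ x, ‖A x‖ ≤ u ^ (2 * n) / (2 * n).factorial * x ^ (2 * n) := by
    intro x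
    refine (norm_exp_I_mul_sub_sum_le (2 * n) (u * x)).trans (le_of_eq ?_)
    rw [Even.pow_abs ⟨n, by ring⟩, mul_pow]
    ring
  have hmon : ∀ k, Integrable fun x : ℝ => x ^ k * Real.exp (-x ^ 2 / 2) := fun k => by
    simpa using integrable_eval_mul_gaussian (X ^ k)
  have hterm : ∀ k, Integrable fun x : ℝ =>
      (Complex.I * (u * x : ℝ)) ^ k / k.factorial * (Real.exp (-x ^ 2 / 2) : ℝ) := by
    intro k
    refine (((hmon k).ofReal (𝕜 := ℂ)).const_mul ((Complex.I * u) ^ k / k.factorial)).congr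
      (.of_forall fun x => ?_)
    simp only [mul_pow, Complex.ofReal_mul, Complex.ofReal_pow, Complex.coe_algebraMap]
    ring
  have hAm : Continuous A := by
    simp only [hA]
    fun_prop
  have hexpc : Continuous fun x : ℝ => ((Real.exp (-x ^ 2 / 2) : ℝ) : ℂ) := by fun_prop
  have hAi : Integrable fun x => A x * (Real.exp (-x ^ 2 / 2) : ℝ) := by
    refine ((hmon (2 * n)).const_mul (u ^ (2 * n) / (2 * n).factorial)).mono'
      (hAm.mul hexpc).aestronglyMeasurable (.of_forall fun x => ?_)
    rw [norm_mul, Complex.norm_real, Real.norm_of_nonneg (Real.exp_pos _).le, ← mul_assoc]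
    exact mul_le_mul_of_nonneg_right (hAb x) (Real.exp_pos _).le
  have hsplit : ∀ x : ℝ, Complex.exp (Complex.I * (u * x : ℝ)) =
      A x + ∑ k ∈ Finset.range (2 * n), (Complex.I * (u * x : ℝ)) ^ k / k.factorial := by
    intro x; simp [hA]
  have hint : (∫ x : ℝ, Complex.exp (Complex.I * (u * x : ℝ)) * (Real.exp (-x ^ 2 / 2) : ℝ)) =
      (∫ x : ℝ, A x * (Real.exp (-x ^ 2 / 2) : ℝ)) + ∑ k ∈ Finset.range (2 * n),
        (Complex.I * u) ^ k / k.factorial * (gaussInt (X ^ k) : ℝ) := by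
    simp_rw [hsplit, add_mul, Finset.sum_mul]
    rw [integral_add hAi (integrable_finsetSum _ fun k _ => hterm k),
      integral_finsetSum _ fun k _ => hterm k]
    congr 1
    refine Finset.sum_congr rfl fun k _ => ?_
    rw [gaussInt_apply, ← integral_complex_ofReal, ← integral_const_mul]
    congr 1
    ext x
    simp only [mul_pow, Complex.ofReal_mul, Complex.ofReal_pow, eval_pow, eval_X]
    ring
  have hsum : (∑ s ∈ hermiteNodes n, (hermiteWeight n s : ℂ) * Complex.exp (Complex.I * (u * s : ℝ))) =
      (∑ s ∈ hermiteNodes n, (hermiteWeight n s : ℂ) * A s) + ∑ k ∈ Finset.range (2 * n),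
        (Complex.I * u) ^ k / k.factorial * (gaussInt (X ^ k) : ℝ) := by
    simp_rw [hsplit, mul_add, Finset.sum_add_distrib, Finset.mul_sum]
    rw [Finset.sum_comm]
    congr 1
    refine Finset.sum_congr rfl fun k hk => ?_
    rw [gaussInt_eq_sum_hermiteWeight (n := n)
      (by rw [natDegree_X_pow]; exact Finset.mem_range.mp hk), Complex.ofReal_sum, Finset.mul_sum]
    refine Finset.sum_congr rfl fun s _ => ?_
    simp only [mul_pow, Complex.ofReal_mul, Complex.ofReal_pow, eval_pow, eval_X]
    ring
  have hfac : u ^ (2 * n) / (2 * n).factorial * gaussInt (X ^ (2 * n)) =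
      √(2 * Real.pi) * (u ^ 2 / 2) ^ n / n.factorial := by
    have := gaussInt_X_pow_even n
    rw [div_mul_eq_mul_div, mul_div_assoc, this, pow_mul, div_pow]
    field_simp
  have hb1 : ‖∫ x : ℝ, A x * (Real.exp (-x ^ 2 / 2) : ℝ)‖ ≤
      √(2 * Real.pi) * (u ^ 2 / 2) ^ n / n.factorial := by
    rw [← hfac, gaussInt_apply, ← integral_const_mul]
    refine norm_integral_le_of_norm_le ?_ (.of_forall fun x => ?_)
    · simpa using (hmon (2 * n)).const_mul (u ^ (2 * n) / (2 * n).factorial)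
    · rw [norm_mul, Complex.norm_real, Real.norm_of_nonneg (Real.exp_pos _).le, ← mul_assoc, eval_pow,
        eval_X]
      exact mul_le_mul_of_nonneg_right (hAb x) (Real.exp_pos _).le
  have hb2 : ‖∑ s ∈ hermiteNodes n, (hermiteWeight n s : ℂ) * A s‖ ≤
      √(2 * Real.pi) * (u ^ 2 / 2) ^ n / n.factorial := by
    refine (norm_sum_le _ _).trans ?_
    rw [← hfac]
    refine le_trans ?_ (mul_le_mul_of_nonneg_left (sum_hermiteWeight_pow_le n)
      (div_nonneg (Even.pow_nonneg ⟨n, by ring⟩ _) (Nat.cast_nonneg _)))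
    rw [Finset.mul_sum]
    refine Finset.sum_le_sum fun s _ => ?_
    rw [norm_mul, Complex.norm_real, Real.norm_of_nonneg (hermiteWeight_nonneg n s)]
    calc _ ≤ hermiteWeight n s * (u ^ (2 * n) / (2 * n).factorial * s ^ (2 * n)) :=
          mul_le_mul_of_nonneg_left (hAb s) (hermiteWeight_nonneg n s)
      _ = _ := by ring
  rw [hint, hsum, add_sub_add_right_eq_sub]
  refine (norm_sub_le _ _).trans ((add_le_add hb1 hb2).trans (le_of_eq ?_))
  ring

end PrivateGPBandit

end

noncomputable section
namespace PrivateGPBandit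

/-! ### Approximation by quadrature Fourier features -/

/-- The Fourier transform of `exp(-x²/2)`. -/
def gaussFT (u : ℝ) : ℂ :=
  ∫ x : ℝ, Complex.exp (Complex.I * (u * x : ℝ)) * (Real.exp (-x ^ 2 / 2) : ℝ)

/-- The quadrature approximation of `gaussFT`. -/
def quadFT (n : ℕ) (u : ℝ) : ℂ :=
  ∑ s ∈ hermiteNodes n, (hermiteWeight n s : ℂ) * Complex.exp (Complex.I * (u * s : ℝ))

theorem norm_gaussFT_le (u : ℝ) : ‖gaussFT u‖ ≤ √(2 * Real.pi) := by
  rw [← gaussInt_one, gaussInt_apply]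
  refine norm_integral_le_of_norm_le (integrable_eval_mul_gaussian 1) (.of_forall fun x => ?_)
  rw [norm_mul, mul_comm Complex.I, Complex.norm_exp_ofReal_mul_I, Complex.norm_real,
    Real.norm_of_nonneg (Real.exp_pos _).le, Polynomial.eval_one]

theorem norm_quadFT_le {n : ℕ} (hn : 0 < n) (u : ℝ) : ‖quadFT n u‖ ≤ √(2 * Real.pi) := by
  rw [← sum_hermiteWeight hn]
  refine (norm_sum_le _ _).trans (Finset.sum_le_sum fun s _ => le_of_eq ?_)
  rw [norm_mul, mul_comm Complex.I, Complex.norm_exp_ofReal_mul_I, Complex.norm_real,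
    Real.norm_of_nonneg (hermiteWeight_nonneg n s), mul_one]

theorem gaussFT_zero : gaussFT 0 = √(2 * Real.pi) := by
  rw [← gaussInt_one, gaussInt_apply, ← integral_complex_ofReal]
  simp [gaussFT]

theorem continuous_gaussFT : Continuous gaussFT := by
  refine continuous_of_dominated (bound := fun x => Real.exp (-x ^ 2 / 2)) ?_ ?_ ?_ ?_
  · intro u
    exact (by fun_prop : Continuous fun x : ℝ => Complex.exp (Complex.I * (u * x : ℝ)) *
      (Real.exp (-x ^ 2 / 2) : ℝ)).aestronglyMeasurable
  · intro u
    refine .of_forall fun x => le_of_eq ?_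
    rw [norm_mul, mul_comm Complex.I, Complex.norm_exp_ofReal_mul_I, Complex.norm_real,
      Real.norm_of_nonneg (Real.exp_pos _).le, one_mul]
  · simpa using integrable_eval_mul_gaussian 1
  · exact .of_forall fun x => by fun_prop

theorem norm_prod_sub_prod_le_sum {ι : Type*} (s : Finset ι) (A B : ι → ℂ)
    (hA : ∀ i ∈ s, ‖A i‖ ≤ 1) (hB : ∀ i ∈ s, ‖B i‖ ≤ 1) :
    ‖∏ i ∈ s, A i - ∏ i ∈ s, B i‖ ≤ ∑ i ∈ s, ‖A i - B i‖ := by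
  induction s using Finset.cons_induction with
  | empty => simp
  | cons i s hi ih =>
    rw [Finset.prod_cons, Finset.prod_cons, Finset.sum_cons]
    have h1 := ih (fun j hj => hA j (Finset.mem_cons_of_mem hj))
      (fun j hj => hB j (Finset.mem_cons_of_mem hj))
    have h2 : ‖∏ j ∈ s, A j‖ ≤ 1 := by
      rw [norm_prod]
      exact Finset.prod_le_one (fun _ _ => norm_nonneg _)
        (fun j hj => hA j (Finset.mem_cons_of_mem hj))
    have h3 := hB i (Finset.mem_cons_self i s)
    calc _ = ‖(A i - B i) * ∏ j ∈ s, A j + B i * (∏ j ∈ s, A j - ∏ j ∈ s, B j)‖ := by ring_nf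
      _ ≤ ‖A i - B i‖ * ‖∏ j ∈ s, A j‖ + ‖B i‖ * ‖∏ j ∈ s, A j - ∏ j ∈ s, B j‖ := by
        refine (norm_add_le _ _).trans ?_
        rw [norm_mul, norm_mul]
      _ ≤ ‖A i - B i‖ * 1 + 1 * ∑ j ∈ s, ‖A j - B j‖ := by gcongr
      _ = _ := by ring

variable {d : ℕ} {k : (Fin d → ℝ) → (Fin d → ℝ) → ℝ} {a ν : Fin d → ℝ}

/-- The cosine is the real part of a product of exponentials, so Fubini factors the integral.
Rescaling each variable by `ν_j` leaves the standard Gaussian transform. -/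
theorem IsDecomposable.eq_re_prod (hk : IsDecomposable k (gaussianSpectrum a ν))
    (hν : ∀ j, 0 < ν j) (x y : Fin d → ℝ) :
    k x y = (∏ j, ((a j / ν j : ℝ) : ℂ) * gaussFT ((x j - y j) / ν j)).re := by
  have h1 : ∀ j, ∫ w : ℝ, (gaussianSpectrum a ν j w : ℂ) *
      Complex.exp (Complex.I * (w * (x j - y j) : ℝ)) =
      ((a j / ν j : ℝ) : ℂ) * gaussFT ((x j - y j) / ν j) := by
    intro j
    have h := Measure.integral_comp_mul_left (fun s : ℝ =>
      Complex.exp (Complex.I * ((x j - y j) / ν j * s : ℝ)) * (Real.exp (-s ^ 2 / 2) : ℝ)) (ν j)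
    rw [abs_of_pos (inv_pos.mpr (hν j))] at h
    rw [gaussFT, Complex.ofReal_div, div_eq_mul_inv, mul_assoc, ← Complex.ofReal_inv,
      ← Complex.real_smul (x := (ν j)⁻¹), ← h, ← integral_const_mul]
    congr 1
    ext w
    rw [gaussianSpectrum, Complex.ofReal_mul, mul_assoc]
    congr 1
    rw [mul_comm]
    have := (hν j).ne'
    congr 3
    · congr 1
      field_simp
    · ring
  rw [hk.fourier x y]
  simp_rw [← h1]
  rw [← integral_fintype_prod_volume_eq_prod (fun j (w : ℝ) => (gaussianSpectrum a ν j w : ℂ) *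
      Complex.exp (Complex.I * (w * (x j - y j) : ℝ)))]
  have hint : Integrable fun w : Fin d → ℝ => ∏ j, (gaussianSpectrum a ν j (w j) : ℂ) *
      Complex.exp (Complex.I * (w j * (x j - y j) : ℝ)) := by
    refine Integrable.fintype_prod (f := fun j (w : ℝ) => (gaussianSpectrum a ν j w : ℂ) *
      Complex.exp (Complex.I * (w * (x j - y j) : ℝ))) fun j => ?_
    refine ((hk.integrable j).ofReal (𝕜 := ℂ)).mul_bdd (c := 1)
      (by fun_prop : Continuous fun w : ℝ =>
        Complex.exp (Complex.I * (w * (x j - y j) : ℝ))).aestronglyMeasurable ?_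
    refine .of_forall fun w => ?_
    rw [mul_comm Complex.I, Complex.norm_exp_ofReal_mul_I]
  have hre := integral_re hint
  simp only [RCLike.re_eq_complex_re] at hre
  rw [← hre]
  congr 1
  ext w
  rw [Finset.prod_mul_distrib, ← Complex.exp_sum, ← Complex.ofReal_prod, ← Finset.mul_sum,
    ← Complex.ofReal_sum, Complex.re_ofReal_mul, mul_comm Complex.I, Complex.exp_ofReal_mul_I_re]

theorem IsDecomposable.self_eq (hk : IsDecomposable k (gaussianSpectrum a ν))
    (hν : ∀ j, 0 < ν j) (x : Fin d → ℝ) : k x x = ∏ j, a j / ν j * √(2 * Real.pi) := by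
  rw [hk.eq_re_prod hν]
  simp only [sub_self, zero_div, gaussFT_zero, ← Complex.ofReal_mul, ← Complex.ofReal_prod,
    Complex.ofReal_re]

theorem IsDecomposable.continuous (hk : IsDecomposable k (gaussianSpectrum a ν))
    (hν : ∀ j, 0 < ν j) : Continuous fun z : (Fin d → ℝ) × (Fin d → ℝ) => k z.1 z.2 := by
  simp_rw [hk.eq_re_prod hν]
  have := continuous_gaussFT
  fun_prop

theorem qff_dotProduct (ha : ∀ j, 0 < a j) (hν : ∀ j, 0 < ν j) (n : ℕ) (x y : Fin d → ℝ) :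
    qff a ν n x ⬝ᵥ qff a ν n y =
      (∏ j, ((a j / ν j : ℝ) : ℂ) * quadFT n ((x j - y j) / ν j)).re := by
  have h1 : ∀ g : Fin d → ↥(hermiteNodes n), 0 ≤ ∏ j, a j / ν j * hermiteWeight n (g j) :=
    fun g => Finset.prod_nonneg fun j _ =>
      mul_nonneg (div_nonneg (ha j).le (hν j).le) (hermiteWeight_nonneg n _)
  have h2 : ∀ j, ((a j / ν j : ℝ) : ℂ) * quadFT n ((x j - y j) / ν j) =
      ∑ s : ↥(hermiteNodes n), ((a j / ν j * hermiteWeight n s : ℝ) : ℂ) *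
        Complex.exp (Complex.I * ((s : ℝ) / ν j * x j - (s : ℝ) / ν j * y j : ℝ)) := by
    intro j
    rw [quadFT, ← Finset.sum_coe_sort, Finset.mul_sum]
    refine Finset.sum_congr rfl fun s _ => ?_
    rw [Complex.ofReal_mul (a j / ν j), mul_assoc]
    congr 3
    push_cast
    ring
  simp_rw [h2]
  rw [Finset.prod_univ_sum, Fintype.piFinset_univ, Complex.re_sum, dotProduct,
    Fintype.sum_prod_type]
  refine Finset.sum_congr rfl fun g _ => ?_
  rw [Fintype.sum_bool, Finset.prod_mul_distrib, ← Complex.ofReal_prod, ← Complex.exp_sum,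
    ← Finset.mul_sum, ← Complex.ofReal_sum, Complex.re_ofReal_mul, mul_comm Complex.I,
    Complex.exp_ofReal_mul_I_re, Finset.sum_sub_distrib, Real.cos_sub]
  simp only [qff, if_true, Bool.false_eq_true, if_false]
  nth_rewrite 5 [← Real.mul_self_sqrt (h1 g)]
  ring

theorem qff_dotProduct_self (ha : ∀ j, 0 < a j) (hν : ∀ j, 0 < ν j) {n : ℕ} (hn : 0 < n)
    (x : Fin d → ℝ) : qff a ν n x ⬝ᵥ qff a ν n x = ∏ j, a j / ν j * √(2 * Real.pi) := by
  rw [qff_dotProduct ha hν]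
  have : quadFT n 0 = √(2 * Real.pi) := by
    rw [← sum_hermiteWeight hn, Complex.ofReal_sum]
    simp [quadFT]
  simp only [sub_self, zero_div, this, ← Complex.ofReal_mul, ← Complex.ofReal_prod,
    Complex.ofReal_re]

/-- Dividing each factor by `√(2π)` leaves two products of numbers of modulus at most one, with the
common prefactor `k(0,0) ≤ 1`. Telescoping then bounds the error by the sum of the one-dimensional
quadrature errors. -/
theorem abs_kernel_sub_qff_le (hk : IsDecomposable k (gaussianSpectrum a ν))
    (ha : ∀ j, 0 < a j) (hν : ∀ j, 0 < ν j) {n : ℕ} (hn : 0 < n) {x y : Fin d → ℝ}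
    (hxy : ∀ j, |x j - y j| ≤ 1) :
    |k x y - qff a ν n x ⬝ᵥ qff a ν n y| ≤
      ∑ j, 2 * (1 / (2 * ν j ^ 2)) ^ n / n.factorial := by
  set c : ℝ := √(2 * Real.pi) with hc
  have hc0 : 0 < c := by positivity
  rw [hk.eq_re_prod hν, qff_dotProduct ha hν, ← Complex.sub_re]
  refine (Complex.abs_re_le_norm _).trans ?_
  have hA : ∀ (F : ℝ → ℂ), (∏ j, ((a j / ν j : ℝ) : ℂ) * F ((x j - y j) / ν j)) =
      ((∏ j, a j / ν j * c : ℝ) : ℂ) * ∏ j, F ((x j - y j) / ν j) / c := by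
    intro F
    rw [Complex.ofReal_prod, ← Finset.prod_mul_distrib]
    refine Finset.prod_congr rfl fun j _ => ?_
    have : (c : ℂ) ≠ 0 := by exact_mod_cast hc0.ne'
    push_cast
    field_simp
  have h1 : 0 ≤ ∏ j, a j / ν j * c := Finset.prod_nonneg fun j _ =>
    mul_nonneg (div_nonneg (ha j).le (hν j).le) hc0.le
  have h2 : ∏ j, a j / ν j * c ≤ 1 := by
    rw [hc, ← hk.self_eq hν 0]
    exact hk.le_one 0 0
  rw [hA, hA, ← mul_sub, norm_mul, Complex.norm_real, Real.norm_of_nonneg h1]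
  have hb : ∀ z : ℂ, ‖z‖ ≤ c → ‖z / c‖ ≤ 1 := by
    intro z hz
    rw [norm_div, Complex.norm_real, Real.norm_of_nonneg hc0.le]
    exact (div_le_one hc0).mpr hz
  refine (mul_le_of_le_one_left (norm_nonneg _) h2).trans
    ((norm_prod_sub_prod_le_sum _ _ _ (fun j _ => hb _ (norm_gaussFT_le _))
      fun j _ => hb _ (norm_quadFT_le hn _)).trans (Finset.sum_le_sum fun j _ => ?_))
  rw [← sub_div, norm_div, Complex.norm_real, Real.norm_of_nonneg hc0.le, div_le_iff₀ hc0]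
  refine (norm_integral_exp_sub_sum_le n _).trans ?_
  have h3 : ((x j - y j) / ν j) ^ 2 / 2 ≤ 1 / (2 * ν j ^ 2) := by
    have : (x j - y j) ^ 2 ≤ 1 := by
      have := hxy j
      rw [← sq_abs]
      exact pow_le_one₀ (abs_nonneg _) this
    rw [div_pow, div_div, mul_comm (2 : ℝ)]
    exact div_le_div_of_nonneg_right this (mul_nonneg (sq_nonneg _) zero_le_two)
  calc 2 * √(2 * Real.pi) * (((x j - y j) / ν j) ^ 2 / 2) ^ n / n.factorial
      ≤ 2 * √(2 * Real.pi) * (1 / (2 * ν j ^ 2)) ^ n / n.factorial := by gcongr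
    _ = _ := by rw [← hc]; ring

/-- The constant in the bound for the approximation error of the features. -/
def epsConst (ν : Fin d → ℝ) : ℝ := ∑ j, 2 * Real.exp (Real.exp 2 / (2 * ν j ^ 2))

theorem epsConst_nonneg (ν : Fin d → ℝ) : 0 ≤ epsConst ν :=
  Finset.sum_nonneg fun _ _ => by positivity

/-- From `y^n / n! ≤ e^y` at `y = e² c`. The factor `exp(-2n)` is what becomes `T⁻¹²` when `n ≥ 6
log T`. -/
theorem pow_div_factorial_le (c : ℝ) (hc : 0 ≤ c) (n : ℕ) :
    c ^ n / n.factorial ≤ Real.exp (Real.exp 2 * c) * Real.exp (-(2 * n)) := by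
  have h := Real.pow_div_factorial_le_exp _ (mul_nonneg (Real.exp_pos 2).le hc) n
  rw [mul_pow, ← Real.exp_nat_mul] at h
  have h2 := mul_le_mul_of_nonneg_right h (Real.exp_pos (-(2 * n : ℝ))).le
  refine le_trans (le_of_eq ?_) h2
  have : Real.exp (n * 2 : ℝ) * Real.exp (-(2 * n : ℝ)) = 1 := by
    rw [← Real.exp_add]
    ring_nf
    simp
  rw [mul_div_assoc, mul_right_comm, this, one_mul]

namespace Params

theorem order_pos (P : Params d) (hT : 2 ≤ P.T) : 0 < P.order := by
  have : (1 : ℝ) < P.T := by exact_mod_cast hT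
  have := Real.log_pos this
  exact Nat.ceil_pos.mpr (by positivity)

theorem log_le_order (P : Params d) : 6 * Real.log P.T ≤ P.order := Nat.le_ceil _

theorem abs_kernel_sub_feat_le (P : Params d) (hk : IsDecomposable P.k (gaussianSpectrum P.a P.ν))
    (ha : ∀ j, 0 < P.a j) (hν : ∀ j, 0 < P.ν j) (hT : 2 ≤ P.T) (x y : Cube d) :
    |P.k x y - P.feat x ⬝ᵥ P.feat y| ≤ epsConst P.ν / (P.T : ℝ) ^ 12 := by
  have hT0 : (0 : ℝ) < P.T := by exact_mod_cast (by omega : 0 < P.T)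
  refine (abs_kernel_sub_qff_le hk ha hν (P.order_pos hT) fun j => ?_).trans ?_
  · have hx := x.2.1 j
    have hx1 := x.2.2 j
    have hy := y.2.1 j
    have hy1 := y.2.2 j
    simp only [Pi.zero_apply, Pi.one_apply] at hx hx1 hy hy1
    rw [abs_le]
    constructor <;> linarith
  · rw [epsConst, Finset.sum_div]
    refine Finset.sum_le_sum fun j _ => ?_
    have h := pow_div_factorial_le (1 / (2 * P.ν j ^ 2)) (by positivity) P.order
    have h2 : Real.exp (-(2 * P.order : ℝ)) ≤ 1 / (P.T : ℝ) ^ 12 := by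
      have : (P.T : ℝ) ^ 12 = Real.exp (12 * Real.log P.T) := by
        rw [show (12 : ℝ) = ((12 : ℕ) : ℝ) by norm_num, Real.exp_nat_mul, Real.exp_log hT0]
      rw [this, one_div, ← Real.exp_neg]
      refine Real.exp_le_exp.mpr ?_
      have := P.log_le_order
      linarith
    calc _ = 2 * ((1 / (2 * P.ν j ^ 2)) ^ P.order / P.order.factorial) := by ring
      _ ≤ 2 * (Real.exp (Real.exp 2 * (1 / (2 * P.ν j ^ 2))) * (1 / (P.T : ℝ) ^ 12)) := by
        refine mul_le_mul_of_nonneg_left (h.trans ?_) zero_le_two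
        gcongr
      _ = _ := by rw [mul_one_div (Real.exp 2)]; ring

theorem bddAbove_kernel_sub_feat (P : Params d)
    (hk : IsDecomposable P.k (gaussianSpectrum P.a P.ν))
    (ha : ∀ j, 0 < P.a j) (hν : ∀ j, 0 < P.ν j) (hT : 2 ≤ P.T) :
    BddAbove (Set.range fun xy : Cube d × Cube d =>
      |P.k xy.1 xy.2 - P.feat xy.1 ⬝ᵥ P.feat xy.2|) :=
  ⟨_, by rintro _ ⟨xy, rfl⟩; exact P.abs_kernel_sub_feat_le hk ha hν hT xy.1 xy.2⟩

theorem ε_nonneg (P : Params d) : 0 ≤ P.ε := Real.iSup_nonneg fun _ => abs_nonneg _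

theorem ε_le (P : Params d) (hk : IsDecomposable P.k (gaussianSpectrum P.a P.ν))
    (ha : ∀ j, 0 < P.a j) (hν : ∀ j, 0 < P.ν j) (hT : 2 ≤ P.T) :
    P.ε ≤ epsConst P.ν / (P.T : ℝ) ^ 12 := by
  refine Real.iSup_le (fun xy => P.abs_kernel_sub_feat_le hk ha hν hT xy.1 xy.2) ?_
  have := epsConst_nonneg P.ν
  positivity

theorem feat_dotProduct_self_le (P : Params d)
    (hk : IsDecomposable P.k (gaussianSpectrum P.a P.ν))
    (ha : ∀ j, 0 < P.a j) (hν : ∀ j, 0 < P.ν j) (hT : 2 ≤ P.T) (x : Cube d) :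
    P.feat x ⬝ᵥ P.feat x ≤ 1 := by
  rw [feat, qff_dotProduct_self ha hν (P.order_pos hT), ← hk.self_eq hν 0]
  exact hk.le_one 0 0

theorem card_idx (P : Params d) : Fintype.card P.Idx = P.m := by
  simp [Idx, m, card_hermiteNodes, mul_comm]

theorem continuous_feat (P : Params d) : Continuous P.feat := by
  unfold feat qff
  refine continuous_pi fun i => ?_
  have h : ∀ j, Continuous fun x : Cube d => (x : Fin d → ℝ) j :=
    fun j => (continuous_apply j).comp continuous_subtype_val
  have h2 : Continuous fun x : Cube d => ∑ j, (i.1 j : ℝ) / P.ν j * (x : Fin d → ℝ) j :=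
    continuous_finsetSum _ fun j _ => (h j).const_mul _
  split_ifs
  · exact (Real.continuous_cos.comp h2).const_mul _
  · exact (Real.continuous_sin.comp h2).const_mul _

end Params
end PrivateGPBandit

end

noncomputable section
namespace PrivateGPBandit
open Matrix
set_option linter.unusedSectionVars false

/-! ### Positive definite matrices -/

section LinearAlgebra

variable {ι κ : Type*} [Fintype ι] [DecidableEq ι] [Fintype κ] [DecidableEq κ]

theorem one_add_sum_le_prod_one_add {s : Finset ι} {f : ι → ℝ} (hf : ∀ i ∈ s, 0 ≤ f i) :
    1 + ∑ i ∈ s, f i ≤ ∏ i ∈ s, (1 + f i) := by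
  induction s using Finset.cons_induction with
  | empty => simp
  | cons i s hi ih =>
    rw [Finset.sum_cons, Finset.prod_cons]
    have h1 := ih fun j hj => hf j (Finset.mem_cons_of_mem hj)
    have h2 := hf i (Finset.mem_cons_self i s)
    have h3 : 0 ≤ ∑ j ∈ s, f j := Finset.sum_nonneg fun j hj => hf j (Finset.mem_cons_of_mem hj)
    nlinarith

/-- The determinant is `∏ (1 + λ_i)` with `λ_i ≥ 0`, read off from the characteristic polynomial at
`-1`. -/
theorem one_add_trace_le_det_one_add {A : Matrix ι ι ℝ} (hA : A.PosSemidef) :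
    1 + A.trace ≤ (1 + A).det := by
  have hdet : (1 + A).det = ∏ i, (1 + hA.1.eigenvalues i) := by
    have h := congrArg (Polynomial.eval (-1)) hA.1.charpoly_eq
    rw [Matrix.eval_charpoly, Polynomial.eval_prod] at h
    have h1 : Matrix.scalar ι (-1 : ℝ) - A = -(1 + A) := by
      rw [map_neg, map_one]; abel
    have h2 : ∀ i, Polynomial.eval (-1) (Polynomial.X - Polynomial.C (hA.1.eigenvalues i : ℝ)) =
        -1 * (1 + hA.1.eigenvalues i) := fun i => by simp; ring
    rw [h1, Matrix.det_neg] at h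
    simp only [RCLike.ofReal_real_eq_id, id_eq, h2] at h
    rw [Finset.prod_mul_distrib, Finset.prod_const, Finset.card_univ] at h
    exact mul_left_cancel₀ (pow_ne_zero _ (by norm_num)) h
  rw [hdet, hA.1.trace_eq_sum_eigenvalues]
  exact one_add_sum_le_prod_one_add fun i _ => hA.eigenvalues_nonneg i

theorem one_le_det_one_add {A : Matrix ι ι ℝ} (hA : A.PosSemidef) : 1 ≤ (1 + A).det :=
  le_trans (by linarith [hA.trace_nonneg]) (one_add_trace_le_det_one_add hA)

open scoped MatrixOrder in
theorem exists_eq_transpose_mul_self {B : Matrix ι ι ℝ} (hB : B.PosSemidef) :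
    ∃ C : Matrix ι ι ℝ, B = Cᵀ * C := by
  obtain ⟨C, rfl⟩ := CStarAlgebra.nonneg_iff_eq_star_mul_self.mp hB.nonneg
  exact ⟨C, rfl⟩

/-- Writing `B = Cᵀ C`, the determinant grows by the factor `det(1 + C A⁻¹ Cᵀ) ≥ 1`. -/
theorem det_le_det_add {A B : Matrix ι ι ℝ} (hA : A.PosDef) (hB : B.PosSemidef) :
    A.det ≤ (A + B).det := by
  obtain ⟨C, rfl⟩ := exists_eq_transpose_mul_self hB
  rw [det_add_mul _ _ hA.det_pos.ne'.isUnit]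
  refine le_mul_of_one_le_right hA.det_pos.le (one_le_det_one_add ?_)
  exact hA.inv.posSemidef.mul_mul_conjTranspose_same C

theorem det_le_det_of_posSemidef_sub {A B : Matrix ι ι ℝ} (hA : A.PosDef)
    (hB : (B - A).PosSemidef) : A.det ≤ B.det := by
  have := det_le_det_add hA hB
  rwa [add_sub_cancel] at this

/-- The quadratic form `x ↦ x ⬝ᵥ A *ᵥ x`. -/
def quad (A : Matrix ι ι ℝ) (x : ι → ℝ) : ℝ := x ⬝ᵥ A *ᵥ x

theorem quad_nonneg {A : Matrix ι ι ℝ} (hA : A.PosSemidef) (x : ι → ℝ) : 0 ≤ quad A x := by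
  simpa [quad] using hA.dotProduct_mulVec_nonneg x

theorem dotProduct_mulVec_comm {A : Matrix ι ι ℝ} (hA : A.IsHermitian) (x y : ι → ℝ) :
    x ⬝ᵥ A *ᵥ y = y ⬝ᵥ A *ᵥ x := by
  rw [dotProduct_comm, ← vecMul_transpose, dotProduct_mulVec, show Aᵀ = A from hA]

theorem quad_add {A : Matrix ι ι ℝ} (hA : A.IsHermitian) (x y : ι → ℝ) :
    quad A (x + y) = quad A x + 2 * (x ⬝ᵥ A *ᵥ y) + quad A y := by
  simp only [quad, mulVec_add, dotProduct_add, add_dotProduct]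
  rw [dotProduct_mulVec_comm hA y x]
  ring

theorem quad_smul (A : Matrix ι ι ℝ) (c : ℝ) (x : ι → ℝ) : quad A (c • x) = c ^ 2 * quad A x := by
  simp only [quad, mulVec_smul, dotProduct_smul, smul_dotProduct, smul_eq_mul]
  ring

theorem quad_sub {A : Matrix ι ι ℝ} (hA : A.IsHermitian) (x y : ι → ℝ) :
    quad A (x - y) = quad A x - 2 * (x ⬝ᵥ A *ᵥ y) + quad A y := by
  have h1 : x - y = x + (-1 : ℝ) • y := by simp [sub_eq_add_neg]
  rw [h1, quad_add hA, quad_smul, mulVec_smul, dotProduct_smul, smul_eq_mul]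
  ring

theorem quad_add_left (A B : Matrix ι ι ℝ) (x : ι → ℝ) :
    quad (A + B) x = quad A x + quad B x := by
  simp [quad, add_mulVec, dotProduct_add]

theorem quad_sub_left (A B : Matrix ι ι ℝ) (x : ι → ℝ) :
    quad (A - B) x = quad A x - quad B x := by
  simp [quad, sub_mulVec, dotProduct_sub]

theorem quad_smul_one (c : ℝ) (x : ι → ℝ) :
    quad (c • (1 : Matrix ι ι ℝ)) x = c * (x ⬝ᵥ x) := by
  simp [quad, smul_mulVec, dotProduct_smul]

theorem quad_vecMulVec (u x : ι → ℝ) : quad (vecMulVec u u) x = (u ⬝ᵥ x) ^ 2 := by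
  rw [quad, vecMulVec_mulVec]
  simp [dotProduct_comm x u, sq]

theorem quad_sum {τ : Type*} (s : Finset τ) (A : τ → Matrix ι ι ℝ) (x : ι → ℝ) :
    quad (∑ i ∈ s, A i) x = ∑ i ∈ s, quad (A i) x := by
  simp [quad, sum_mulVec, dotProduct_sum]

theorem posSemidef_sub_of_quad_le {A B : Matrix ι ι ℝ} (hA : A.IsHermitian) (hB : B.IsHermitian)
    (h : ∀ x, quad A x ≤ quad B x) : (B - A).PosSemidef := by
  refine .of_dotProduct_mulVec_nonneg (hB.sub hA) fun x => ?_
  have := h x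
  have h2 := quad_sub_left B A x
  simp only [star_trivial]
  change 0 ≤ quad (B - A) x
  linarith

/-- The Cauchy–Schwarz inequality for a positive semidefinite matrix. -/
theorem abs_dotProduct_mulVec_le {A : Matrix ι ι ℝ} (hA : A.PosSemidef) (x y : ι → ℝ) :
    |x ⬝ᵥ A *ᵥ y| ≤ √(quad A x) * √(quad A y) := by
  rw [← Real.sqrt_mul (quad_nonneg hA x)]
  refine Real.abs_le_sqrt ?_
  have h := fun t : ℝ => quad_nonneg hA (t • x + y)
  simp only [quad_add hA.1, quad_smul, smul_dotProduct, smul_eq_mul] at h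
  have := discrim_le_zero (a := quad A x) (b := 2 * (x ⬝ᵥ A *ᵥ y)) (c := quad A y)
    fun t => by nlinarith [h t]
  rw [discrim] at this
  nlinarith

theorem sqrt_quad_add_le {A : Matrix ι ι ℝ} (hA : A.PosSemidef) (x y : ι → ℝ) :
    √(quad A (x + y)) ≤ √(quad A x) + √(quad A y) := by
  refine Real.sqrt_le_iff.mpr ⟨by positivity, ?_⟩
  have h := (le_abs_self _).trans (abs_dotProduct_mulVec_le hA x y)
  rw [quad_add hA.1, add_sq, Real.sq_sqrt (quad_nonneg hA x), Real.sq_sqrt (quad_nonneg hA y)]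
  linarith

theorem sqrt_quad_sum_le {A : Matrix ι ι ℝ} (hA : A.PosSemidef) {τ : Type*} (s : Finset τ)
    (x : τ → ι → ℝ) : √(quad A (∑ i ∈ s, x i)) ≤ ∑ i ∈ s, √(quad A (x i)) := by
  induction s using Finset.cons_induction with
  | empty => simp [quad]
  | cons i s hi ih =>
    rw [Finset.sum_cons, Finset.sum_cons]
    exact (sqrt_quad_add_le hA _ _).trans (by gcongr)

theorem mulVec_inv_mulVec {V : Matrix ι ι ℝ} (hV : V.PosDef) (x : ι → ℝ) :
    V *ᵥ (V⁻¹ *ᵥ x) = x := by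
  rw [mulVec_mulVec, mul_nonsing_inv _ hV.det_pos.ne'.isUnit, one_mulVec]

theorem inv_mulVec_eq_iff {V : Matrix ι ι ℝ} (hV : V.PosDef) {x z : ι → ℝ} (h : V *ᵥ z = x) :
    V⁻¹ *ᵥ x = z := by
  rw [← h, mulVec_mulVec, nonsing_inv_mul _ hV.det_pos.ne'.isUnit, one_mulVec]

theorem quad_inv_mulVec {V : Matrix ι ι ℝ} (hV : V.PosDef) (x : ι → ℝ) :
    quad V (V⁻¹ *ᵥ x) = quad V⁻¹ x := by
  rw [quad, mulVec_inv_mulVec hV, dotProduct_comm]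
  rfl

/-- If `H ≤ V` then `H V⁻¹ H ≤ H`. -/
theorem quad_inv_mulVec_le {V H : Matrix ι ι ℝ} (hV : V.PosDef) (hH : H.PosSemidef)
    (h : ∀ x, quad H x ≤ quad V x) (θ : ι → ℝ) : quad V⁻¹ (H *ᵥ θ) ≤ quad H θ := by
  -- The form to bound equals both `zᵀHθ` and `zᵀVz`, and `zᵀHz ≤ zᵀVz`. Expanding `(z - θ)ᵀ H (z -
  -- θ) ≥ 0` then gives the claim.
  set z := V⁻¹ *ᵥ (H *ᵥ θ) with hz
  have h1 : quad V⁻¹ (H *ᵥ θ) = z ⬝ᵥ H *ᵥ θ := by rw [quad, hz, dotProduct_comm]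
  have h2 : quad V z = quad V⁻¹ (H *ᵥ θ) := quad_inv_mulVec hV _
  have h3 := quad_nonneg hH (z - θ)
  rw [quad_sub hH.1] at h3
  have h4 := h z
  linarith

/-- Antitonicity of the inverse: the preceding inequality with `H = W` and `θ = W⁻¹ x`. -/
theorem quad_inv_le_quad_inv {V W : Matrix ι ι ℝ} (hV : V.PosDef) (hW : W.PosDef)
    (h : ∀ x, quad W x ≤ quad V x) (x : ι → ℝ) : quad V⁻¹ x ≤ quad W⁻¹ x := by
  have h1 := quad_inv_mulVec_le hV hW.posSemidef h (W⁻¹ *ᵥ x)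
  rwa [mulVec_inv_mulVec hW, quad_inv_mulVec hW] at h1

theorem posDef_smul_one {c : ℝ} (hc : 0 < c) : (c • (1 : Matrix ι ι ℝ)).PosDef :=
  PosDef.one.smul hc

theorem quad_inv_le_div {V : Matrix ι ι ℝ} (hV : V.PosDef) {c : ℝ} (hc : 0 < c)
    (h : ∀ x, c * (x ⬝ᵥ x) ≤ quad V x) (x : ι → ℝ) : quad V⁻¹ x ≤ (x ⬝ᵥ x) / c := by
  have h1 := quad_inv_le_quad_inv hV (posDef_smul_one hc)
    (fun x => by rw [quad_smul_one]; exact h x) x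
  have h2 : (c • (1 : Matrix ι ι ℝ))⁻¹ *ᵥ x = c⁻¹ • x :=
    inv_mulVec_eq_iff (posDef_smul_one hc) (by
      rw [smul_mulVec, one_mulVec, smul_smul, mul_inv_cancel₀ hc.ne', one_smul])
  refine h1.trans (le_of_eq ?_)
  rw [quad, h2, dotProduct_smul, smul_eq_mul, inv_mul_eq_div]

theorem posSemidef_vecMulVec (u : ι → ℝ) : (vecMulVec u u).PosSemidef := by
  simpa using posSemidef_vecMulVec_self_star u

/-- The matrix determinant lemma. -/
theorem det_add_vecMulVec {V : Matrix ι ι ℝ} (hV : V.PosDef) (u : ι → ℝ) :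
    (V + vecMulVec u u).det = V.det * (1 + quad V⁻¹ u) := by
  rw [vecMulVec_eq Unit, det_add_replicateCol_mul_replicateRow hV.det_pos.ne'.isUnit,
    det_unique (n := Unit), Matrix.add_apply, one_apply_eq, quad, Matrix.mul_assoc]
  simp [Matrix.mul_apply, dotProduct, mulVec]

/-- The rank-one update formula for `S ↦ Sᵀ V⁻¹ S`. -/
theorem quad_inv_add_vecMulVec {V : Matrix ι ι ℝ} (hV : V.PosDef) (u S : ι → ℝ) (e : ℝ) :
    quad (V + vecMulVec u u)⁻¹ (S + e • u) = quad V⁻¹ S +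
      (2 * e * (u ⬝ᵥ V⁻¹ *ᵥ S) + e ^ 2 * quad V⁻¹ u - (u ⬝ᵥ V⁻¹ *ᵥ S) ^ 2) /
        (1 + quad V⁻¹ u) := by
  have hw : 0 ≤ quad V⁻¹ u := quad_nonneg hV.inv.posSemidef u
  set w := quad V⁻¹ u with hwd
  set s := u ⬝ᵥ V⁻¹ *ᵥ S with hs
  have hV' : (V + vecMulVec u u).PosDef := hV.add_posSemidef (posSemidef_vecMulVec u)
  have h1 : (V + vecMulVec u u)⁻¹ *ᵥ (S + e • u) =
      V⁻¹ *ᵥ S + ((e - s) / (1 + w)) • (V⁻¹ *ᵥ u) := by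
    refine inv_mulVec_eq_iff hV' ?_
    rw [add_mulVec, mulVec_add, mulVec_smul, mulVec_inv_mulVec hV, mulVec_inv_mulVec hV,
      vecMulVec_mulVec, dotProduct_add, dotProduct_smul, ← hs]
    change S + ((e - s) / (1 + w)) • u + MulOpposite.op (s + ((e - s) / (1 + w)) • w) • u = _
    ext i
    simp only [Pi.add_apply, Pi.smul_apply, smul_eq_mul, MulOpposite.smul_eq_mul_unop,
      MulOpposite.unop_op]
    field_simp
    ring
  have h2 : S ⬝ᵥ V⁻¹ *ᵥ u = s := dotProduct_mulVec_comm hV.inv.1 S u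
  rw [quad, h1, dotProduct_add, add_dotProduct, add_dotProduct, smul_dotProduct, dotProduct_smul,
    dotProduct_smul, smul_dotProduct, ← hs, h2]
  change quad V⁻¹ S + e * s + ((e - s) / (1 + w) * s + (e - s) / (1 + w) * (e * w)) = _
  field_simp
  ring

end LinearAlgebra
end PrivateGPBandit

end

noncomputable section
namespace PrivateGPBandit
set_option linter.unusedSectionVars false
open scoped ENNReal

/-! ### Product measures -/

theorem lintegral_fin_prod_eq_prod {n : ℕ} {E : Fin n → Type*} {mE : ∀ i, MeasurableSpace (E i)}
    {μ : (i : Fin n) → Measure (E i)} [∀ i, SigmaFinite (μ i)]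
    (f : (i : Fin n) → E i → ℝ≥0∞) (hf : ∀ i, Measurable (f i)) :
    ∫⁻ x : (i : Fin n) → E i, ∏ i, f i (x i) ∂(Measure.pi μ) = ∏ i, ∫⁻ x, f i x ∂(μ i) := by
  induction n with
  | zero => simp
  | succ n ih =>
    have hm : ∀ i, Measurable fun x : (j : Fin n) → E (Fin.succAbove 0 j) =>
        f (Fin.succAbove 0 i) (x i) := fun i => (hf _).comp (measurable_pi_apply i)
    have h := (measurePreserving_piFinSuccAbove μ 0).lintegral_comp
      (f := fun x : E 0 × ((j : Fin n) → E (Fin.succAbove 0 j)) =>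
        f 0 x.1 * ∏ j, f (Fin.succAbove 0 j) (x.2 j))
      (((hf 0).comp measurable_fst).mul
        ((Finset.measurable_prod _ fun i _ => hm i).comp measurable_snd))
    rw [lintegral_prod_mul (hf 0).aemeasurable
      (Finset.measurable_prod _ fun i _ => hm i).aemeasurable, ih _ fun i => hf _] at h
    rw [Fin.prod_univ_succAbove _ 0, ← h]
    refine lintegral_congr fun x => ?_
    rw [Fin.prod_univ_succAbove _ 0]
    rfl

section Pi

variable {ι : Type*} [Fintype ι] {E : ι → Type*} {mE : ∀ i, MeasurableSpace (E i)}
  {μ ν : (i : ι) → Measure (E i)}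

theorem lintegral_fintype_prod_eq_prod [∀ i, SigmaFinite (μ i)]
    (f : (i : ι) → E i → ℝ≥0∞) (hf : ∀ i, Measurable (f i)) :
    ∫⁻ x : (i : ι) → E i, ∏ i, f i (x i) ∂(Measure.pi μ) = ∏ i, ∫⁻ x, f i x ∂(μ i) := by
  let e := (Fintype.equivFin ι).symm
  rw [← (measurePreserving_piCongrLeft _ e).lintegral_comp_emb
    (MeasurableEquiv.measurableEmbedding _)]
  simp_rw [← e.prod_comp, MeasurableEquiv.coe_piCongrLeft, Equiv.piCongrLeft_apply_apply]
  exact lintegral_fin_prod_eq_prod _ fun i => hf _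

theorem pi_withDensity [∀ i, SigmaFinite (μ i)] {f : (i : ι) → E i → ℝ≥0∞}
    (hf : ∀ i, Measurable (f i)) [∀ i, SigmaFinite ((μ i).withDensity (f i))] :
    Measure.pi (fun i => (μ i).withDensity (f i)) =
      (Measure.pi μ).withDensity fun x => ∏ i, f i (x i) := by
  refine Measure.pi_eq fun s hs => ?_
  rw [withDensity_apply _ (MeasurableSet.univ_pi hs), ← lintegral_indicator (.univ_pi hs)]
  have h : (Set.univ.pi s).indicator (fun x => ∏ i, f i (x i)) =
      fun x => ∏ i, (s i).indicator (f i) (x i) := by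
    ext x
    by_cases hx : x ∈ Set.univ.pi s
    · rw [Set.indicator_of_mem hx]
      exact Finset.prod_congr rfl fun i _ => (Set.indicator_of_mem (hx i trivial) _).symm
    · rw [Set.indicator_of_notMem hx]
      simp only [Set.mem_pi, Set.mem_univ, true_implies, not_forall] at hx
      obtain ⟨i, hi⟩ := hx
      exact (Finset.prod_eq_zero (Finset.mem_univ i) (Set.indicator_of_notMem hi _)).symm
  rw [h, lintegral_fintype_prod_eq_prod _ fun i => (hf i).indicator (hs i)]
  refine Finset.prod_congr rfl fun i _ => ?_
  rw [lintegral_indicator (hs i), withDensity_apply _ (hs i)]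

/-- Replacing the coordinates in `s` by independent ones. -/
theorem measurePreserving_piecewise [∀ i, IsProbabilityMeasure (μ i)]
    [∀ i, IsProbabilityMeasure (ν i)] (s : Set ι) [DecidablePred (· ∈ s)]
    (ξ : (i : ι) → Measure (E i)) [∀ i, SigmaFinite (ξ i)] (hξ : ∀ i ∈ s, ξ i = ν i)
    (hξ' : ∀ i ∉ s, ξ i = μ i) :
    MeasurePreserving (fun p : (∀ i, E i) × (∀ i, E i) => s.piecewise p.2 p.1)
      ((Measure.pi μ).prod (Measure.pi ν)) (Measure.pi ξ) := by
  have hm : Measurable fun p : (∀ i, E i) × (∀ i, E i) => s.piecewise p.2 p.1 := by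
    refine measurable_pi_lambda _ fun i => ?_
    by_cases hi : i ∈ s
    · simp only [Set.piecewise_eq_of_mem _ _ _ hi]
      fun_prop
    · simp only [Set.piecewise_eq_of_notMem _ _ _ hi]
      fun_prop
  refine ⟨hm, (Measure.pi_eq fun t ht => ?_).symm⟩
  rw [Measure.map_apply hm (.univ_pi ht)]
  have h : (fun p : (∀ i, E i) × (∀ i, E i) => s.piecewise p.2 p.1) ⁻¹' Set.univ.pi t =
      (Set.univ.pi fun i => if i ∈ s then Set.univ else t i) ×ˢ
        (Set.univ.pi fun i => if i ∈ s then t i else Set.univ) := by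
    ext p
    simp only [Set.mem_preimage, Set.mem_pi, Set.mem_univ, true_implies, Set.mem_prod,
      ← forall_and]
    refine forall_congr' fun i => ?_
    by_cases hi : i ∈ s <;> simp [hi]
  rw [h, Measure.prod_prod, Measure.pi_pi, Measure.pi_pi, ← Finset.prod_mul_distrib]
  refine Finset.prod_congr rfl fun i _ => ?_
  by_cases hi : i ∈ s
  · simp [hi, hξ i hi]
  · simp [hi, hξ' i hi]

end Pi

/-! ### Gaussian measures under translations -/

/-- `μ` is a centred Gaussian measure with covariance `v` times the inverse of the form `ip`, as far
as translations are concerned: the Cameron–Martin formula holds. -/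
structure HasGaussianShift {E : Type*} [AddCommGroup E] [MeasurableSpace E]
    (μ : Measure E) (v : ℝ) (ip : E → E → ℝ) : Prop where
  measurable_ip : ∀ δ, Measurable (ip δ)
  map_add : ∀ δ, μ.map (· + δ) =
    μ.withDensity fun x => ENNReal.ofReal (Real.exp ((ip δ x - ip δ δ / 2) / v))

theorem hasGaussianShift_gaussianReal {v : NNReal} (hv : v ≠ 0) :
    HasGaussianShift (gaussianReal 0 v) v fun δ x => δ * x := by
  refine ⟨fun δ => by fun_prop, fun δ => ?_⟩
  rw [gaussianReal_map_add_const, zero_add, gaussianReal_of_var_ne_zero _ hv,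
    gaussianReal_of_var_ne_zero _ hv, ← withDensity_mul _ (measurable_gaussianPDF 0 v) (by fun_prop)]
  congr 1
  ext x
  have hv' : (v : ℝ) ≠ 0 := by exact_mod_cast hv
  rw [Pi.mul_apply, gaussianPDF, gaussianPDF, gaussianPDFReal, gaussianPDFReal,
    ← ENNReal.ofReal_mul (by positivity), mul_assoc _ (Real.exp _), ← Real.exp_add]
  congr 3
  field_simp
  ring

theorem HasGaussianShift.pi {ι : Type*} [Fintype ι] {E : ι → Type*} [∀ i, AddCommGroup (E i)]
    [∀ i, MeasurableSpace (E i)] [∀ i, MeasurableAdd₂ (E i)] {μ : (i : ι) → Measure (E i)}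
    [∀ i, IsProbabilityMeasure (μ i)]
    {v : ℝ} {ip : (i : ι) → E i → E i → ℝ} (h : ∀ i, HasGaussianShift (μ i) v (ip i)) :
    HasGaussianShift (Measure.pi μ) v fun δ x => ∑ i, ip i (δ i) (x i) := by
  refine ⟨fun δ => Finset.measurable_sum _ fun i _ =>
    ((h i).measurable_ip (δ i)).comp (measurable_pi_apply i), fun δ => ?_⟩
  have hm : ∀ i, Measurable fun x : E i => x + δ i := fun i => measurable_add_const (δ i)
  have h1 : ∀ i, IsProbabilityMeasure ((μ i).map (· + δ i)) := fun i =>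
    Measure.isProbabilityMeasure_map (hm i).aemeasurable
  have h2 : (Measure.pi μ).map (· + δ) = Measure.pi fun i => (μ i).map (· + δ i) :=
    Measure.pi_map_pi fun i => (hm i).aemeasurable
  have h3 : ∀ i, SigmaFinite ((μ i).withDensity fun x =>
      ENNReal.ofReal (Real.exp ((ip i (δ i) x - ip i (δ i) (δ i) / 2) / v))) := fun i => by
    rw [← (h i).map_add]; infer_instance
  rw [h2]
  simp_rw [(h _).map_add]
  rw [pi_withDensity]
  · congr 1
    ext x
    rw [← ENNReal.ofReal_prod_of_nonneg fun i _ => (Real.exp_pos _).le, ← Real.exp_sum]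
    congr 2
    rw [← Finset.sum_div, Finset.sum_sub_distrib, Finset.sum_div]
  · intro i
    have := (h i).measurable_ip (δ i)
    fun_prop

/-! ### The Gaussian mechanism. -/

section Mechanism

variable {E : Type*} [AddCommGroup E] [Module ℝ E] [MeasurableSpace E] [MeasurableAdd E]
  {μ : Measure E} [IsProbabilityMeasure μ] {v : ℝ} {ip : E → E → ℝ}

/-- The density of the translate by `v • u` has total mass one, and up to a constant factor it is
`exp(ip u x)`. -/
theorem HasGaussianShift.lintegral_exp (h : HasGaussianShift μ v ip) (hv : 0 < v)
    (h1 : ∀ (c : ℝ) δ x, ip (c • δ) x = c * ip δ x)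
    (h2 : ∀ (c : ℝ) δ x, ip x (c • δ) = c * ip x δ) (u : E) :
    ∫⁻ x, ENNReal.ofReal (Real.exp (ip u x)) ∂μ = ENNReal.ofReal (Real.exp (v * ip u u / 2)) := by
  have hm : Measurable fun x : E => x + v • u := measurable_add_const _
  have h3 := congrArg (fun m : Measure E => m Set.univ) (h.map_add (v • u))
  rw [Measure.map_apply hm .univ] at h3
  simp only [Set.preimage_univ, measure_univ, withDensity_apply _ MeasurableSet.univ,
    Measure.restrict_univ] at h3
  have h4 : ∀ x, ENNReal.ofReal (Real.exp ((ip (v • u) x - ip (v • u) (v • u) / 2) / v)) =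
      ENNReal.ofReal (Real.exp (ip u x)) * ENNReal.ofReal (Real.exp (-(v * ip u u / 2))) := by
    intro x
    rw [← ENNReal.ofReal_mul (Real.exp_pos _).le, ← Real.exp_add]
    congr 2
    rw [h1, h1, h2]
    field_simp
    ring
  simp_rw [h4] at h3
  have := h.measurable_ip u
  rw [lintegral_mul_const _ (by fun_prop)] at h3
  have h5 := congrArg (· * ENNReal.ofReal (Real.exp (v * ip u u / 2))) h3
  simp only [one_mul, mul_assoc] at h5
  rw [← ENNReal.ofReal_mul (Real.exp_pos _).le, ← Real.exp_add, neg_add_cancel, Real.exp_zero,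
    ENNReal.ofReal_one, mul_one] at h5
  exact h5.symm

/-- The Gaussian mechanism: translations by a vector that is short compared with the standard
deviation are `(α, exp(1/2 - L))`-indistinguishable. -/
theorem HasGaussianShift.lintegral_comp_add_le (h : HasGaussianShift μ v ip) (hv : 0 < v)
    (h1 : ∀ (c : ℝ) δ x, ip (c • δ) x = c * ip δ x)
    (h2 : ∀ (c : ℝ) δ x, ip x (c • δ) = c * ip x δ) {α L : ℝ} (hα : 0 < α) (hα1 : α ≤ 1)
    (hL : 0 < L) (δ : E) (hδ : ip δ δ ≤ v * (α ^ 2 / (2 * L))) {F : E → ℝ≥0∞}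
    (hF : Measurable F) (hF1 : ∀ x, F x ≤ 1) :
    ∫⁻ x, F (x + δ) ∂μ ≤
      ENNReal.ofReal (Real.exp α) * ∫⁻ x, F x ∂μ + ENNReal.ofReal (Real.exp (1 / 2 - L)) := by
  have hm : Measurable fun x : E => x + δ := measurable_add_const _
  have hip := h.measurable_ip δ
  set r : E → ℝ := fun x => (ip δ x - ip δ δ / 2) / v with hr
  have hrm : Measurable r := by fun_prop
  -- Where the log-density `r` exceeds `α`, `e^r ≤ exp((1+s) r - s α)`, whose integral is
  -- `exp(s(1+s)D/2 - sα)` with `D = ip δ δ / v ≤ α²/(2L)`. The choice `s = 2L/α` bounds the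
  -- exponent by `α/2 - L`, and `α ≤ 1`.
  set s : ℝ := 2 * L / α with hs
  have hs0 : 0 < s := by positivity
  have e1 : ∫⁻ x, F (x + δ) ∂μ = ∫⁻ x, ENNReal.ofReal (Real.exp (r x)) * F x ∂μ := by
    rw [← lintegral_map hF hm, h.map_add, lintegral_withDensity_eq_lintegral_mul _ (by fun_prop) hF]
    rfl
  have e2 : ∀ x, ENNReal.ofReal (Real.exp (r x)) * F x ≤ ENNReal.ofReal (Real.exp α) * F x +
      ENNReal.ofReal (Real.exp ((1 + s) * r x - s * α)) := by
    intro x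
    rcases le_total (r x) α with hx | hx
    · refine le_add_right ?_
      gcongr
    · refine le_add_left ?_
      refine (mul_le_of_le_one_right' (hF1 x)).trans ?_
      gcongr
      nlinarith
  rw [e1]
  refine (lintegral_mono e2).trans ?_
  rw [lintegral_add_left (hF.const_mul _), lintegral_const_mul _ hF]
  refine add_le_add le_rfl ?_
  have e3 : ∀ x, ENNReal.ofReal (Real.exp ((1 + s) * r x - s * α)) =
      ENNReal.ofReal (Real.exp (ip (((1 + s) / v) • δ) x)) *
        ENNReal.ofReal (Real.exp (-((1 + s) * (ip δ δ / 2) / v) - s * α)) := by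
    intro x
    rw [← ENNReal.ofReal_mul (Real.exp_pos _).le, ← Real.exp_add]
    congr 2
    rw [h1]
    simp only [hr]
    ring
  simp_rw [e3]
  have := h.measurable_ip (((1 + s) / v) • δ)
  rw [lintegral_mul_const _ (by fun_prop), h.lintegral_exp hv h1 h2,
    ← ENNReal.ofReal_mul (Real.exp_pos _).le, ← Real.exp_add]
  refine ENNReal.ofReal_le_ofReal (Real.exp_le_exp.mpr ?_)
  rw [h1, h2]
  set D := ip δ δ / v with hD
  have hD1 : D ≤ α ^ 2 / (2 * L) := by
    rw [hD, div_le_iff₀ hv]; linarith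
  have e4 : v * ((1 + s) / v * ((1 + s) / v * ip δ δ)) / 2 +
      (-((1 + s) * (ip δ δ / 2) / v) - s * α) = s * (1 + s) / 2 * D - s * α := by
    rw [hD]; field_simp; ring
  rw [e4]
  have e5 : s * (1 + s) / 2 * D ≤ s * (1 + s) / 2 * (α ^ 2 / (2 * L)) := by gcongr
  have e6 : s * (1 + s) / 2 * (α ^ 2 / (2 * L)) - s * α = α / 2 - L := by
    rw [hs]; field_simp; ring
  linarith

end Mechanism
end PrivateGPBandit

end

noncomputable section
namespace PrivateGPBandit
set_option linter.unusedSectionVars false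
open scoped ENNReal Matrix
open Matrix WithLp

/-! ### Entropy of Gaussian vectors and information gain -/

theorem map_withDensity_comp {X Y : Type*} [MeasurableSpace X] [MeasurableSpace Y]
    {μ : Measure X} {ν : Measure Y} {g : X → Y} (hg : MeasurePreserving g μ ν) {f : Y → ℝ≥0∞}
    (hf : Measurable f) : (μ.withDensity (f ∘ g)).map g = ν.withDensity f := by
  ext s hs
  rw [Measure.map_apply hg.measurable hs, withDensity_apply _ (hg.measurable hs),
    withDensity_apply _ hs]
  exact hg.setLIntegral_comp_preimage hs hf

section Entropy

variable {ι : Type} [Fintype ι]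

/-- The density of the standard Gaussian distribution. -/
def stdDensity (x : EuclideanSpace ℝ ι) : ℝ := ∏ i, gaussianPDFReal 0 1 (x i)

theorem stdDensity_pos (x : EuclideanSpace ℝ ι) : 0 < stdDensity x :=
  Finset.prod_pos fun _ _ => gaussianPDFReal_pos _ _ _ one_ne_zero

theorem measurable_stdDensity : Measurable (stdDensity (ι := ι)) :=
  Finset.measurable_prod _ fun i _ => (measurable_gaussianPDFReal 0 1).comp (by fun_prop)

theorem stdGaussian_eq_withDensity :
    stdGaussian (EuclideanSpace ℝ ι) =
      volume.withDensity fun x => ENNReal.ofReal (stdDensity x) := by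
  have h1 : (Measure.pi fun _ : ι => gaussianReal 0 1) =
      (volume : Measure (ι → ℝ)).withDensity
        ((fun x : EuclideanSpace ℝ ι => ENNReal.ofReal (stdDensity x)) ∘ toLp 2) := by
    have : SigmaFinite ((volume : Measure ℝ).withDensity (gaussianPDF 0 1)) := by
      rw [← gaussianReal_of_var_ne_zero 0 one_ne_zero]; infer_instance
    simp_rw [gaussianReal_of_var_ne_zero 0 one_ne_zero]
    rw [pi_withDensity (f := fun _ : ι => gaussianPDF 0 1) (fun _ => measurable_gaussianPDF 0 1),
      volume_pi]
    congr 1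
    ext x
    simp only [gaussianPDF, Function.comp, stdDensity]
    rw [ENNReal.ofReal_prod_of_nonneg fun i _ => gaussianPDFReal_nonneg _ _ _]
  rw [← map_pi_eq_stdGaussian, h1]
  exact map_withDensity_comp (PiLp.volume_preserving_toLp ι)
    (ENNReal.measurable_ofReal.comp measurable_stdDensity)

theorem integrable_log_stdDensity :
    Integrable (fun x => Real.log (stdDensity x)) (stdGaussian (EuclideanSpace ℝ ι)) := by
  have h : ∀ x : EuclideanSpace ℝ ι, Real.log (stdDensity x) =
      ∑ i, (Real.log (√(2 * Real.pi))⁻¹ - 1 / 2 * (x i) ^ 2) := by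
    intro x
    rw [stdDensity, Real.log_prod fun i _ => (gaussianPDFReal_pos _ _ _ one_ne_zero).ne']
    refine Finset.sum_congr rfl fun i _ => ?_
    rw [gaussianPDFReal, Real.log_mul (by positivity) (Real.exp_pos _).ne', Real.log_exp]
    simp
    ring
  simp_rw [h]
  refine integrable_finsetSum _ fun i _ => (integrable_const _).sub (Integrable.const_mul ?_ _)
  exact (IsGaussian.memLp_dual _ (EuclideanSpace.proj i : EuclideanSpace ℝ ι →L[ℝ] ℝ) 2
    (by simp)).integrable_sq

variable [DecidableEq ι]

theorem det_toEuclideanCLM (A : Matrix ι ι ℝ) :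
    LinearMap.det (toEuclideanCLM (𝕜 := ℝ) A : EuclideanSpace ℝ ι →ₗ[ℝ] EuclideanSpace ℝ ι) =
      A.det := by
  rw [coe_toEuclideanCLM_eq_toEuclideanLin, toEuclideanLin, toLpLin_eq_toLin, LinearMap.det_toLin]

/-- The entropy of an affine image of the standard Gaussian distribution. -/
theorem diffEntropy_map_stdGaussian (v : EuclideanSpace ℝ ι) {A : Matrix ι ι ℝ} (hA : A.det ≠ 0) :
    diffEntropy ((stdGaussian (EuclideanSpace ℝ ι)).map
      fun x => v + toEuclideanCLM (𝕜 := ℝ) A x) =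
      Real.log |A.det| - ∫ x, Real.log (stdDensity x) ∂stdGaussian (EuclideanSpace ℝ ι) := by
  set T : EuclideanSpace ℝ ι → EuclideanSpace ℝ ι := fun x => v + toEuclideanCLM (𝕜 := ℝ) A x
    with hT
  set T' : EuclideanSpace ℝ ι → EuclideanSpace ℝ ι :=
    fun y => toEuclideanCLM (𝕜 := ℝ) A⁻¹ (y - v) with hT'
  have hTT : ∀ x, T' (T x) = x := by
    intro x
    simp only [hT, hT', add_sub_cancel_left]
    rw [← mul_apply_eq_comp, ← map_mul, nonsing_inv_mul _ hA.isUnit, map_one]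
    rfl
  have hTm : Measurable T := by simp only [hT]; fun_prop
  have hT'm : Measurable T' := by simp only [hT']; fun_prop
  set c : ℝ := |A.det|⁻¹ with hc
  have hc0 : 0 < c := inv_pos.mpr (abs_pos.mpr hA)
  have hvol : MeasurePreserving T volume (ENNReal.ofReal c • volume) := by
    refine ⟨hTm, ?_⟩
    have h1 := Measure.map_linearMap_addHaar_eq_smul_addHaar
      (volume : Measure (EuclideanSpace ℝ ι)) (f := (toEuclideanCLM (𝕜 := ℝ) A :
        EuclideanSpace ℝ ι →ₗ[ℝ] EuclideanSpace ℝ ι)) (by rwa [det_toEuclideanCLM])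
    rw [det_toEuclideanCLM, abs_inv, ← hc] at h1
    have h2 : T = (fun x => v + x) ∘ toEuclideanCLM (𝕜 := ℝ) A := rfl
    rw [h2, ← Measure.map_map (measurable_const_add v) (by fun_prop)]
    have h3 : Measure.map (toEuclideanCLM (𝕜 := ℝ) A) volume =
        ENNReal.ofReal c • (volume : Measure (EuclideanSpace ℝ ι)) := h1
    rw [h3, Measure.map_smul, map_add_left_eq_self]
  set f : EuclideanSpace ℝ ι → ℝ≥0∞ := fun y => ENNReal.ofReal (c * stdDensity (T' y)) with hf
  have hfm : Measurable f :=
    ENNReal.measurable_ofReal.comp ((measurable_stdDensity.comp hT'm).const_mul c)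
  have hmap : (stdGaussian (EuclideanSpace ℝ ι)).map T = volume.withDensity f := by
    have h1 : (fun x : EuclideanSpace ℝ ι => ENNReal.ofReal (stdDensity x)) =
        (fun y => ENNReal.ofReal (stdDensity (T' y))) ∘ T := by
      ext x; simp [hTT]
    have h2 : Measurable fun y => ENNReal.ofReal (stdDensity (T' y)) :=
      ENNReal.measurable_ofReal.comp (measurable_stdDensity.comp hT'm)
    rw [stdGaussian_eq_withDensity, h1, map_withDensity_comp hvol h2, withDensity_smul_measure,
      ← withDensity_smul _ h2]
    congr 1
    ext y
    simp only [Pi.smul_apply, smul_eq_mul, hf]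
    rw [← ENNReal.ofReal_mul hc0.le]
  have hrn : (fun y => Real.log (((stdGaussian (EuclideanSpace ℝ ι)).map T).rnDeriv volume y).toReal)
      =ᵐ[(stdGaussian (EuclideanSpace ℝ ι)).map T] fun y => Real.log (c * stdDensity (T' y)) := by
    have h1 := Measure.rnDeriv_withDensity (volume : Measure (EuclideanSpace ℝ ι)) hfm
    rw [hmap]
    filter_upwards [(withDensity_absolutelyContinuous volume f).ae_le h1] with y hy
    rw [hy, hf]
    simp only
    rw [ENNReal.toReal_ofReal (mul_pos hc0 (stdDensity_pos _)).le]
  have hlm : Measurable fun y => Real.log (c * stdDensity (T' y)) :=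
    Real.measurable_log.comp ((measurable_stdDensity.comp hT'm).const_mul c)
  rw [diffEntropy, integral_congr_ae hrn, integral_map hTm.aemeasurable hlm.aestronglyMeasurable]
  simp_rw [hTT, Real.log_mul hc0.ne' (stdDensity_pos _).ne']
  rw [integral_add (integrable_const _) integrable_log_stdDensity]
  simp [hc]
  ring

open scoped MatrixOrder in
-- The measure is the image of the standard Gaussian under the square root of `S`, whose
-- log-determinant is half that of `S`. The remaining term depends neither on `S` nor on `v`, so it
-- cancels in differences of entropies.
theorem diffEntropy_multivariateGaussian (v : EuclideanSpace ℝ ι) {S : Matrix ι ι ℝ}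
    (hS : S.PosDef) :
    diffEntropy (multivariateGaussian v S) = Real.log S.det / 2 -
      ∫ x, Real.log (stdDensity x) ∂stdGaussian (EuclideanSpace ℝ ι) := by
  have h1 : (CFC.sqrt S).det * (CFC.sqrt S).det = S.det := by
    rw [← det_mul, CFC.sqrt_mul_sqrt_self S hS.posSemidef.nonneg]
  have h2 : (CFC.sqrt S).det ≠ 0 := by
    intro h
    rw [h, zero_mul] at h1
    exact hS.det_pos.ne h1
  rw [multivariateGaussian, diffEntropy_map_stdGaussian v h2, ← h1, Real.log_mul h2 h2, Real.log_abs]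
  ring

end Entropy

/-! ### Information gain as a log-determinant. -/

variable {d : ℕ} {k : (Fin d → ℝ) → (Fin d → ℝ) → ℝ}

/-- The conditional entropy does not depend on the value of `f`, so averaging over `f` is trivial.
Prior and noise carry the same factor `ρ²`, which therefore drops out. -/
theorem infoGain_eq {ρ : ℝ} (hρ : 0 < ρ) {A : Finset (Cube d)} (hK : (gram k A).PosSemidef) :
    infoGain k ρ A = Real.log (1 + gram k A).det / 2 := by
  have h1 : (ρ ^ 2 • gram k A + ρ ^ 2 • (1 : Matrix ↥A ↥A ℝ)).PosDef :=
    (posDef_smul_one (by positivity)).posSemidef_add (hK.smul (by positivity))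
  have h2 : (ρ ^ 2 • (1 : Matrix ↥A ↥A ℝ)).PosDef := posDef_smul_one (by positivity)
  have h3 : (ρ ^ 2 • gram k A + ρ ^ 2 • (1 : Matrix ↥A ↥A ℝ)).det =
      (ρ ^ 2 • (1 : Matrix ↥A ↥A ℝ)).det * (1 + gram k A).det := by
    rw [← det_mul, smul_mul_assoc, one_mul, smul_add, add_comm]
  have h4 : (1 + gram k A).det ≠ 0 := (zero_lt_one.trans_le (one_le_det_one_add hK)).ne'
  rw [infoGain, diffEntropy_multivariateGaussian _ h1]
  simp_rw [diffEntropy_multivariateGaussian _ h2]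
  rw [integral_const, h3, Real.log_mul h2.det_pos.ne' h4]
  simp
  ring

/-- The Gram matrix of a family of points. -/
def kernelMatrix {ι : Type*} (k : (Fin d → ℝ) → (Fin d → ℝ) → ℝ) (x : ι → Cube d) :
    Matrix ι ι ℝ :=
  Matrix.of fun i j => k (x i) (x j)

theorem det_one_add_le_exp_trace {ι : Type*} [Fintype ι] [DecidableEq ι] {A : Matrix ι ι ℝ}
    (hA : A.PosSemidef) : (1 + A).det ≤ Real.exp A.trace := by
  have h : (1 + A).PosDef := PosDef.one.add_posSemidef hA
  rw [h.1.det_eq_prod_eigenvalues]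
  have ht : ∑ i, (h.1.eigenvalues i - 1) = A.trace := by
    have h2 := h.1.trace_eq_sum_eigenvalues
    rw [trace_add, trace_one] at h2
    simp only [RCLike.ofReal_real_eq_id, id_eq] at h2
    rw [Finset.sum_sub_distrib, ← h2]
    simp
  rw [← ht, Real.exp_sum]
  simp only [RCLike.ofReal_real_eq_id, id_eq]
  refine Finset.prod_le_prod (fun i _ => (h.eigenvalues_pos i).le) fun i _ => ?_
  linarith [Real.add_one_le_exp (h.1.eigenvalues i - 1)]

section MaxInfoGain

variable (hK : ∀ {ι : Type} [Fintype ι] (x : ι → Cube d), (kernelMatrix k x).PosSemidef)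
  (hk1 : ∀ x y, k x y ≤ 1)
include hK hk1

/-- Needed because `sSup` of an unbounded set is `0` by default. The log-determinant is at most the
trace, which is at most `T`. -/
theorem bddAbove_infoGain {ρ : ℝ} (hρ : 0 < ρ) (T : ℕ) :
    BddAbove {r : ℝ | ∃ A : Finset (Cube d), A.card = T ∧ r = infoGain k ρ A} := by
  refine ⟨(T : ℝ) / 2, ?_⟩
  rintro _ ⟨A, hA, rfl⟩
  have hp : (gram k A).PosSemidef := hK (fun x : ↥A => (x : Cube d))
  rw [infoGain_eq hρ hp]
  have h1 := det_one_add_le_exp_trace hp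
  have h2 := Real.log_le_log (zero_lt_one.trans_le (one_le_det_one_add hp)) h1
  rw [Real.log_exp] at h2
  have h3 : (gram k A).trace ≤ T := by
    rw [← hA, trace]
    refine (Finset.sum_le_sum fun i _ => show (gram k A).diag i ≤ 1 from hk1 _ _).trans ?_
    simp
  linarith

theorem log_det_le_maxInfoGain_of_injective {ρ : ℝ} (hρ : 0 < ρ) {T : ℕ} {x : Fin T → Cube d}
    (hx : Function.Injective x) :
    Real.log (1 + kernelMatrix k x).det ≤ 2 * maxInfoGain k ρ T := by
  classical
  set A : Finset (Cube d) := Finset.univ.image x with hA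
  have hc : A.card = T := by rw [hA, Finset.card_image_of_injective _ hx]; simp
  have hp : (gram k A).PosSemidef := hK (fun x : ↥A => (x : Cube d))
  have h1 : infoGain k ρ A ≤ maxInfoGain k ρ T :=
    le_csSup (bddAbove_infoGain hK hk1 hρ T) ⟨A, hc, rfl⟩
  rw [infoGain_eq hρ hp] at h1
  have he : Function.Bijective fun i : Fin T =>
      (⟨x i, Finset.mem_image_of_mem x (Finset.mem_univ i)⟩ : ↥A) := by
    refine ⟨fun i j hij => hx (congrArg Subtype.val hij), fun y => ?_⟩
    obtain ⟨i, -, hi⟩ := Finset.mem_image.mp y.2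
    exact ⟨i, Subtype.ext hi⟩
  have h2 : 1 + kernelMatrix k x =
      (1 + gram k A).submatrix (Equiv.ofBijective _ he) (Equiv.ofBijective _ he) := by
    rw [← Matrix.submatrix_one_equiv (Equiv.ofBijective _ he)]
    rfl
  rw [h2, det_submatrix_equiv_self]
  linarith

/-- Actions may repeat, whereas the information gain ranges over sets of `T` distinct points. The
points are therefore pulled slightly towards `T` distinct points of the diagonal of the cube: for
small `δ > 0` they are distinct, and continuity of the kernel carries the bound to `δ = 0`. -/
theorem log_det_le_maxInfoGain (hd : 0 < d)
    (hkc : Continuous fun z : (Fin d → ℝ) × (Fin d → ℝ) => k z.1 z.2)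
    {ρ : ℝ} (hρ : 0 < ρ) {T : ℕ} (x : Fin T → Cube d) :
    Real.log (1 + kernelMatrix k x).det ≤ 2 * maxInfoGain k ρ T := by
  have hc : ∀ i : Fin T, (fun _ : Fin d => ((i : ℝ) / T)) ∈ Set.Icc (0 : Fin d → ℝ) 1 := by
    intro i
    have hi : ((i : ℕ) : ℝ) ≤ T := by exact_mod_cast i.2.le
    refine ⟨fun j => by positivity, fun j => div_le_one_of_le₀ hi (by positivity)⟩
  set f : Fin T → ℝ → (Fin d → ℝ) := fun i δ =>
    (1 - δ) • (x i : Fin d → ℝ) + δ • (fun _ : Fin d => ((i : ℝ) / T)) with hf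
  have hfc : ∀ i, Continuous (f i) := fun i => by simp only [hf]; fun_prop
  have hf0 : ∀ i, f i 0 = x i := fun i => by simp [hf]
  have hmem : ∀ δ ∈ Set.Ioo (0 : ℝ) 1, ∀ i, f i δ ∈ Set.Icc (0 : Fin d → ℝ) 1 := fun δ hδ i =>
    (convex_Icc 0 1) (x i).2 (hc i) (by linarith [hδ.2]) hδ.1.le (by ring)
  have hinj : ∀ᶠ δ in nhdsWithin (0 : ℝ) (Set.Ioi 0), Function.Injective fun i => f i δ := by
    have : ∀ i j : Fin T, ∀ᶠ δ in nhdsWithin (0 : ℝ) (Set.Ioi 0), i ≠ j → f i δ ≠ f j δ := by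
      intro i j
      by_cases h0 : (x i : Fin d → ℝ) = x j
      · filter_upwards [self_mem_nhdsWithin] with δ hδ hij he
        have h1 := congrFun he ⟨0, hd⟩
        simp only [hf, h0, Pi.add_apply, Pi.smul_apply, smul_eq_mul, add_right_inj] at h1
        have h2 := mul_left_cancel₀ (ne_of_gt hδ) h1
        have hT : (T : ℝ) ≠ 0 := by
          have := i.pos
          exact_mod_cast this.ne'
        rw [div_left_inj' hT] at h2
        exact hij (Fin.ext (by exact_mod_cast h2))
      · have h1 : ∀ᶠ δ in nhds (0 : ℝ), f i δ ≠ f j δ := by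
          refine ((hfc i).continuousAt.ne_iff_eventually_ne (hfc j).continuousAt).mp ?_
          rwa [hf0, hf0]
        filter_upwards [nhdsWithin_le_nhds h1] with δ hδ _ using hδ
    have h2 := Filter.eventually_all.mpr fun i => Filter.eventually_all.mpr fun j => this i j
    filter_upwards [h2] with δ hδ i j hij
    by_contra hne
    exact hδ i j hne hij
  set g : ℝ → ℝ := fun δ => (1 + Matrix.of fun i j : Fin T => k (f i δ) (f j δ)).det with hg
  have hgc : Continuous g := by
    refine Continuous.matrix_det (continuous_const.add (continuous_matrix fun i j => ?_))
    exact hkc.comp ((hfc i).prodMk (hfc j))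
  have hg0 : g 0 = (1 + kernelMatrix k x).det := by simp only [hg, hf0]; rfl
  have hpos : 0 < g 0 := by
    rw [hg0]; exact zero_lt_one.trans_le (one_le_det_one_add (hK x))
  have hlim : Filter.Tendsto (fun δ => Real.log (g δ)) (nhdsWithin 0 (Set.Ioi 0))
      (nhds (Real.log (g 0))) :=
    ((hgc.continuousAt.log hpos.ne').tendsto).mono_left nhdsWithin_le_nhds
  rw [← hg0]
  refine le_of_tendsto hlim ?_
  filter_upwards [hinj, Ioo_mem_nhdsGT (show (0 : ℝ) < 1 by norm_num)] with δ h1 h2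
  exact log_det_le_maxInfoGain_of_injective hK hk1 hρ
    (x := fun i => (⟨f i δ, hmem δ h2 i⟩ : Cube d))
    fun i j hij => h1 (congrArg Subtype.val hij)

/-- One point repeated `T` times. This bounds `γ_T` below uniformly in `T`, so that errors of order
one can be absorbed into `√(T γ_T)`. -/
theorem log_le_maxInfoGain (hd : 0 < d)
    (hkc : Continuous fun z : (Fin d → ℝ) × (Fin d → ℝ) => k z.1 z.2)
    {ρ : ℝ} (hρ : 0 < ρ) {T : ℕ} (hT : 0 < T) (x : Cube d) (hx : 0 ≤ k x x) :
    Real.log (1 + k x x) ≤ 2 * maxInfoGain k ρ T := by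
  refine le_trans ?_ (log_det_le_maxInfoGain hK hk1 hd hkc hρ (fun _ : Fin T => x))
  refine Real.log_le_log (by linarith) (le_trans ?_ (one_add_trace_le_det_one_add (hK _)))
  have : (kernelMatrix k fun _ : Fin T => x).trace = T * k x x := by
    simp [trace, kernelMatrix]
  rw [this]
  have h1 : (1 : ℝ) ≤ T := by exact_mod_cast hT
  nlinarith

end MaxInfoGain
end PrivateGPBandit

end

noncomputable section
namespace PrivateGPBandit
set_option linter.unusedSectionVars false
open Matrix

/-! ### Measurability of the run -/

section MatrixMeasurability

variable {Ω ι : Type*} [MeasurableSpace Ω] [Fintype ι] [DecidableEq ι]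

theorem measurable_det {A : Ω → Matrix ι ι ℝ} (hA : ∀ i j, Measurable fun ω => A ω i j) :
    Measurable fun ω => (A ω).det := by
  simp_rw [Matrix.det_apply]
  refine Finset.measurable_sum _ fun σ _ => Measurable.const_smul ?_ _
  exact Finset.measurable_prod _ fun i _ => hA _ _

theorem measurable_inv_apply {A : Ω → Matrix ι ι ℝ} (hA : ∀ i j, Measurable fun ω => A ω i j)
    (i j : ι) : Measurable fun ω => (A ω)⁻¹ i j := by
  have h : ∀ ω, (A ω)⁻¹ i j = (A ω).det⁻¹ * ((A ω).updateRow j (Pi.single i 1)).det := by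
    intro ω
    rw [Matrix.inv_def, Matrix.smul_apply, Matrix.adjugate_apply, Ring.inverse_eq_inv', smul_eq_mul]
  simp_rw [h]
  refine (measurable_det hA).inv.mul (measurable_det fun a b => ?_)
  by_cases hab : a = j
  · subst hab
    simp only [updateRow_self]
    exact measurable_const
  · simp only [updateRow_ne hab]
    exact hA a b

theorem measurable_mulVec {A : Ω → Matrix ι ι ℝ} (hA : ∀ i j, Measurable fun ω => A ω i j)
    {v : Ω → ι → ℝ} (hv : Measurable v) : Measurable fun ω => A ω *ᵥ v ω := by
  refine measurable_pi_lambda _ fun i => ?_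
  simp only [mulVec, dotProduct]
  exact Finset.measurable_sum _ fun j _ => (hA i j).mul ((measurable_pi_apply j).comp hv)

theorem measurable_dotProduct {u v : Ω → ι → ℝ} (hu : Measurable u) (hv : Measurable v) :
    Measurable fun ω => u ω ⬝ᵥ v ω := by
  simp only [dotProduct]
  exact Finset.measurable_sum _ fun j _ =>
    ((measurable_pi_apply j).comp hu).mul ((measurable_pi_apply j).comp hv)

theorem measurable_quad_inv {A : Ω → Matrix ι ι ℝ} (hA : ∀ i j, Measurable fun ω => A ω i j)
    {v : Ω → ι → ℝ} (hv : Measurable v) : Measurable fun ω => quad (A ω)⁻¹ (v ω) :=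
  measurable_dotProduct hv (measurable_mulVec (measurable_inv_apply hA) hv)

end MatrixMeasurability

namespace Params

variable {d : ℕ} (P : Params d) {Ω : Type*} [MeasurableSpace Ω]

theorem measurable_feat : Measurable P.feat := P.continuous_feat.measurable

theorem measurable_datum : Measurable P.datum := by
  refine measurable_pi_lambda _ fun i => ?_
  rcases i with i | i
  · exact ((measurable_pi_apply i).comp P.measurable_feat).comp measurable_fst
  · exact measurable_snd

theorem measurable_treeSum {N : Ω → P.TreeNoise} (hN : Measurable N) {t : ℕ}
    {h : Ω → Fin t → Cube d × ℝ} (hh : Measurable h) (i j : P.Idx ⊕ Unit) :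
    Measurable fun ω => P.treeSum (N ω) (h ω) i j := by
  simp only [treeSum, Matrix.sum_apply]
  refine Finset.measurable_sum _ fun q _ => ?_
  split_ifs
  · simp only [nodeValue, Matrix.add_apply, Matrix.sum_apply, Matrix.smul_apply,
      Matrix.transpose_apply, Matrix.of_apply, smul_eq_mul]
    refine (Finset.measurable_sum _ fun l _ => ?_).add (Measurable.const_mul (Measurable.add ?_ ?_) _)
    · split_ifs
      · simp only [vecMulVec_apply]
        have h1 : Measurable fun ω => P.datum (h ω l) :=
          P.measurable_datum.comp ((measurable_pi_apply l).comp hh)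
        exact ((measurable_pi_apply i).comp h1).mul ((measurable_pi_apply j).comp h1)
      · exact measurable_const
    · fun_prop
    · fun_prop
  · exact measurable_const

theorem measurable_action (R : P.ArgmaxRule) {N : Ω → P.TreeNoise} (hN : Measurable N) {t : ℕ}
    {h : Ω → Fin t → Cube d × ℝ} (hh : Measurable h) (D : NonemptyCompacts (Cube d)) :
    Measurable fun ω => P.action R (N ω) (h ω) D := by
  have h1 : ∀ i j, Measurable fun ω => P.privSigma (N ω) (h ω) i j := fun i j => by
    simp only [privSigma, Matrix.add_apply, toBlocks₁₁, Matrix.of_apply]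
    exact (P.measurable_treeSum hN hh _ _).add_const _
  have h2 : ∀ i j, Measurable fun ω =>
      (P.privSigma (N ω) (h ω) + P.reg • (1 : Matrix P.Idx P.Idx ℝ)) i j := fun i j => by
    simp only [Matrix.add_apply]
    exact (h1 i j).add_const _
  have h3 : Measurable fun ω => P.privU (N ω) (h ω) :=
    measurable_pi_lambda _ fun i => P.measurable_treeSum hN hh _ _
  have h4 : Measurable fun ω => P.sqrtBeta (t + 1) (P.privSigma (N ω) (h ω)) := by
    simp only [sqrtBeta]
    refine Measurable.const_add (Measurable.sqrt (Measurable.add_const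
      (Measurable.log (measurable_det fun i j => ?_)) _)) _
    simp only [Matrix.smul_apply, smul_eq_mul]
    exact (h2 i j).const_mul _
  exact (R.measurable_pick D).comp ((measurable_mulVec (measurable_inv_apply h2) h3).prodMk
    ((measurable_pi_lambda _ fun i => measurable_pi_lambda _ fun j => h2 i j).prodMk h4))

theorem measurable_history (R : P.ArgmaxRule) (S : Fin P.T → User d) {N : Ω → P.TreeNoise}
    (hN : Measurable N) {e : Ω → Fin P.T → ℝ} (he : Measurable e) (t : ℕ) (ht : t ≤ P.T) :
    Measurable fun ω => P.history R S (N ω) (e ω) t ht := by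
  induction t with
  | zero => exact measurable_pi_lambda _ fun i => i.elim0
  | succ t ih =>
    have h1 := ih (Nat.le_of_succ_le ht)
    refine measurable_pi_lambda _ fun i => ?_
    simp only [history]
    induction i using Fin.lastCases with
    | last =>
      simp only [Fin.snoc_last]
      have h2 := P.measurable_action R hN h1 (S ⟨t, ht⟩).decisionSet
      exact h2.prodMk (((S ⟨t, ht⟩).measurable_meanReward.comp h2).add
        ((measurable_pi_apply _).comp he))
    | cast i =>
      simp only [Fin.snoc_castSucc]
      exact (measurable_pi_apply i).comp h1

theorem measurable_actions (R : P.ArgmaxRule) (S : Fin P.T → User d) :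
    Measurable fun ω : P.Sample => P.actions R S ω :=
  measurable_pi_lambda _ fun i => measurable_fst.comp ((measurable_pi_apply i).comp
    (P.measurable_history R S measurable_fst measurable_snd P.T le_rfl))

/-! ### The history as a recursion -/

theorem history_succ_castSucc (R : P.ArgmaxRule) (S : Fin P.T → User d) (N : P.TreeNoise)
    (e : Fin P.T → ℝ) (t : ℕ) (ht : t + 1 ≤ P.T) (i : Fin t) :
    P.history R S N e (t + 1) ht i.castSucc =
      P.history R S N e t (Nat.le_of_succ_le ht) i := by
  simp only [history, Fin.snoc_castSucc]

theorem history_eq_of_le (R : P.ArgmaxRule) (S : Fin P.T → User d) (N : P.TreeNoise)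
    (e : Fin P.T → ℝ) {s t : ℕ} (hst : s ≤ t) (ht : t ≤ P.T) (i : Fin s) :
    P.history R S N e t ht (Fin.castLE hst i) = P.history R S N e s (hst.trans ht) i := by
  induction t, hst using Nat.le_induction with
  | base => rfl
  | succ t hst ih =>
    rw [← ih (Nat.le_of_succ_le ht), ← P.history_succ_castSucc R S N e t ht]
    rfl

/-- The action of round `t`, as a function of the randomness. -/
def actionAt (R : P.ArgmaxRule) (S : Fin P.T → User d) (N : P.TreeNoise) (e : Fin P.T → ℝ)
    (t : Fin P.T) : Cube d :=
  P.action R N (P.history R S N e t t.2.le) (S t).decisionSet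

theorem history_apply (R : P.ArgmaxRule) (S : Fin P.T → User d) (N : P.TreeNoise)
    (e : Fin P.T → ℝ) {t : ℕ} (ht : t ≤ P.T) (i : Fin t) :
    P.history R S N e t ht i = (P.actionAt R S N e (Fin.castLE ht i),
      (S (Fin.castLE ht i)).meanReward (P.actionAt R S N e (Fin.castLE ht i)) +
        e (Fin.castLE ht i)) := by
  have h := P.history_eq_of_le R S N e (s := i + 1) i.2 ht (Fin.last i)
  have h2 : Fin.castLE (i.2 : (i : ℕ) + 1 ≤ t) (Fin.last i) = i := Fin.ext rfl
  rw [h2] at h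
  rw [h]
  simp only [history, Fin.snoc_last]
  rfl

theorem actions_eq_actionAt (R : P.ArgmaxRule) (S : Fin P.T → User d) (ω : P.Sample) (i : Fin P.T) :
    P.actions R S ω i = P.actionAt R S ω.1 ω.2 i := by
  rw [actions, history_apply]
  rfl

theorem measurable_actionAt (R : P.ArgmaxRule) (S : Fin P.T → User d) {N : Ω → P.TreeNoise}
    (hN : Measurable N) {e : Ω → Fin P.T → ℝ} (he : Measurable e) (t : Fin P.T) :
    Measurable fun ω => P.actionAt R S (N ω) (e ω) t :=
  P.measurable_action R hN (P.measurable_history R S hN he _ _) _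

/-! ### The dyadic decomposition -/

/-- The node `q` belongs to the dyadic decomposition of `{0, …, t-1}`. -/
def Selected (t : ℕ) (q : P.Node) : Prop :=
  t.testBit q.1 = true ∧ (q.2 : ℕ) + 1 = t / 2 ^ (q.1 : ℕ)

instance (t : ℕ) (q : P.Node) : Decidable (P.Selected t q) := by
  unfold Selected; infer_instance

theorem div_two_pow_succ (i l : ℕ) : i / 2 ^ (l + 1) = i / 2 ^ l / 2 := by
  rw [pow_succ, Nat.div_div_eq_div_mul]

/-- At a selected level the block index of `t` is odd and that of `i` is one less, so halving makes
them equal, and they stay equal at all higher levels. -/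
theorem div_eq_div_of_selected {t i l l' : ℕ} (h1 : t.testBit l = true)
    (h2 : i / 2 ^ l + 1 = t / 2 ^ l) (hl : l < l') : i / 2 ^ l' = t / 2 ^ l' := by
  obtain ⟨c, rfl⟩ := Nat.exists_eq_add_of_le (Nat.succ_le_of_lt hl)
  have h3 : i / 2 ^ (l + 1) = t / 2 ^ (l + 1) := by
    rw [div_two_pow_succ, div_two_pow_succ]
    have := Nat.testBit_eq_decide_div_mod_eq (x := t) (i := l)
    rw [h1] at this
    have h4 : t / 2 ^ l % 2 = 1 := by simpa using this.symm
    omega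
  rw [Nat.succ_eq_add_one, pow_add, ← Nat.div_div_eq_div_mul, ← Nat.div_div_eq_div_mul, h3]

/-- Take the first level at which `i` and `t` share a block. One level below they lie in sibling
blocks, the one of `t` being the right one. -/
theorem exists_selected {t i : ℕ} (hi : i < t) :
    ∃ l, t.testBit l = true ∧ i / 2 ^ l + 1 = t / 2 ^ l := by
  have hex : ∃ l, i / 2 ^ l = t / 2 ^ l := by
    refine ⟨t, ?_⟩
    rw [Nat.div_eq_of_lt (hi.trans Nat.lt_two_pow_self), Nat.div_eq_of_lt Nat.lt_two_pow_self]
  classical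
  obtain ⟨l, hl⟩ : ∃ l, Nat.find hex = l + 1 := by
    refine Nat.exists_eq_succ_of_ne_zero fun h0 => ?_
    have := Nat.find_spec hex
    rw [h0] at this
    simp at this
    omega
  have h1 : i / 2 ^ (l + 1) = t / 2 ^ (l + 1) := hl ▸ Nat.find_spec hex
  have h2 : i / 2 ^ l ≠ t / 2 ^ l := Nat.find_min hex (by omega)
  have h3 : i / 2 ^ l ≤ t / 2 ^ l := Nat.div_le_div_right hi.le
  rw [div_two_pow_succ, div_two_pow_succ] at h1
  refine ⟨l, ?_, by omega⟩
  rw [Nat.testBit_eq_decide_div_mod_eq]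
  simp only [decide_eq_true_eq]
  omega

/-- A selected node lies within the `depth` levels because `t < T ≤ 2 ^ clog T`. Two selected levels
are incompatible: above the lower one `i` and `t` share a block, while at the higher one their
blocks would be adjacent. -/
theorem existsUnique_selected {t : ℕ} (ht : t < P.T) (i : Fin t) :
    ∃! q : P.Node, P.Selected t q ∧ (i : ℕ) / 2 ^ (q.1 : ℕ) = q.2 := by
  obtain ⟨l, h1, h2⟩ := exists_selected i.2
  have hl : l < P.depth := by
    by_contra hcon
    rw [depth] at hcon
    have h3 : t < 2 ^ l := ht.trans_le ((Nat.le_pow_clog one_lt_two P.T).trans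
      (Nat.pow_le_pow_right two_pos (by omega)))
    rw [Nat.div_eq_of_lt h3] at h2
    exact Nat.succ_ne_zero _ h2
  have hq : (i : ℕ) / 2 ^ l < P.T := (Nat.div_le_self _ _).trans_lt (i.2.trans ht)
  refine ⟨(⟨l, hl⟩, ⟨_, hq⟩), ⟨⟨h1, h2⟩, rfl⟩, ?_⟩
  rintro ⟨l', j⟩ ⟨⟨h3, h4⟩, h5⟩
  simp only at h3 h4 h5
  have hll : (l' : ℕ) = l := by
    rcases lt_trichotomy (l' : ℕ) l with h | h | h
    · rw [← h5] at h4
      have := div_eq_div_of_selected h3 h4 h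
      omega
    · exact h
    · have := div_eq_div_of_selected h1 h2 h
      omega
  refine Prod.ext (Fin.ext hll) (Fin.ext ?_)
  simp only
  rw [← h5, hll]

/-- The noise of the private prefix sum. -/
def noiseSum (N : P.TreeNoise) (t : ℕ) : Matrix (P.Idx ⊕ Unit) (P.Idx ⊕ Unit) ℝ :=
  ∑ q : P.Node, if P.Selected t q then
    (1 / √2) • ((Matrix.of (N q)).transpose + Matrix.of (N q)) else 0

theorem treeSum_eq (N : P.TreeNoise) {t : ℕ} (ht : t < P.T) (h : Fin t → Cube d × ℝ) :
    P.treeSum N h = ∑ i, vecMulVec (P.datum (h i)) (P.datum (h i)) + P.noiseSum N t := by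
  have h1 : P.treeSum N h = ∑ q : P.Node, ((∑ i : Fin t,
      if P.Selected t q ∧ (i : ℕ) / 2 ^ (q.1 : ℕ) = q.2 then
        vecMulVec (P.datum (h i)) (P.datum (h i)) else 0) +
      if P.Selected t q then
        (1 / √2) • ((Matrix.of (N q)).transpose + Matrix.of (N q)) else 0) := by
    rw [treeSum]
    refine Finset.sum_congr rfl fun q _ => ?_
    by_cases hq : P.Selected t q
    · rw [if_pos hq, if_pos (show _ ∧ _ from hq), nodeValue]
      simp only [hq, true_and]
    · rw [if_neg hq, if_neg (show ¬(_ ∧ _) from hq)]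
      simp [hq]
  rw [h1, Finset.sum_add_distrib, Finset.sum_comm, noiseSum]
  congr 1
  refine Finset.sum_congr rfl fun i _ => ?_
  obtain ⟨q, hq, huniq⟩ := P.existsUnique_selected ht i
  rw [Finset.sum_eq_single q]
  · rw [if_pos hq]
  · intro q' _ hne
    rw [if_neg fun h' => hne (huniq q' h')]
  · intro hcon
    exact absurd (Finset.mem_univ q) hcon

theorem card_selected_le (t : ℕ) :
    (Finset.univ.filter fun q : P.Node => P.Selected t q).card ≤ P.depth := by
  have h := Finset.card_le_card_of_injOn (s := Finset.univ.filter fun q : P.Node => P.Selected t q)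
    (t := (Finset.univ : Finset (Fin P.depth))) Prod.fst (fun _ _ => Finset.mem_univ _) ?_
  · simpa using h
  · rintro ⟨l, j⟩ hq ⟨l', j'⟩ hq' (hl : l = l')
    subst hl
    have h1 := (Finset.mem_filter.mp hq).2.2
    have h2 := (Finset.mem_filter.mp hq').2.2
    simp only at h1 h2
    exact Prod.ext rfl (Fin.ext (by simp only; omega))

end Params
end PrivateGPBandit

end

noncomputable section
namespace PrivateGPBandit
set_option linter.unusedSectionVars false
open Matrix
open scoped ENNReal

/-! ### Privacy -/

namespace Params

variable {d : ℕ} (P : Params d)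

/-- The nodes whose leaves contain round `t`. -/
def above (t : ℕ) : Set P.Node := {q | t / 2 ^ (q.1 : ℕ) = q.2}

instance (t : ℕ) : DecidablePred (· ∈ P.above t) := fun q => by
  unfold above; exact inferInstanceAs (Decidable (t / 2 ^ (q.1 : ℕ) = q.2))

theorem lt_of_selected_of_mem_above {s t : ℕ} {q : P.Node} (h : P.Selected s q)
    (hq : q ∈ P.above t) : t < s := by
  have h1 := h.2
  have h2 : t / 2 ^ (q.1 : ℕ) = q.2 := hq
  by_contra hcon
  have := Nat.div_le_div_right (c := 2 ^ (q.1 : ℕ)) (not_lt.mp hcon)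
  omega

theorem card_above_le (t : ℕ) :
    (Finset.univ.filter fun q : P.Node => q ∈ P.above t).card ≤ P.depth := by
  have h := Finset.card_le_card_of_injOn (s := Finset.univ.filter fun q : P.Node => q ∈ P.above t)
    (t := (Finset.univ : Finset (Fin P.depth))) Prod.fst (fun _ _ => Finset.mem_univ _) ?_
  · simpa using h
  · rintro ⟨l, j⟩ hq ⟨l', j'⟩ hq' (hl : l = l')
    subst hl
    have h1 : t / 2 ^ (l : ℕ) = j := (Finset.mem_filter.mp hq).2
    have h2 : t / 2 ^ (l : ℕ) = j' := (Finset.mem_filter.mp hq').2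
    exact Prod.ext rfl (Fin.ext (h1.symm.trans h2))

/-- The action depends on the tree only through the node values outside the last diagonal entry. -/
theorem action_congr (R : P.ArgmaxRule) {N N' : P.TreeNoise} {s : ℕ}
    {h h' : Fin s → Cube d × ℝ} (D : NonemptyCompacts (Cube d))
    (hv : ∀ q, P.Selected s q → ∀ i j, P.nodeValue N h q (Sum.inl i) j =
      P.nodeValue N' h' q (Sum.inl i) j) :
    P.action R N h D = P.action R N' h' D := by
  have h1 : ∀ i j, P.treeSum N h (Sum.inl i) j = P.treeSum N' h' (Sum.inl i) j := by
    intro i j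
    simp only [treeSum, Matrix.sum_apply]
    refine Finset.sum_congr rfl fun q _ => ?_
    split_ifs with hq
    · exact hv q hq i j
    · rfl
  have h2 : P.privSigma N h = P.privSigma N' h' := by
    ext i j
    simp only [privSigma, Matrix.add_apply, toBlocks₁₁, Matrix.of_apply, h1]
  have h3 : P.privU N h = P.privU N' h' := funext fun i => h1 i _
  rw [action, action, h2, h3]

/-- A node containing leaf `t` is selected only in rounds after `t`, so its noise cannot influence
any action up to and including that of round `t`. -/
theorem actionAt_congr_of_agree (R : P.ArgmaxRule) (S : Fin P.T → User d) {N N' : P.TreeNoise}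
    (e : Fin P.T → ℝ) (t : ℕ) (hN : ∀ q ∉ P.above t, N q = N' q) (i : Fin P.T) (hi : (i : ℕ) ≤ t) :
    P.actionAt R S N e i = P.actionAt R S N' e i := by
  obtain ⟨n, hn⟩ := i
  induction n using Nat.strong_induction_on with
  | _ n ih =>
    have hh : P.history R S N e n hn.le = P.history R S N' e n hn.le := by
      funext j
      have hj : (j : ℕ) ≤ t := j.2.le.trans hi
      rw [P.history_apply, P.history_apply]
      have := ih j j.2 (j.2.trans hn) hj
      simp only [Fin.castLE] at this ⊢
      rw [this]
    refine P.action_congr R _ fun q hq a b => ?_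
    have hqt : q ∉ P.above t := fun hcon =>
      absurd (P.lt_of_selected_of_mem_above hq hcon) (not_lt.mpr hi)
    change P.nodeValue N (P.history R S N e n hn.le) q _ _ =
      P.nodeValue N' (P.history R S N' e n hn.le) q _ _
    rw [hh, nodeValue, nodeValue, hN q hqt]

/-- The change of the noise at a node that compensates replacing the datum `z` by `z'`. -/
def nodeShift (z z' : Cube d × ℝ) (i j : P.Idx ⊕ Unit) : ℝ :=
  -- The last diagonal entry is never used by the actions and needs no compensation, so no fourth
  -- power of a reward enters the length of the shift. Division by `√2` because symmetrization
  -- multiplies a symmetric shift by `2/√2`.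
  if i.isRight ∧ j.isRight then 0 else
    (P.datum z i * P.datum z j - P.datum z' i * P.datum z' j) / √2

/-- The change of the tree noise that compensates replacing the datum `z` of round `t`
by `z'`. -/
def treeShift (t : ℕ) (z z' : Cube d × ℝ) : P.TreeNoise := fun q =>
  if q ∈ P.above t then P.nodeShift z z' else 0

theorem nodeValue_add_treeShift (N : P.TreeNoise) {s : ℕ} {h h' : Fin s → Cube d × ℝ} (t : Fin s)
    (hh : ∀ i, i ≠ t → h i = h' i) (q : P.Node) (a : P.Idx) (b : P.Idx ⊕ Unit) :
    P.nodeValue (N + P.treeShift t (h t) (h' t)) h' q (Sum.inl a) b =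
      P.nodeValue N h q (Sum.inl a) b := by
  simp only [nodeValue, Matrix.add_apply, Matrix.sum_apply, Matrix.smul_apply,
    Matrix.transpose_apply, Matrix.of_apply, smul_eq_mul, Pi.add_apply]
  have h1 : ∀ g : Fin s → Cube d × ℝ, ∑ c : Fin s, (if (c : ℕ) / 2 ^ (q.1 : ℕ) = q.2 then
      vecMulVec (P.datum (g c)) (P.datum (g c)) else 0 : Matrix (P.Idx ⊕ Unit) (P.Idx ⊕ Unit) ℝ)
        (Sum.inl a) b =
      (∑ c ∈ Finset.univ.erase t, (if (c : ℕ) / 2 ^ (q.1 : ℕ) = q.2 then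
        P.datum (g c) (Sum.inl a) * P.datum (g c) b else 0)) +
      if q ∈ P.above t then P.datum (g t) (Sum.inl a) * P.datum (g t) b else 0 := by
    intro g
    rw [← Finset.sum_erase_add _ _ (Finset.mem_univ t)]
    congr 1
    · refine Finset.sum_congr rfl fun c _ => ?_
      split_ifs <;> simp [vecMulVec_apply]
    · change (if q ∈ P.above t then _ else _ : Matrix (P.Idx ⊕ Unit) (P.Idx ⊕ Unit) ℝ) _ _ = _
      split_ifs <;> simp [vecMulVec_apply]
  rw [h1, h1]
  have h2 : ∑ c ∈ Finset.univ.erase t, (if (c : ℕ) / 2 ^ (q.1 : ℕ) = q.2 then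
        P.datum (h' c) (Sum.inl a) * P.datum (h' c) b else 0) =
      ∑ c ∈ Finset.univ.erase t, (if (c : ℕ) / 2 ^ (q.1 : ℕ) = q.2 then
        P.datum (h c) (Sum.inl a) * P.datum (h c) b else 0) :=
    Finset.sum_congr rfl fun c hc => by rw [hh c (Finset.ne_of_mem_erase hc)]
  rw [h2, treeShift]
  split_ifs with hq
  · have e1 : P.nodeShift (h t) (h' t) (Sum.inl a) b = (P.datum (h t) (Sum.inl a) * P.datum (h t) b -
        P.datum (h' t) (Sum.inl a) * P.datum (h' t) b) / √2 := by simp [nodeShift]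
    have e2 : P.nodeShift (h t) (h' t) b (Sum.inl a) = (P.datum (h t) (Sum.inl a) * P.datum (h t) b -
        P.datum (h' t) (Sum.inl a) * P.datum (h' t) b) / √2 := by simp [nodeShift, mul_comm]
    have e3 : (√2 : ℝ) ≠ 0 := by positivity
    have e4 : (√2 : ℝ) ^ 2 = 2 := Real.sq_sqrt zero_le_two
    rw [e1, e2]
    field_simp
    ring_nf
    simp only [e4]
    ring
  · simp

/-- The datum of round `t`. -/
def datumAt (R : P.ArgmaxRule) (S : Fin P.T → User d) (N : P.TreeNoise) (e : Fin P.T → ℝ)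
    (t : Fin P.T) : Cube d × ℝ :=
  (P.actionAt R S N e t, (S t).meanReward (P.actionAt R S N e t) + e t)

/-- Shifting the tree noise hides the replacement of user `t` from all other users. -/
theorem actionAt_add_treeShift (R : P.ArgmaxRule) {S S' : Fin P.T → User d} {t : Fin P.T}
    (hS : ∀ i, i ≠ t → S i = S' i) (N : P.TreeNoise) {e e' : Fin P.T → ℝ}
    (he : ∀ i, i ≠ t → e i = e' i) (i : Fin P.T) (hi : i ≠ t) :
    P.actionAt R S' (N + P.treeShift t (P.datumAt R S N e t) (P.datumAt R S' N e' t)) e' i =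
      P.actionAt R S N e i := by
  set N' := N + P.treeShift t (P.datumAt R S N e t) (P.datumAt R S' N e' t) with hN'
  have hoff : ∀ q ∉ P.above t, N' q = N q := fun q hq => by
    simp [hN', treeShift, hq]
  obtain ⟨n, hn⟩ := i
  induction n using Nat.strong_induction_on with
  | _ n ih =>
    have hhist : ∀ j : Fin n, Fin.castLE hn.le j ≠ t →
        P.history R S N e n hn.le j = P.history R S' N' e' n hn.le j := by
      intro j hj
      rw [P.history_apply, P.history_apply]
      have := ih j j.2 (j.2.trans hn) hj
      have h2 : Fin.castLE hn.le j = ⟨j, j.2.trans hn⟩ := rfl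
      rw [hS _ hj, he _ hj, h2, this]
    rw [actionAt, actionAt, hS _ hi]
    refine P.action_congr R _ fun q hq a b => ?_
    rcases lt_or_ge (t : ℕ) n with htn | htn
    · set t' : Fin n := ⟨t, htn⟩
      have h1 : P.history R S N e n hn.le t' = P.datumAt R S N e t := P.history_apply R S N e _ _
      -- The shift was built from the datum of round `t` under `N`, while the run uses `N'`. The two
      -- data agree, since they ignore the noise above leaf `t`, the only place where `N` and `N'`
      -- differ.
      have h2 : P.history R S' N' e' n hn.le t' = P.datumAt R S' N e' t := by
        rw [P.history_apply]
        have : P.actionAt R S' N' e' t = P.actionAt R S' N e' t :=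
          P.actionAt_congr_of_agree R S' e' t hoff t le_rfl
        change (P.actionAt R S' N' e' t, (S' t).meanReward (P.actionAt R S' N' e' t) + e' t) = _
        rw [this]
        rfl
      have h3 := P.nodeValue_add_treeShift N (h := P.history R S N e n hn.le)
        (h' := P.history R S' N' e' n hn.le) t' (fun j hj => hhist j fun hcon => hj (Fin.ext
          (show (j : ℕ) = t from congrArg (fun i : Fin P.T => (i : ℕ)) hcon))) q a b
      rw [h1, h2] at h3
      exact h3
    · have hqt : q ∉ P.above t := fun hcon =>
        absurd (P.lt_of_selected_of_mem_above hq hcon) (not_lt.mpr htn)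
      have h1 : P.history R S N e n hn.le = P.history R S' N' e' n hn.le := by
        funext j
        refine hhist j fun hcon => ?_
        have := congrArg Fin.val hcon
        have := j.2
        simp at *
        omega
      simp only [nodeValue, h1, hoff q hqt]

/-! ### The size of the shift -/

/-- The squared Frobenius distance of the two outer products is `|u|⁴ - 2⟨u,w⟩² + |w|⁴`. -/
theorem sum_mul_sub_mul_sq_le {ι : Type*} [Fintype ι] {u w : ι → ℝ} (hu : u ⬝ᵥ u ≤ 1)
    (hw : w ⬝ᵥ w ≤ 1) : ∑ i, ∑ j, (u i * u j - w i * w j) ^ 2 ≤ 2 := by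
  have h : ∑ i, ∑ j, (u i * u j - w i * w j) ^ 2 =
      (u ⬝ᵥ u) ^ 2 - 2 * (u ⬝ᵥ w) ^ 2 + (w ⬝ᵥ w) ^ 2 := by
    have e : ∀ a b c e : ι → ℝ, (a ⬝ᵥ b) * (c ⬝ᵥ e) = ∑ i, ∑ j, a i * b i * (c j * e j) := by
      intro a b c e
      rw [dotProduct, dotProduct, Finset.sum_mul_sum]
    rw [sq, sq, sq, e, e, e, Finset.mul_sum, ← Finset.sum_sub_distrib, ← Finset.sum_add_distrib]
    refine Finset.sum_congr rfl fun i _ => ?_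
    rw [Finset.mul_sum, ← Finset.sum_sub_distrib, ← Finset.sum_add_distrib]
    exact Finset.sum_congr rfl fun j _ => by ring
  have h1 : 0 ≤ u ⬝ᵥ u := Finset.sum_nonneg fun i _ => mul_self_nonneg (u i)
  have h2 : 0 ≤ w ⬝ᵥ w := Finset.sum_nonneg fun i _ => mul_self_nonneg (w i)
  rw [h]
  nlinarith [sq_nonneg (u ⬝ᵥ w)]

theorem sum_smul_sub_smul_sq_le {ι : Type*} [Fintype ι] {u w : ι → ℝ} (hu : u ⬝ᵥ u ≤ 1)
    (hw : w ⬝ᵥ w ≤ 1) (y y' : ℝ) : ∑ i, (u i * y - w i * y') ^ 2 ≤ 2 * y ^ 2 + 2 * y' ^ 2 := by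
  have h : ∑ i, (u i * y - w i * y') ^ 2 ≤ 2 * y ^ 2 * (u ⬝ᵥ u) + 2 * y' ^ 2 * (w ⬝ᵥ w) := by
    rw [dotProduct, dotProduct, Finset.mul_sum, Finset.mul_sum, ← Finset.sum_add_distrib]
    refine Finset.sum_le_sum fun i _ => ?_
    nlinarith [sq_nonneg (u i * y + w i * y')]
  nlinarith [sq_nonneg y, sq_nonneg y']

/-- All squares are halved by the factor `1/√2`. The feature block then contributes at most `1`, and
each of the two off-diagonal blocks at most `y² + y'²`. -/
theorem sum_nodeShift_sq_le {z z' : Cube d × ℝ} (h1 : P.feat z.1 ⬝ᵥ P.feat z.1 ≤ 1)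
    (h2 : P.feat z'.1 ⬝ᵥ P.feat z'.1 ≤ 1) :
    ∑ i, ∑ j, P.nodeShift z z' i j * P.nodeShift z z' i j ≤ 1 + 2 * z.2 ^ 2 + 2 * z'.2 ^ 2 := by
  have e4 : (√2 : ℝ) * √2 = 2 := Real.mul_self_sqrt zero_le_two
  have e5 : ∀ a : ℝ, a / √2 * (a / √2) = a ^ 2 / 2 := fun a => by
    rw [div_mul_div_comm, e4, sq]
  simp only [Fintype.sum_sum_type, nodeShift, datum, Sum.isRight_inl, Sum.isRight_inr, Sum.elim_inl,
    Sum.elim_inr, Bool.false_eq_true, false_and, and_false, if_false, Finset.univ_unique,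
    Finset.sum_singleton, if_true, true_and, mul_zero, add_zero, e5, Finset.sum_add_distrib,
    ← Finset.sum_div]
  have h3 := sum_mul_sub_mul_sq_le h1 h2
  have h4 := sum_smul_sub_smul_sq_le h1 h2 z.2 z'.2
  have h5 : ∑ i, (z.2 * P.feat z.1 i - z'.2 * P.feat z'.1 i) ^ 2 =
      ∑ i, (P.feat z.1 i * z.2 - P.feat z'.1 i * z'.2) ^ 2 :=
    Finset.sum_congr rfl fun i _ => by ring
  rw [h5]
  linarith

/-- The inner product of tree noises. -/
def treeInner (δ x : P.TreeNoise) : ℝ := ∑ q, ∑ i, ∑ j, δ q i j * x q i j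

theorem treeInner_smul_left (c : ℝ) (δ x : P.TreeNoise) :
    P.treeInner (c • δ) x = c * P.treeInner δ x := by
  simp only [treeInner, Finset.mul_sum, Pi.smul_apply, smul_eq_mul, mul_assoc]

theorem treeInner_smul_right (c : ℝ) (δ x : P.TreeNoise) :
    P.treeInner x (c • δ) = c * P.treeInner x δ := by
  simp only [treeInner, Finset.mul_sum, Pi.smul_apply, smul_eq_mul, mul_left_comm]

theorem treeInner_treeShift_le (t : ℕ) {z z' : Cube d × ℝ} (h1 : P.feat z.1 ⬝ᵥ P.feat z.1 ≤ 1)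
    (h2 : P.feat z'.1 ⬝ᵥ P.feat z'.1 ≤ 1) :
    P.treeInner (P.treeShift t z z') (P.treeShift t z z') ≤
      P.depth * (1 + 2 * z.2 ^ 2 + 2 * z'.2 ^ 2) := by
  have h3 := P.sum_nodeShift_sq_le h1 h2
  have h4 : P.treeInner (P.treeShift t z z') (P.treeShift t z z') =
      ∑ q : P.Node, if q ∈ P.above t then
        ∑ i, ∑ j, P.nodeShift z z' i j * P.nodeShift z z' i j else 0 := by
    refine Finset.sum_congr rfl fun q _ => ?_
    simp only [treeShift]
    split_ifs <;> simp
  rw [h4, ← Finset.sum_filter, Finset.sum_const, nsmul_eq_mul]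
  have h5 : ((Finset.univ.filter fun q : P.Node => q ∈ P.above t).card : ℝ) ≤ P.depth := by
    exact_mod_cast P.card_above_le t
  exact mul_le_mul h5 h3 (Finset.sum_nonneg fun i _ => Finset.sum_nonneg fun j _ =>
    mul_self_nonneg _) (Nat.cast_nonneg _)

/-- The law of the tree noise. -/
def treeMeasure : Measure P.TreeNoise :=
  Measure.pi fun _ => Measure.pi fun _ => Measure.pi fun _ =>
    gaussianReal 0 (Real.toNNReal (P.σ ^ 2))

instance : IsProbabilityMeasure P.treeMeasure := by unfold treeMeasure; infer_instance

theorem sampleMeasure_eq (S : Fin P.T → User d) :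
    P.sampleMeasure S = P.treeMeasure.prod (Measure.pi fun i => ((S i).noise : Measure ℝ)) := rfl

instance (S : Fin P.T → User d) : IsProbabilityMeasure (P.sampleMeasure S) := by
  rw [sampleMeasure_eq]; infer_instance

theorem hasGaussianShift_treeMeasure (hσ : 0 < P.σ) :
    HasGaussianShift P.treeMeasure (P.σ ^ 2) P.treeInner := by
  have h := hasGaussianShift_gaussianReal (v := Real.toNNReal (P.σ ^ 2)) (by simpa using by positivity)
  rw [Real.coe_toNNReal _ (by positivity)] at h
  exact HasGaussianShift.pi fun _ => HasGaussianShift.pi fun _ => HasGaussianShift.pi fun _ => h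

end Params

/-! ### Joint differential privacy -/

theorem measure_abs_gt_le {ν : Measure ℝ} [IsProbabilityMeasure ν] {ρ : ℝ} (hρ : 0 < ρ)
    (h : HasSubgaussianMGF id (Real.toNNReal (ρ ^ 2)) ν) {L : ℝ} (hL : 0 ≤ L) :
    ν {x | ρ * √(2 * L) < |x|} ≤ ENNReal.ofReal (2 * Real.exp (-L)) := by
  have hε : 0 ≤ ρ * √(2 * L) := by positivity
  have hexp : Real.exp (-(ρ * √(2 * L)) ^ 2 / (2 * (Real.toNNReal (ρ ^ 2) : ℝ))) =
      Real.exp (-L) := by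
    rw [Real.coe_toNNReal _ (by positivity), mul_pow, Real.sq_sqrt (by positivity)]
    congr 1
    field_simp
  have h1 := h.measure_ge_le hε
  have h2 := h.neg.measure_ge_le hε
  rw [hexp] at h1 h2
  have hsub : {x : ℝ | ρ * √(2 * L) < |x|} ⊆
      {x | ρ * √(2 * L) ≤ id x} ∪ {x | ρ * √(2 * L) ≤ (-id) x} := by
    intro x hx
    rcases lt_abs.mp (show ρ * √(2 * L) < |x| from hx) with h | h
    · exact Or.inl h.le
    · exact Or.inr h.le
  rw [← ENNReal.ofReal_toReal (measure_ne_top ν _)]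
  refine ENNReal.ofReal_le_ofReal ?_
  change ν.real _ ≤ _
  refine (measureReal_mono hsub).trans ((measureReal_union_le _ _).trans ?_)
  linarith

namespace Params

variable {d : ℕ} (P : Params d)

/-- The `(α, β)`-bound for fixed reward noise. -/
theorem lintegral_actions_le (R : P.ArgmaxRule) {S S' : Fin P.T → User d} {t : Fin P.T}
    (hS : ∀ i, i ≠ t → S i = S' i) (hσ : 0 < P.σ) {α L M : ℝ} (hα : 0 < α) (hα1 : α ≤ 1) (hL : 0 < L)
    (hM : P.depth * M ≤ P.σ ^ 2 * (α ^ 2 / (2 * L)))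
    (hfeat : ∀ x, P.feat x ⬝ᵥ P.feat x ≤ 1)
    {e e' : Fin P.T → ℝ} (he : ∀ i, i ≠ t → e i = e' i)
    (hM' : ∀ x x', 1 + 2 * ((S t).meanReward x + e t) ^ 2 +
      2 * ((S' t).meanReward x' + e' t) ^ 2 ≤ M)
    {E : Set ({i : Fin P.T // i ≠ t} → Cube d)} (hE : MeasurableSet E) :
    ∫⁻ N, E.indicator 1 (fun i : {i // i ≠ t} => P.actionAt R S N e i) ∂P.treeMeasure ≤
      ENNReal.ofReal (Real.exp α) *
        ∫⁻ N, E.indicator 1 (fun i : {i // i ≠ t} => P.actionAt R S' N e' i) ∂P.treeMeasure +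
        ENNReal.ofReal (Real.exp (1 / 2 - L)) := by
  set G : P.TreeNoise → ℝ≥0∞ := fun N =>
    E.indicator 1 (fun i : {i // i ≠ t} => P.actionAt R S N e i) with hG
  set G' : P.TreeNoise → ℝ≥0∞ := fun N =>
    E.indicator 1 (fun i : {i // i ≠ t} => P.actionAt R S' N e' i) with hG'
  have hmeas : ∀ (S : Fin P.T → User d) (e : Fin P.T → ℝ), Measurable fun N : P.TreeNoise =>
      (E.indicator 1 (fun i : {i // i ≠ t} => P.actionAt R S N e i) : ℝ≥0∞) := fun S e =>
    (measurable_one.indicator hE).comp (measurable_pi_lambda _ fun i =>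
      P.measurable_actionAt R S measurable_id measurable_const _)
  have hGm : Measurable G := hmeas S e
  have hG'm : Measurable G' := hmeas S' e'
  have hG'1 : ∀ N, G' N ≤ 1 := fun N => Set.indicator_le_self' (by simp) _
  have hpres : MeasurePreserving
      (fun p : P.TreeNoise × P.TreeNoise => (P.above t).piecewise p.2 p.1)
      (P.treeMeasure.prod P.treeMeasure) P.treeMeasure :=
    measurePreserving_piecewise (P.above t) _ (fun _ _ => rfl) fun _ _ => rfl
  -- Resample the noise above leaf `t` as `N'`, keeping `N` elsewhere. For fixed `N` both data of
  -- round `t`, hence the shift `δ`, are constant in `N'`, so the Gaussian mechanism applies to the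
  -- inner integral.
  have hres : ∀ F : P.TreeNoise → ℝ≥0∞, Measurable F → ∫⁻ N, F N ∂P.treeMeasure =
      ∫⁻ N, ∫⁻ N', F ((P.above t).piecewise N' N) ∂P.treeMeasure ∂P.treeMeasure := by
    intro F hF
    have hm : Measurable fun p : P.TreeNoise × P.TreeNoise =>
      F ((P.above t).piecewise p.2 p.1) := hF.comp hpres.measurable
    rw [← hpres.lintegral_comp hF, lintegral_prod _ hm.aemeasurable]
  have hm' : Measurable fun N => ∫⁻ N', G' ((P.above t).piecewise N' N) ∂P.treeMeasure :=
    Measurable.lintegral_prod_right' (f := fun p : P.TreeNoise × P.TreeNoise =>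
      G' ((P.above t).piecewise p.2 p.1)) (hG'm.comp hpres.measurable)
  rw [hres G hGm, hres G' hG'm, ← lintegral_const_mul _ hm', ← mul_one (ENNReal.ofReal (Real.exp (1 / 2 - L))),
    ← measure_univ (μ := P.treeMeasure), ← lintegral_const, ← lintegral_add_right _ measurable_const]
  refine lintegral_mono fun N => ?_
  set δ := P.treeShift t (P.datumAt R S N e t) (P.datumAt R S' N e' t) with hδ
  have hkey : ∀ N', G ((P.above t).piecewise N' N) = G' ((P.above t).piecewise (N' + δ) N) := by
    intro N'
    set M' := (P.above t).piecewise N' N with hM'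
    have hoff : ∀ q ∉ P.above t, M' q = N q := fun q hq =>
      Set.piecewise_eq_of_notMem _ _ _ hq
    have hd1 : P.datumAt R S M' e t = P.datumAt R S N e t := by
      rw [datumAt, datumAt, P.actionAt_congr_of_agree R S e t hoff t le_rfl]
    have hd2 : P.datumAt R S' M' e' t = P.datumAt R S' N e' t := by
      rw [datumAt, datumAt, P.actionAt_congr_of_agree R S' e' t hoff t le_rfl]
    have hadd : (P.above t).piecewise (N' + δ) N = M' + δ := by
      funext q
      by_cases hq : q ∈ P.above t
      · simp [hM', hq]
      · simp [hM', hq, hδ, treeShift]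
    rw [hadd, hG, hG']
    simp only
    congr 1
    funext i
    rw [hδ, ← hd1, ← hd2]
    exact (P.actionAt_add_treeShift R hS M' he i i.2).symm
  simp_rw [hkey]
  have hpm : Measurable fun N' : P.TreeNoise => (P.above t).piecewise N' N :=
    hpres.measurable.comp measurable_prodMk_left
  refine (P.hasGaussianShift_treeMeasure hσ).lintegral_comp_add_le (by positivity)
    P.treeInner_smul_left P.treeInner_smul_right hα hα1 hL δ ?_ (hG'm.comp hpm) fun N' => hG'1 _
  refine (P.treeInner_treeShift_le t (hfeat _) (hfeat _)).trans (le_trans ?_ hM)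
  exact mul_le_mul_of_nonneg_left (hM' _ _) (Nat.cast_nonneg _)

/-- The two worlds share the reward noise of all users but the `t`-th, whose noises are drawn
independently. Of the budget `β`, the events that these noises exceed `r` take `β/4` each, since `2
exp(-log(8/β)) = β/4`. The Gaussian mechanism takes `exp(1/2) β/10 ≤ β/2`. -/
theorem isJDP (hfeat : ∀ x, P.feat x ⬝ᵥ P.feat x ≤ 1) (hρ : 0 < P.ρ) {α β : ℝ} (hα : 0 < α)
    (hα1 : α ≤ 1) (hβ : 0 < β) (hβ1 : β < 1) (hσ : privacyScale P.T P.B P.ρ α β ≤ P.σ)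
    (R : P.ArgmaxRule) : P.IsJDP R α β := by
  intro t S S' hS hS' hSS E hE
  set L := Real.log (10 / β) with hL
  set L8 := Real.log (8 / β) with hL8
  have hL0 : 0 < L := Real.log_pos (by rw [lt_div_iff₀ hβ]; linarith)
  have hL80 : 0 < L8 := Real.log_pos (by rw [lt_div_iff₀ hβ]; linarith)
  set r := P.ρ * √(2 * L8) with hr
  have hr0 : 0 ≤ r := by positivity
  have hr2 : r ^ 2 = 2 * P.ρ ^ 2 * L8 := by
    rw [hr, mul_pow, Real.sq_sqrt (by positivity)]; ring
  -- Off the bad events each squared reward is at most `2 (B² + r²)`, so one plus twice both squares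
  -- is at most `M`. The constant `4` in `privacyScale` is the one for which `σ² α² / (2L)` reaches
  -- `depth * M`.
  set M := 8 * (1 + P.B ^ 2 + 2 * P.ρ ^ 2 * L8) with hM
  have hdep : (0 : ℝ) < P.depth := by
    rw [depth]; positivity
  have hX : 0 < (P.depth : ℝ) * (1 + P.B ^ 2 + 2 * P.ρ ^ 2 * L8) * L := by positivity
  have hsc : privacyScale P.T P.B P.ρ α β =
      4 * √((P.depth : ℝ) * (1 + P.B ^ 2 + 2 * P.ρ ^ 2 * L8) * L) / α := rfl
  have hσ0 : 0 < P.σ := by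
    refine lt_of_lt_of_le ?_ hσ
    rw [hsc]
    positivity
  have hMσ : P.depth * M ≤ P.σ ^ 2 * (α ^ 2 / (2 * L)) := by
    have h1 : (privacyScale P.T P.B P.ρ α β) ^ 2 ≤ P.σ ^ 2 := by
      refine pow_le_pow_left₀ ?_ hσ 2
      rw [hsc]; positivity
    rw [hsc, div_pow, mul_pow, Real.sq_sqrt hX.le] at h1
    calc P.depth * M = (4 ^ 2 * (P.depth * (1 + P.B ^ 2 + 2 * P.ρ ^ 2 * L8) * L) / α ^ 2) *
          (α ^ 2 / (2 * L)) := by rw [hM]; field_simp; ring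
      _ ≤ _ := by gcongr
  set π := Measure.pi fun i => ((S i).noise : Measure ℝ) with hπ
  set π' := Measure.pi fun i => ((S' i).noise : Measure ℝ) with hπ'
  set G : P.TreeNoise → (Fin P.T → ℝ) → ℝ≥0∞ := fun N e =>
    E.indicator 1 (fun i : {i // i ≠ t} => P.actionAt R S N e i) with hG
  set G' : P.TreeNoise → (Fin P.T → ℝ) → ℝ≥0∞ := fun N e =>
    E.indicator 1 (fun i : {i // i ≠ t} => P.actionAt R S' N e i) with hG'
  have hmeas : ∀ S : Fin P.T → User d, Measurable fun z : P.TreeNoise × (Fin P.T → ℝ) =>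
      (E.indicator 1 (fun i : {i // i ≠ t} => P.actionAt R S z.1 z.2 i) : ℝ≥0∞) := fun S =>
    (measurable_one.indicator hE).comp (measurable_pi_lambda _ fun i =>
      P.measurable_actionAt R S measurable_fst measurable_snd _)
  have hprob : ∀ S : Fin P.T → User d,
      P.sampleMeasure S {ω | (fun i : {i // i ≠ t} => P.actions R S ω i) ∈ E} =
      ∫⁻ e, ∫⁻ N, E.indicator 1 (fun i : {i // i ≠ t} => P.actionAt R S N e i) ∂P.treeMeasure
        ∂(Measure.pi fun i => ((S i).noise : Measure ℝ)) := by
    intro S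
    have h1 : MeasurableSet {ω | (fun i : {i // i ≠ t} => P.actions R S ω i) ∈ E} :=
      (measurable_pi_lambda _ fun i : {i // i ≠ t} =>
        (measurable_pi_apply i.1).comp (P.measurable_actions R S)) hE
    rw [← lintegral_indicator_one h1, sampleMeasure_eq, ← lintegral_prod_symm' _ (hmeas S)]
    refine lintegral_congr fun ω => ?_
    have h2 : (fun i : {i // i ≠ t} => P.actions R S ω i) =
        fun i : {i // i ≠ t} => P.actionAt R S ω.1 ω.2 i :=
      funext fun i => P.actions_eq_actionAt R S ω i
    rw [← h2]
    rfl
  set bad : ℝ → ℝ≥0∞ := {x : ℝ | r < |x|}.indicator 1 with hbad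
  have hbadset : MeasurableSet {x : ℝ | r < |x|} := measurableSet_lt measurable_const (by fun_prop)
  have hbadm : Measurable bad := measurable_one.indicator hbadset
  have hbadint : ∀ (S : Fin P.T → User d), (∀ i, (S i).Admissible P.B P.ρ) →
      ∫⁻ e, bad (e t) ∂(Measure.pi fun i => ((S i).noise : Measure ℝ)) ≤
        ENNReal.ofReal (β / 4) := by
    intro S hS
    rw [(measurePreserving_eval (fun i => ((S i).noise : Measure ℝ)) t).lintegral_comp hbadm,
      hbad, lintegral_indicator_one hbadset]
    refine (measure_abs_gt_le hρ (hS t).2 hL80.le).trans (ENNReal.ofReal_le_ofReal (le_of_eq ?_))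
    rw [hL8, Real.exp_neg, Real.exp_log (by positivity)]
    field_simp
    norm_num
  have hG1 : ∀ e, ∫⁻ N, G N e ∂P.treeMeasure ≤ 1 := fun e =>
    calc ∫⁻ N, G N e ∂P.treeMeasure ≤ ∫⁻ _, 1 ∂P.treeMeasure :=
          lintegral_mono fun N => Set.indicator_le_self' (f := 1) (by simp) _
      _ = 1 := by simp
  have hpt : ∀ e e', ∫⁻ N, G N e ∂P.treeMeasure ≤
      (ENNReal.ofReal (Real.exp α) * ∫⁻ N, G' N (({t} : Set (Fin P.T)).piecewise e' e) ∂P.treeMeasure +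
        ENNReal.ofReal (Real.exp (1 / 2 - L))) + (bad (e t) + bad (e' t)) := by
    intro e e'
    by_cases h1 : r < |e t|
    · have : bad (e t) = 1 := Set.indicator_of_mem (show e t ∈ {x : ℝ | r < |x|} from h1) _
      rw [this]
      refine le_trans ?_ (le_add_left (le_add_right le_rfl))
      exact hG1 e
    by_cases h2 : r < |e' t|
    · have : bad (e' t) = 1 := Set.indicator_of_mem (show e' t ∈ {x : ℝ | r < |x|} from h2) _
      rw [this]
      refine le_trans ?_ (le_add_left (le_add_left le_rfl))
      exact hG1 e
    refine le_add_right (P.lintegral_actions_le R hSS hσ0 hα hα1 hL0 hMσ hfeat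
      (fun i hi => by simp [hi]) (fun x x' => ?_) hE)
    have hb : ∀ (m x : ℝ), |m| ≤ P.B → ¬ r < |x| →
        (m + x) ^ 2 ≤ 2 * (P.B ^ 2 + 2 * P.ρ ^ 2 * L8) := by
      intro m x hm hx
      have h3 : m ^ 2 ≤ P.B ^ 2 := by
        rw [← sq_abs m]; exact pow_le_pow_left₀ (abs_nonneg _) hm 2
      have h4 : x ^ 2 ≤ r ^ 2 := by
        rw [← sq_abs x]; exact pow_le_pow_left₀ (abs_nonneg _) (not_lt.mp hx) 2
      rw [hr2] at h4
      nlinarith [sq_nonneg (m - x)]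
    have h3 := hb _ _ ((hS t).1 x) h1
    have h4 := hb _ _ ((hS' t).1 x') h2
    simp only [Set.mem_singleton_iff, Set.piecewise_eq_of_mem]
    rw [hM]
    linarith
  have hpres : MeasurePreserving
      (fun p : (Fin P.T → ℝ) × (Fin P.T → ℝ) => ({t} : Set (Fin P.T)).piecewise p.2 p.1)
      (π.prod π') π' :=
    measurePreserving_piecewise {t} _ (fun _ _ => rfl) fun i hi => by rw [hSS i hi]
  have hA : Measurable fun e => ∫⁻ N, G N e ∂P.treeMeasure := (hmeas S).lintegral_prod_left'
  have hA' : Measurable fun e => ∫⁻ N, G' N e ∂P.treeMeasure := (hmeas S').lintegral_prod_left'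
  have hB' : Measurable fun p : (Fin P.T → ℝ) × (Fin P.T → ℝ) =>
      ∫⁻ N, G' N (({t} : Set (Fin P.T)).piecewise p.2 p.1) ∂P.treeMeasure :=
    hA'.comp hpres.measurable
  have hb1 : Measurable fun p : (Fin P.T → ℝ) × (Fin P.T → ℝ) => bad (p.1 t) :=
    hbadm.comp ((measurable_pi_apply t).comp measurable_fst)
  have hb2 : Measurable fun p : (Fin P.T → ℝ) × (Fin P.T → ℝ) => bad (p.2 t) :=
    hbadm.comp ((measurable_pi_apply t).comp measurable_snd)
  have hmain : P.sampleMeasure S {ω | (fun i : {i // i ≠ t} => P.actions R S ω i) ∈ E} ≤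
      ENNReal.ofReal (Real.exp α) *
        P.sampleMeasure S' {ω | (fun i : {i // i ≠ t} => P.actions R S' ω i) ∈ E} +
        ENNReal.ofReal β := by
    rw [hprob S, hprob S']
    calc ∫⁻ e, ∫⁻ N, G N e ∂P.treeMeasure ∂π
        = ∫⁻ e, ∫⁻ _ : Fin P.T → ℝ, ∫⁻ N, G N e ∂P.treeMeasure ∂π' ∂π := by simp
      _ ≤ ∫⁻ e, ∫⁻ e', (ENNReal.ofReal (Real.exp α) *
            ∫⁻ N, G' N (({t} : Set (Fin P.T)).piecewise e' e) ∂P.treeMeasure +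
          ENNReal.ofReal (Real.exp (1 / 2 - L))) + (bad (e t) + bad (e' t)) ∂π' ∂π :=
        lintegral_mono fun e => lintegral_mono fun e' => hpt e e'
      _ = ∫⁻ p, (ENNReal.ofReal (Real.exp α) *
            ∫⁻ N, G' N (({t} : Set (Fin P.T)).piecewise p.2 p.1) ∂P.treeMeasure +
          ENNReal.ofReal (Real.exp (1 / 2 - L))) + (bad (p.1 t) + bad (p.2 t)) ∂(π.prod π') := by
        rw [lintegral_prod]
        exact (((hB'.const_mul _).add_const _).add (hb1.add hb2)).aemeasurable
      _ = (ENNReal.ofReal (Real.exp α) * ∫⁻ e, ∫⁻ N, G' N e ∂P.treeMeasure ∂π' +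
          ENNReal.ofReal (Real.exp (1 / 2 - L))) +
          (∫⁻ e, bad (e t) ∂π + ∫⁻ e, bad (e t) ∂π') := by
        rw [lintegral_add_left ((hB'.const_mul _).add_const _),
          lintegral_add_right _ measurable_const, lintegral_const_mul _ hB',
          lintegral_add_left hb1]
        congr 2
        · rw [← hpres.lintegral_comp hA']
        · simp
        · exact (measurePreserving_fst (μ := π) (ν := π')).lintegral_comp
            (hbadm.comp (measurable_pi_apply t))
        · exact (measurePreserving_snd (μ := π) (ν := π')).lintegral_comp
            (hbadm.comp (measurable_pi_apply t))
      _ ≤ (ENNReal.ofReal (Real.exp α) * ∫⁻ e, ∫⁻ N, G' N e ∂P.treeMeasure ∂π' +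
          ENNReal.ofReal (β / 2)) + (ENNReal.ofReal (β / 4) + ENNReal.ofReal (β / 4)) := by
        refine add_le_add (add_le_add le_rfl (ENNReal.ofReal_le_ofReal ?_))
          (add_le_add (hbadint S hS) (hbadint S' hS'))
        rw [sub_eq_add_neg, Real.exp_add, hL, Real.exp_neg, Real.exp_log (by positivity), inv_div]
        have h3 : Real.exp (1 / 2) ≤ 5 := by
          have := Real.exp_one_lt_d9
          have h4 : Real.exp (1 / 2) ≤ Real.exp 1 := Real.exp_le_exp.mpr (by norm_num)
          linarith
        nlinarith
      _ = _ := by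
        rw [add_assoc, ← ENNReal.ofReal_add (by positivity) (by positivity),
          ← ENNReal.ofReal_add (by positivity) (by positivity)]
        congr 2
        ring
  have hfin := ENNReal.toReal_mono (by
    exact ENNReal.add_ne_top.mpr ⟨ENNReal.mul_ne_top ENNReal.ofReal_ne_top (measure_ne_top _ _),
      ENNReal.ofReal_ne_top⟩) hmain
  rw [ENNReal.toReal_add (ENNReal.mul_ne_top ENNReal.ofReal_ne_top (measure_ne_top _ _))
    ENNReal.ofReal_ne_top, ENNReal.toReal_mul, ENNReal.toReal_ofReal (Real.exp_pos _).le,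
    ENNReal.toReal_ofReal hβ.le] at hfin
  exact hfin

end Params
end PrivateGPBandit

end

noncomputable section
namespace PrivateGPBandit
set_option linter.unusedSectionVars false
open Matrix
open scoped ENNReal

/-! ### Gaussian integrals -/

theorem lintegral_exp_quadratic_gaussianReal {θ : ℝ} (hθ : θ < 1) (c : ℝ) :
    ∫⁻ x, ENNReal.ofReal (Real.exp (θ * x ^ 2 / 2 + c * x)) ∂(gaussianReal 0 1) =
      ENNReal.ofReal ((√(1 - θ))⁻¹ * Real.exp (c ^ 2 / (2 * (1 - θ)))) := by
  have h0 : 0 < 1 - θ := by linarith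
  set v : NNReal := ⟨(1 - θ)⁻¹, by positivity⟩ with hv
  have hvc : (v : ℝ) = (1 - θ)⁻¹ := rfl
  have hv0 : v ≠ 0 := by
    intro h
    have := congrArg (fun z : NNReal => (z : ℝ)) h
    simp only [hvc, NNReal.coe_zero] at this
    exact (inv_pos.mpr h0).ne' this
  rw [gaussianReal_of_var_ne_zero _ one_ne_zero, lintegral_withDensity_eq_lintegral_mul _
    (measurable_gaussianPDF 0 1) (by fun_prop)]
  have hpt : ∀ x, (gaussianPDF 0 1 * fun x => ENNReal.ofReal (Real.exp (θ * x ^ 2 / 2 + c * x))) x =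
      ENNReal.ofReal ((√(1 - θ))⁻¹ * Real.exp (c ^ 2 / (2 * (1 - θ)))) *
        gaussianPDF (c / (1 - θ)) v x := by
    intro x
    simp only [Pi.mul_apply, gaussianPDF]
    rw [← ENNReal.ofReal_mul (gaussianPDFReal_nonneg _ _ _), ← ENNReal.ofReal_mul (by positivity)]
    congr 1
    simp only [gaussianPDFReal, hvc, NNReal.coe_one, mul_one, sub_zero]
    rw [mul_assoc, ← Real.exp_add, mul_mul_mul_comm, ← Real.exp_add]
    congr 1
    · rw [Real.sqrt_mul (by positivity) (1 - θ)⁻¹, Real.sqrt_inv]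
      have : √(1 - θ) ≠ 0 := (Real.sqrt_pos.mpr h0).ne'
      have : √(2 * Real.pi) ≠ 0 := (Real.sqrt_pos.mpr (by positivity)).ne'
      field_simp
    · congr 1
      field_simp
      ring
  rw [lintegral_congr hpt, lintegral_const_mul _ (measurable_gaussianPDF _ _),
    lintegral_gaussianPDF_eq_one _ hv0, mul_one]

/-! ### The norm of a sub-Gaussian vector -/

section Concentration

variable {Ω ι : Type*} [MeasurableSpace Ω] [Fintype ι] [DecidableEq ι] {μ : Measure Ω}
  [IsProbabilityMeasure μ]

/-- `exp(l² |η|² / 2)` is the average of `exp(l ⟨g, η⟩)` over a standard Gaussian `g`. Exchanging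
the integrals reduces to the sub-Gaussian hypothesis and a product of one-dimensional Gaussian
integrals. Markov's inequality follows, with `θ = 1 - n/r²` minimizing the exponent at radius `s r`.
-/
theorem measure_dotProduct_self_gt_le {η : Ω → ι → ℝ} (hη : Measurable η) {s : ℝ} (hs : 0 < s)
    (h : ∀ w, ∫⁻ ω, ENNReal.ofReal (Real.exp (w ⬝ᵥ η ω)) ∂μ ≤
      ENNReal.ofReal (Real.exp (s ^ 2 * (w ⬝ᵥ w) / 2))) [Nonempty ι] {x : ℝ} (hx : 0 ≤ x) :
    μ {ω | (s * (√(Fintype.card ι) + √(2 * x))) ^ 2 < η ω ⬝ᵥ η ω} ≤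
      ENNReal.ofReal (Real.exp (-x)) := by
  set n : ℝ := (Fintype.card ι : ℝ) with hn
  have hn0 : 0 < n := by rw [hn]; exact_mod_cast Fintype.card_pos
  set y := √(2 * x) with hy
  have hy0 : 0 ≤ y := Real.sqrt_nonneg _
  have hy2 : y ^ 2 = 2 * x := Real.sq_sqrt (by positivity)
  set r := √n + y with hr
  have hsn : 0 < √n := Real.sqrt_pos.mpr hn0
  have hsn2 : √n ^ 2 = n := Real.sq_sqrt hn0.le
  have hr0 : 0 < r := by positivity
  set θ := 1 - n / r ^ 2 with hθ
  have hθ1 : 1 - θ = n / r ^ 2 := by rw [hθ]; ring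
  have hθ0 : 0 ≤ θ := by
    rw [hθ, sub_nonneg, div_le_one (by positivity)]
    nlinarith
  have hθlt : θ < 1 := by have : 0 < n / r ^ 2 := by positivity
                          linarith
  set γ : Measure (ι → ℝ) := Measure.pi fun _ => gaussianReal 0 1 with hγ
  have hshift : HasGaussianShift γ 1 fun δ x => ∑ i, δ i * x i := by
    have h1 := hasGaussianShift_gaussianReal (v := 1) one_ne_zero
    simpa using HasGaussianShift.pi fun _ : ι => h1
  have hlin : ∀ z : ι → ℝ, ∫⁻ g, ENNReal.ofReal (Real.exp (z ⬝ᵥ g)) ∂γ =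
      ENNReal.ofReal (Real.exp (z ⬝ᵥ z / 2)) := by
    intro z
    have := hshift.lintegral_exp one_pos
      (fun c δ x => by simp only [Pi.smul_apply, smul_eq_mul, Finset.mul_sum, mul_assoc])
      (fun c δ x => by simp only [Pi.smul_apply, smul_eq_mul, Finset.mul_sum, mul_left_comm]) z
    rw [one_mul] at this
    exact this
  set l := √θ / s with hl
  have hl2 : l ^ 2 = θ / s ^ 2 := by rw [hl, div_pow, Real.sq_sqrt hθ0]
  have hA : ∫⁻ ω, ENNReal.ofReal (Real.exp (l ^ 2 * (η ω ⬝ᵥ η ω) / 2)) ∂μ ≤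
      ENNReal.ofReal ((√(1 - θ))⁻¹ ^ Fintype.card ι) := by
    calc ∫⁻ ω, ENNReal.ofReal (Real.exp (l ^ 2 * (η ω ⬝ᵥ η ω) / 2)) ∂μ
        = ∫⁻ ω, ∫⁻ g, ENNReal.ofReal (Real.exp ((l • g) ⬝ᵥ η ω)) ∂γ ∂μ := by
          refine lintegral_congr fun ω => ?_
          have := hlin (l • η ω)
          simp only [smul_dotProduct, dotProduct_smul, smul_eq_mul] at this
          rw [show l ^ 2 * (η ω ⬝ᵥ η ω) / 2 = l * (l * (η ω ⬝ᵥ η ω)) / 2 by ring, ← this]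
          refine lintegral_congr fun g => ?_
          rw [smul_dotProduct, dotProduct_comm, smul_eq_mul]
      _ = ∫⁻ g, ∫⁻ ω, ENNReal.ofReal (Real.exp ((l • g) ⬝ᵥ η ω)) ∂μ ∂γ := by
          rw [lintegral_lintegral_swap]
          refine Measurable.aemeasurable ?_
          refine ENNReal.measurable_ofReal.comp (Real.measurable_exp.comp ?_)
          exact measurable_dotProduct (measurable_snd.const_smul l) (hη.comp measurable_fst)
      _ ≤ ∫⁻ g, ENNReal.ofReal (Real.exp (s ^ 2 * ((l • g) ⬝ᵥ (l • g)) / 2)) ∂γ :=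
          lintegral_mono fun g => h _
      _ = ∫⁻ g, ∏ i, ENNReal.ofReal (Real.exp (θ * g i ^ 2 / 2 + 0 * g i)) ∂γ := by
          refine lintegral_congr fun g => ?_
          rw [← ENNReal.ofReal_prod_of_nonneg fun i _ => (Real.exp_pos _).le, ← Real.exp_sum]
          congr 2
          simp only [smul_dotProduct, dotProduct_smul, smul_eq_mul, zero_mul, add_zero,
            ← Finset.sum_div, ← Finset.mul_sum]
          have e1 : ∑ i, g i ^ 2 = g ⬝ᵥ g := Finset.sum_congr rfl fun i _ => sq (g i)
          rw [e1, show s ^ 2 * (l * (l * (g ⬝ᵥ g))) / 2 = s ^ 2 * l ^ 2 * (g ⬝ᵥ g) / 2 by ring, hl2]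
          congr 2
          field_simp
      _ = _ := by
          rw [lintegral_fintype_prod_eq_prod
            (fun _ z => ENNReal.ofReal (Real.exp (θ * z ^ 2 / 2 + 0 * z))) (fun _ => by fun_prop)]
          simp only [lintegral_exp_quadratic_gaussianReal hθlt]
          rw [Finset.prod_const, Finset.card_univ, ← ENNReal.ofReal_pow (by positivity)]
          simp
  have hB : (√(1 - θ))⁻¹ ^ Fintype.card ι ≤ Real.exp (√n * y) := by
    rw [hθ1, Real.sqrt_div hn0.le, Real.sqrt_sq hr0.le, inv_div]
    have h1 : r / √n ≤ Real.exp (y / √n) := by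
      have : r / √n = y / √n + 1 := by rw [hr]; field_simp; ring
      rw [this]
      exact Real.add_one_le_exp _
    calc (r / √n) ^ Fintype.card ι ≤ Real.exp (y / √n) ^ Fintype.card ι :=
          pow_le_pow_left₀ (by positivity) h1 _
      _ = Real.exp (√n * y) := by
          rw [← Real.exp_nat_mul, ← hn]
          congr 1
          nth_rewrite 1 [← hsn2]
          field_simp
  have hC : l ^ 2 * (s * r) ^ 2 / 2 = √n * y + x := by
    rw [hl2]
    have : θ / s ^ 2 * (s * r) ^ 2 / 2 = (r ^ 2 - n) / 2 := by rw [hθ]; field_simp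
    rw [this, hr]
    nlinarith
  have hmark := meas_ge_le_lintegral_div (μ := μ)
    (f := fun ω => ENNReal.ofReal (Real.exp (l ^ 2 * (η ω ⬝ᵥ η ω) / 2)))
    (ENNReal.measurable_ofReal.comp (Real.measurable_exp.comp
      (((measurable_dotProduct hη hη).const_mul _).div_const _))).aemeasurable
    (ε := ENNReal.ofReal (Real.exp (√n * y + x))) (by simp [Real.exp_pos]) ENNReal.ofReal_ne_top
  refine le_trans (measure_mono fun ω hω => ?_) (hmark.trans ?_)
  · refine ENNReal.ofReal_le_ofReal (Real.exp_le_exp.mpr ?_)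
    rw [← hC]
    have : (s * r) ^ 2 < η ω ⬝ᵥ η ω := hω
    have := mul_le_mul_of_nonneg_left this.le (sq_nonneg l)
    linarith
  · refine (ENNReal.div_le_div_right (hA.trans (ENNReal.ofReal_le_ofReal hB)) _).trans (le_of_eq ?_)
    rw [← ENNReal.ofReal_div_of_pos (Real.exp_pos _), ← Real.exp_sub]
    congr 2
    ring

/-! ### The quadratic form of a random symmetric matrix -/

/-- If the quadratic form of a symmetric matrix exceeds `L` somewhere on the sphere, then with one
of the two signs it is large on a ball of radius `1/10` around a unit vector. -/
theorem exists_forall_le_quad {A : Matrix ι ι ℝ} (hA : A.IsHermitian) {L : ℝ}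
    {v : ι → ℝ} (hv : L * (v ⬝ᵥ v) < |quad A v|) :
    ∃ u : EuclideanSpace ℝ ι, ‖u‖ = 1 ∧
      ((∀ z ∈ Metric.closedBall u (1 / 10), 79 / 100 * L ≤ quad A z.ofLp) ∨
        ∀ z ∈ Metric.closedBall u (1 / 10), 79 / 100 * L ≤ -quad A z.ofLp) := by
  have hdot : ∀ z : EuclideanSpace ℝ ι, z.ofLp ⬝ᵥ z.ofLp = ‖z‖ ^ 2 := fun z => by
    rw [EuclideanSpace.real_norm_sq_eq]
    exact Finset.sum_congr rfl fun i _ => (sq _).symm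
  have hcont : Continuous fun z : EuclideanSpace ℝ ι => |quad A z.ofLp| := by
    unfold quad dotProduct mulVec dotProduct
    fun_prop
  have hv0 : (WithLp.toLp 2 v : EuclideanSpace ℝ ι) ≠ 0 := by
    intro h
    have : v = 0 := by simpa using congrArg WithLp.ofLp h
    subst this
    simp [quad] at hv
  have : Nontrivial (EuclideanSpace ℝ ι) := ⟨⟨_, _, hv0⟩⟩
  obtain ⟨u, hu, hmax⟩ := (isCompact_sphere (0 : EuclideanSpace ℝ ι) 1).exists_isMaxOn
    (NormedSpace.sphere_nonempty.mpr zero_le_one) hcont.continuousOn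
  have hu1 : ‖u‖ = 1 := by simpa using hu
  set l := |quad A u.ofLp| with hl
  have hbound : ∀ z : EuclideanSpace ℝ ι, |quad A z.ofLp| ≤ l * ‖z‖ ^ 2 := by
    intro z
    by_cases hz : z = 0
    · subst hz; simp [quad]
    have hz0 : ‖z‖ ≠ 0 := norm_ne_zero_iff.mpr hz
    have h1 : |quad A (‖z‖⁻¹ • z).ofLp| ≤ l := hmax (by simp [norm_smul, hz0])
    rw [WithLp.ofLp_smul, quad_smul, abs_mul, abs_of_nonneg (sq_nonneg _), inv_pow,
      inv_mul_le_iff₀ (by positivity)] at h1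
    linarith
  have hLl : L < l := by
    have h1 := hbound (WithLp.toLp 2 v)
    have h2 := hdot (WithLp.toLp 2 v)
    have h3 : 0 < ‖(WithLp.toLp 2 v : EuclideanSpace ℝ ι)‖ ^ 2 := by positivity
    simp only at h1 h2
    rw [h2] at hv
    exact lt_of_mul_lt_mul_right (hv.trans_le h1) h3.le
  -- Polarization of `w` against `u/10`, so that both vectors have norm at most `1/10`: the
  -- parallelogram law bounds four times the cross term by `4l/100`.
  have hcross : ∀ w : EuclideanSpace ℝ ι, ‖w‖ ≤ 1 / 10 → |w.ofLp ⬝ᵥ A *ᵥ u.ofLp| ≤ l / 10 := by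
    intro w hw
    have h1 := quad_add hA w.ofLp ((1 / 10 : ℝ) • u.ofLp)
    have h2 := quad_sub hA w.ofLp ((1 / 10 : ℝ) • u.ofLp)
    have h3 := hbound (w + (1 / 10 : ℝ) • u)
    have h4 := hbound (w - (1 / 10 : ℝ) • u)
    rw [WithLp.ofLp_add, WithLp.ofLp_smul] at h3
    rw [WithLp.ofLp_sub, WithLp.ofLp_smul] at h4
    have h5 := parallelogram_law_with_norm ℝ w ((1 / 10 : ℝ) • u)
    rw [norm_smul, hu1] at h5
    norm_num at h5
    rw [mulVec_smul, dotProduct_smul, smul_eq_mul] at h1 h2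
    have h6 : ‖w‖ * ‖w‖ ≤ 1 / 100 := by nlinarith [norm_nonneg w]
    have h7 : ‖w + (1 / 10 : ℝ) • u‖ ^ 2 + ‖w - (1 / 10 : ℝ) • u‖ ^ 2 ≤ 4 / 100 := by
      nlinarith
    have h8 : l * ‖w + (1 / 10 : ℝ) • u‖ ^ 2 + l * ‖w - (1 / 10 : ℝ) • u‖ ^ 2 ≤ l * (4 / 100) := by
      rw [← mul_add]; exact mul_le_mul_of_nonneg_left h7 (abs_nonneg _)
    have h9 := abs_le.mp h3
    have h10 := abs_le.mp h4
    rw [abs_le]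
    constructor <;> linarith [h9.1, h9.2, h10.1, h10.2]
  -- Twice the cross term plus the square term: `2 · l/10 + l/100 = 21/100 · l`, which leaves
  -- `79/100`.
  have hball : ∀ z ∈ Metric.closedBall u (1 / 10),
      |quad A z.ofLp - quad A u.ofLp| ≤ 21 / 100 * l := by
    intro z hz
    have hw : ‖z - u‖ ≤ 1 / 10 := by simpa [dist_eq_norm] using hz
    have h1 := quad_add hA (z - u).ofLp u.ofLp
    rw [← WithLp.ofLp_add, sub_add_cancel] at h1
    have h2 := hbound (z - u)
    have h3 := hcross _ hw
    have h4 : l * ‖z - u‖ ^ 2 ≤ l * (1 / 100) :=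
      mul_le_mul_of_nonneg_left (by nlinarith [norm_nonneg (z - u)]) (abs_nonneg _)
    rw [h1, abs_le]
    have h5 := abs_le.mp h2
    have h6 := abs_le.mp h3
    constructor <;> linarith [h5.1, h5.2, h6.1, h6.2]
  refine ⟨u, hu1, ?_⟩
  rcases abs_choice (quad A u.ofLp) with h | h
  · left
    intro z hz
    have := abs_le.mp (hball z hz)
    linarith [this.1]
  · right
    intro z hz
    have := abs_le.mp (hball z hz)
    linarith [this.2]

/-- An integral replaces the usual net. Integrate `exp(c q) + exp(-c q)`, `q` being the quadratic
form, over the ball of radius `11/10`. On the event the integrand is at least `exp(0.79 c L)` on a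
ball of radius `1/10` inside, so Markov's inequality costs the volume ratio `11^n`. The factor `2`
comes from the two signs and `(11/10)^4` from `|z|⁴`. -/
theorem measure_exists_quad_gt_le {M : Ω → Matrix ι ι ℝ} (hM : ∀ i j, Measurable fun ω => M ω i j)
    (hsymm : ∀ ω, (M ω).IsHermitian) {s : ℝ}
    (h : ∀ (c : ℝ) (v : ι → ℝ), ∫⁻ ω, ENNReal.ofReal (Real.exp (c * quad (M ω) v)) ∂μ ≤
      ENNReal.ofReal (Real.exp (c ^ 2 * s ^ 2 * (v ⬝ᵥ v) ^ 2))) {c L : ℝ} (hc : 0 ≤ c) :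
    μ {ω | ∃ v, L * (v ⬝ᵥ v) < |quad (M ω) v|} ≤
      ENNReal.ofReal (2 * 11 ^ Fintype.card ι *
        Real.exp (c ^ 2 * s ^ 2 * (11 / 10) ^ 4 - c * (79 / 100 * L))) := by
  have hdot : ∀ z : EuclideanSpace ℝ ι, z.ofLp ⬝ᵥ z.ofLp = ‖z‖ ^ 2 := fun z => by
    rw [EuclideanSpace.real_norm_sq_eq]
    exact Finset.sum_congr rfl fun i _ => (sq _).symm
  set F : Ω → EuclideanSpace ℝ ι → ℝ≥0∞ := fun ω z => ENNReal.ofReal (Real.exp (c * quad (M ω) z.ofLp)) +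
    ENNReal.ofReal (Real.exp (-c * quad (M ω) z.ofLp)) with hF
  have hqm : Measurable fun p : Ω × EuclideanSpace ℝ ι => quad (M p.1) p.2.ofLp := by
    have h1 : Measurable fun p : Ω × EuclideanSpace ℝ ι => p.2.ofLp :=
      (WithLp.measurable_ofLp 2 (ι → ℝ)).comp measurable_snd
    exact measurable_dotProduct h1 (measurable_mulVec (fun i j => (hM i j).comp measurable_fst) h1)
  have hF1 : Measurable fun p : Ω × EuclideanSpace ℝ ι => ENNReal.ofReal (Real.exp (c * quad (M p.1) p.2.ofLp)) :=
    ENNReal.measurable_ofReal.comp (Real.measurable_exp.comp (hqm.const_mul _))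
  have hF2 : Measurable fun p : Ω × EuclideanSpace ℝ ι => ENNReal.ofReal (Real.exp (-c * quad (M p.1) p.2.ofLp)) :=
    ENNReal.measurable_ofReal.comp (Real.measurable_exp.comp (hqm.const_mul _))
  have hFm : Measurable (Function.uncurry F) := hF1.add hF2
  have hF1z : ∀ z : EuclideanSpace ℝ ι, Measurable fun ω => ENNReal.ofReal (Real.exp (c * quad (M ω) z.ofLp)) :=
    fun z => Measurable.of_uncurry_right (f := fun ω (z : EuclideanSpace ℝ ι) =>
      ENNReal.ofReal (Real.exp (c * quad (M ω) z.ofLp))) hF1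
  have hFω : ∀ ω, Measurable (F ω) := fun ω => hFm.of_uncurry_left
  set n := Fintype.card ι with hn
  set K := Metric.closedBall (0 : EuclideanSpace ℝ ι) (11 / 10) with hK
  set κ := (volume : Measure (EuclideanSpace ℝ ι)) (Metric.ball 0 1) with hκ
  have hκ0 : κ ≠ 0 := (Metric.measure_ball_pos volume _ one_pos).ne'
  have hκt : κ ≠ ∞ := measure_ball_lt_top.ne
  have hvol : ∀ (z : EuclideanSpace ℝ ι) {r : ℝ}, 0 ≤ r → volume (Metric.closedBall z r) =
      ENNReal.ofReal (r ^ n) * κ := fun z r hr => by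
    rw [Measure.addHaar_closedBall _ _ hr, finrank_euclideanSpace]
  set J : Ω → ℝ≥0∞ := fun ω => ∫⁻ z in K, F ω z with hJ
  have hJm : Measurable J := hFm.lintegral_prod_right'
  have hJint : ∫⁻ ω, J ω ∂μ ≤ ENNReal.ofReal (2 * Real.exp (c ^ 2 * s ^ 2 * (11 / 10) ^ 4)) *
      (ENNReal.ofReal ((11 / 10) ^ n) * κ) := by
    rw [hJ, lintegral_lintegral_swap hFm.aemeasurable, ← hvol 0 (by norm_num),
      ← setLIntegral_const]
    refine setLIntegral_mono measurable_const fun z hz => ?_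
    rw [hF]
    simp only
    rw [lintegral_add_left (hF1z z), two_mul,
      ENNReal.ofReal_add (by positivity) (by positivity)]
    have hz' : ‖z‖ ≤ 11 / 10 := mem_closedBall_zero_iff.mp hz
    have hb : c ^ 2 * s ^ 2 * (z.ofLp ⬝ᵥ z.ofLp) ^ 2 ≤ c ^ 2 * s ^ 2 * (11 / 10) ^ 4 := by
      rw [hdot, ← pow_mul]
      gcongr
    refine add_le_add ((h c _).trans ?_) ((h (-c) _).trans ?_)
    · exact ENNReal.ofReal_le_ofReal (Real.exp_le_exp.mpr hb)
    · rw [neg_sq]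
      exact ENNReal.ofReal_le_ofReal (Real.exp_le_exp.mpr hb)
  have hlow : ∀ ω, (∃ v, L * (v ⬝ᵥ v) < |quad (M ω) v|) →
      ENNReal.ofReal (Real.exp (c * (79 / 100 * L))) * (ENNReal.ofReal ((1 / 10) ^ n) * κ) ≤
        J ω := by
    rintro ω ⟨v, hv⟩
    obtain ⟨u, hu, hball⟩ := exists_forall_le_quad (hsymm ω) hv
    rw [← hvol u (by norm_num), ← setLIntegral_const]
    have hsub : Metric.closedBall u (1 / 10) ⊆ K := by
      intro z hz
      have h1 : ‖z - u‖ ≤ 1 / 10 := by simpa [dist_eq_norm] using hz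
      have h2 : ‖z‖ ≤ ‖z - u‖ + ‖u‖ := by simpa using norm_add_le (z - u) u
      rw [hK, mem_closedBall_zero_iff]
      rw [hu] at h2
      linarith
    change _ ≤ ∫⁻ z in K, F ω z
    refine le_trans ?_ (lintegral_mono_set hsub)
    refine setLIntegral_mono (hFω ω) fun z hz => ?_
    change _ ≤ ENNReal.ofReal (Real.exp (c * quad (M ω) z.ofLp)) +
      ENNReal.ofReal (Real.exp (-c * quad (M ω) z.ofLp))
    rcases hball with hb | hb
    · refine le_add_right (ENNReal.ofReal_le_ofReal (Real.exp_le_exp.mpr ?_))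
      exact mul_le_mul_of_nonneg_left (hb z hz) hc
    · refine le_add_left (ENNReal.ofReal_le_ofReal (Real.exp_le_exp.mpr ?_))
      have := mul_le_mul_of_nonneg_left (hb z hz) hc
      linarith
  set low := ENNReal.ofReal (Real.exp (c * (79 / 100 * L))) * (ENNReal.ofReal ((1 / 10) ^ n) * κ)
    with hlowdef
  have hlow0 : low ≠ 0 := by
    rw [hlowdef]
    refine mul_ne_zero ?_ (mul_ne_zero ?_ hκ0)
    · simp [Real.exp_pos]
    · simp
  have hlowt : low ≠ ∞ := by
    rw [hlowdef]
    exact ENNReal.mul_ne_top ENNReal.ofReal_ne_top (ENNReal.mul_ne_top ENNReal.ofReal_ne_top hκt)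
  have hmark := meas_ge_le_lintegral_div (μ := μ) hJm.aemeasurable hlow0 hlowt
  have hset : {ω | ∃ v, L * (v ⬝ᵥ v) < |quad (M ω) v|} ⊆ {ω | low ≤ J ω} := fun ω hω => hlow ω hω
  clear_value J low
  refine (measure_mono hset).trans (hmark.trans ?_)
  refine (ENNReal.div_le_div_right hJint _).trans (le_of_eq ?_)
  rw [hlowdef, ← mul_assoc, ← mul_assoc, ENNReal.mul_div_mul_right _ _ hκ0 hκt,
    ← ENNReal.ofReal_mul (by positivity), ← ENNReal.ofReal_mul (by positivity),
    ← ENNReal.ofReal_div_of_pos (by positivity)]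
  congr 1
  have h11 : ((11 : ℝ) / 10) ^ n = 11 ^ n * (1 / 10) ^ n := by rw [← mul_pow]; norm_num
  rw [Real.exp_sub, h11]
  field_simp

end Concentration

/-! ### A maximal inequality for products -/

open Classical in
/-- The process `W` stopped when it reaches `c`. -/
def stopAbove {X : Type*} (c : ℝ≥0∞) (W : ℕ → X → ℝ≥0∞) : ℕ → X → ℝ≥0∞
  | 0 => W 0
  | t + 1 => fun e => if c ≤ stopAbove c W t e then stopAbove c W t e else W (t + 1) e

/-- Ville's inequality: `W t` depends on the first `t` coordinates only and does not grow on
average. The process stopped at level `c` keeps mean at most one and stays above `c` once there, so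
Markov's inequality at time `T` suffices. -/
theorem measure_exists_ge_le {T : ℕ} {ν : Fin T → Measure ℝ} [∀ i, IsProbabilityMeasure (ν i)]
    {W : ℕ → (Fin T → ℝ) → ℝ≥0∞} (hW : ∀ t, Measurable (W t)) (hW0 : ∀ e, W 0 e ≤ 1)
    (hdep : ∀ (t s : ℕ) (hs : s < T) (e : Fin T → ℝ) (y : ℝ), t ≤ s →
      W t (Function.update e ⟨s, hs⟩ y) = W t e)
    (hstep : ∀ (t : ℕ) (ht : t < T) (e : Fin T → ℝ),
      ∫⁻ y, W (t + 1) (Function.update e ⟨t, ht⟩ y) ∂(ν ⟨t, ht⟩) ≤ W t e)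
    {c : ℝ≥0∞} (hc0 : c ≠ 0) (hct : c ≠ ∞) :
    Measure.pi ν {e | ∃ t ≤ T, c ≤ W t e} ≤ c⁻¹ := by
  classical
  set Z := stopAbove c W with hZdef
  have hZ : ∀ t e, Z (t + 1) e = if c ≤ Z t e then Z t e else W (t + 1) e := fun t e => rfl
  have hZm : ∀ t, Measurable (Z t) := by
    intro t
    induction t with
    | zero => exact hW 0
    | succ t ih => exact Measurable.ite (measurableSet_le measurable_const ih) ih (hW (t + 1))
  have hZdep : ∀ (t s : ℕ) (hs : s < T) (e : Fin T → ℝ) (y : ℝ), t ≤ s →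
      Z t (Function.update e ⟨s, hs⟩ y) = Z t e := by
    intro t
    induction t with
    | zero => exact hdep 0
    | succ t ih =>
      intro s hs e y hts
      rw [hZ, hZ, ih s hs e y (Nat.le_of_succ_le hts), hdep (t + 1) s hs e y hts]
  have hZW : ∀ t e, ¬ c ≤ Z t e → Z t e = W t e := by
    intro t e h
    cases t with
    | zero => rfl
    | succ t =>
      rw [hZ] at h ⊢
      split_ifs at h ⊢ with h1
      · exact absurd h1 h
      · rfl
  have hint : ∀ t ≤ T, ∫⁻ e, Z t e ∂Measure.pi ν ≤ 1 := by
    intro t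
    induction t with
    | zero =>
      intro _
      calc ∫⁻ e, Z 0 e ∂Measure.pi ν ≤ ∫⁻ _, 1 ∂Measure.pi ν := lintegral_mono hW0
        _ = 1 := by simp
    | succ t ih =>
      intro ht
      refine le_trans ?_ (ih (Nat.le_of_succ_le ht))
      set i : Fin T := ⟨t, ht⟩ with hi
      have hpres : MeasurePreserving
          (fun p : (Fin T → ℝ) × (Fin T → ℝ) => ({i} : Set (Fin T)).piecewise p.2 p.1)
          ((Measure.pi ν).prod (Measure.pi ν)) (Measure.pi ν) :=
        measurePreserving_piecewise {i} _ (fun _ _ => rfl) fun _ _ => rfl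
      have hpw : ∀ e e' : Fin T → ℝ,
          ({i} : Set (Fin T)).piecewise e' e = Function.update e i (e' i) := by
        intro e e'
        rw [Set.piecewise_singleton]
      have hm : Measurable fun p : (Fin T → ℝ) × (Fin T → ℝ) =>
          Z (t + 1) (({i} : Set (Fin T)).piecewise p.2 p.1) := (hZm (t + 1)).comp hpres.measurable
      rw [← hpres.lintegral_comp (hZm (t + 1)), lintegral_prod _ hm.aemeasurable]
      refine lintegral_mono fun e => ?_
      simp only [hpw]
      have hm2 : Measurable fun y => Z (t + 1) (Function.update e i y) :=
        (hZm (t + 1)).comp (measurable_update e)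
      have h1 : ∫⁻ e' : Fin T → ℝ, Z (t + 1) (Function.update e i (e' i)) ∂Measure.pi ν =
          ∫⁻ y, Z (t + 1) (Function.update e i y) ∂ν i :=
        (measurePreserving_eval ν i).lintegral_comp hm2
      rw [h1]
      simp only [hZ, hi, hZdep t t ht e _ le_rfl]
      by_cases h : c ≤ Z t e
      · simp [h]
      · simp only [h, if_false]
        rw [hZW t e h]
        exact hstep t ht e
  have hZmono : ∀ (e : Fin T → ℝ) {s t : ℕ}, s ≤ t → c ≤ Z s e → c ≤ Z t e := by
    intro e s t hst
    induction hst with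
    | refl => exact id
    | step _ ih =>
      intro h
      rw [Nat.succ_eq_add_one, hZ, if_pos (ih h)]
      exact ih h
  have hWZ : ∀ (e : Fin T → ℝ) (t : ℕ), c ≤ W t e → c ≤ Z t e := by
    intro e t h
    by_contra hcon
    rw [hZW t e hcon] at hcon
    exact hcon h
  calc Measure.pi ν {e | ∃ t ≤ T, c ≤ W t e} ≤ Measure.pi ν {e | c ≤ Z T e} :=
        measure_mono fun e ⟨t, ht, h⟩ => hZmono e ht (hWZ e t h)
    _ ≤ (∫⁻ e, Z T e ∂Measure.pi ν) / c := meas_ge_le_lintegral_div (hZm T).aemeasurable hc0 hct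
    _ ≤ 1 / c := ENNReal.div_le_div_right (hint T le_rfl) _
    _ = c⁻¹ := one_div c

end PrivateGPBandit

end

noncomputable section
namespace PrivateGPBandit
set_option linter.unusedSectionVars false
open Matrix
open scoped ENNReal

/-! ### The self-normalized bound -/

theorem lintegral_exp_mul_le {ν : Measure ℝ} {ρ : ℝ}
    (h : HasSubgaussianMGF id (Real.toNNReal (ρ ^ 2)) ν) (b : ℝ) :
    ∫⁻ y, ENNReal.ofReal (Real.exp (b * y)) ∂ν ≤ ENNReal.ofReal (Real.exp (ρ ^ 2 * b ^ 2 / 2)) := by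
  have h1 := h.integrable_exp_mul b
  have h2 := h.mgf_le b
  rw [Real.coe_toNNReal _ (sq_nonneg _)] at h2
  simp only [id] at h1
  rw [← ofReal_integral_eq_lintegral_ofReal h1 (Filter.Eventually.of_forall fun _ =>
    (Real.exp_pos _).le)]
  exact ENNReal.ofReal_le_ofReal h2

/-- The square of `y` in the exponent is linearized by an auxiliary Gaussian variable `g`. For fixed
`g` the sub-Gaussian bound applies, and the integral over `g` is explicit. The bound is attained by
Gaussian noise, and `√(1+w)` is exactly the growth of the root of the determinant in one round. -/
theorem lintegral_exp_quadratic_le {ν : Measure ℝ} [IsProbabilityMeasure ν] {ρ : ℝ} (hρ : 0 < ρ)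
    (h : HasSubgaussianMGF id (Real.toNNReal (ρ ^ 2)) ν) {w : ℝ} (hw : 0 ≤ w) (s : ℝ) :
    ∫⁻ y, ENNReal.ofReal (Real.exp ((2 * y * s + y ^ 2 * w - s ^ 2) / (1 + w) / (2 * ρ ^ 2))) ∂ν ≤
      ENNReal.ofReal (√(1 + w)) := by
  have hw1 : 0 < 1 + w := by linarith
  set θ := w / (1 + w) with hθ
  have hθ0 : 0 ≤ θ := by positivity
  have hθ1 : 1 - θ = (1 + w)⁻¹ := by rw [hθ]; field_simp; ring
  have hθlt : θ < 1 := by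
    have : 0 < (1 + w)⁻¹ := by positivity
    linarith
  have hsθ : √θ ^ 2 = θ := Real.sq_sqrt hθ0
  set b := s / (ρ ^ 2 * (1 + w)) with hb
  set K := Real.exp (-(s ^ 2 / (2 * ρ ^ 2 * (1 + w)))) with hK
  have hK0 : 0 < K := Real.exp_pos _
  calc ∫⁻ y, ENNReal.ofReal (Real.exp ((2 * y * s + y ^ 2 * w - s ^ 2) / (1 + w) / (2 * ρ ^ 2))) ∂ν
      = ∫⁻ y, ENNReal.ofReal K * ∫⁻ g, ENNReal.ofReal (Real.exp ((√θ / ρ * g + b) * y))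
          ∂(gaussianReal 0 1) ∂ν := by
        refine lintegral_congr fun y => ?_
        have h1 := lintegral_exp_quadratic_gaussianReal (θ := 0) zero_lt_one (√θ / ρ * y)
        have h2 : ∀ g : ℝ, ENNReal.ofReal (Real.exp ((√θ / ρ * g + b) * y)) =
            ENNReal.ofReal (Real.exp (b * y)) *
              ENNReal.ofReal (Real.exp (0 * g ^ 2 / 2 + √θ / ρ * y * g)) := by
          intro g
          rw [← ENNReal.ofReal_mul (Real.exp_pos _).le, ← Real.exp_add]
          congr 2
          ring
        simp only [h2]
        rw [lintegral_const_mul _ (by fun_prop), h1, ← ENNReal.ofReal_mul (Real.exp_pos _).le,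
          ← ENNReal.ofReal_mul hK0.le]
        congr 1
        rw [hK, sub_zero, Real.sqrt_one, inv_one, one_mul, ← Real.exp_add, ← Real.exp_add, mul_pow,
          div_pow, hsθ, hθ, hb]
        congr 1
        field_simp
        ring
    _ = ENNReal.ofReal K * ∫⁻ g, ∫⁻ y, ENNReal.ofReal (Real.exp ((√θ / ρ * g + b) * y)) ∂ν
          ∂(gaussianReal 0 1) := by
        have hm : Measurable fun p : ℝ × ℝ =>
            ENNReal.ofReal (Real.exp ((√θ / ρ * p.2 + b) * p.1)) := by fun_prop
        have hm' : Measurable fun y : ℝ => ∫⁻ g, ENNReal.ofReal (Real.exp ((√θ / ρ * g + b) * y))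
          ∂(gaussianReal 0 1) := hm.lintegral_prod_right'
        rw [lintegral_const_mul _ hm', lintegral_lintegral_swap hm.aemeasurable]
    _ ≤ ENNReal.ofReal K * ∫⁻ g, ENNReal.ofReal (Real.exp (ρ ^ 2 * (√θ / ρ * g + b) ^ 2 / 2))
          ∂(gaussianReal 0 1) := by
        gcongr with g
        exact lintegral_exp_mul_le h _
    _ = ENNReal.ofReal K * (ENNReal.ofReal (Real.exp (ρ ^ 2 * b ^ 2 / 2)) *
          ∫⁻ g, ENNReal.ofReal (Real.exp (θ * g ^ 2 / 2 + √θ * ρ * b * g)) ∂(gaussianReal 0 1)) := by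
        congr 1
        rw [← lintegral_const_mul _ (by fun_prop)]
        refine lintegral_congr fun g => ?_
        rw [← ENNReal.ofReal_mul (Real.exp_pos _).le, ← Real.exp_add]
        congr 2
        field_simp
        rw [add_sq, mul_pow, hsθ]
        ring
    _ = ENNReal.ofReal (√(1 + w)) := by
        rw [lintegral_exp_quadratic_gaussianReal hθlt, ← ENNReal.ofReal_mul (Real.exp_pos _).le,
          ← ENNReal.ofReal_mul hK0.le, hθ1, Real.sqrt_inv, inv_inv]
        congr 1
        rw [mul_left_comm (Real.exp (ρ ^ 2 * b ^ 2 / 2)), mul_left_comm K, hK, ← Real.exp_add, ← Real.exp_add]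
        rw [show (-(s ^ 2 / (2 * ρ ^ 2 * (1 + w))) + (ρ ^ 2 * b ^ 2 / 2 +
          (√θ * ρ * b) ^ 2 / (2 * (1 + w)⁻¹))) = 0 from ?_, Real.exp_zero, mul_one]
        rw [mul_pow, mul_pow, hsθ, hθ, hb]
        field_simp
        ring

section SelfNormalized

variable {ι : Type*} [Fintype ι] [DecidableEq ι] {T : ℕ}

/-- The regularized design matrix `c I + ∑_{i < t} φ_i φ_iᵀ`. -/
def design (c : ℝ) (φ : Fin T → ι → ℝ) (t : ℕ) : Matrix ι ι ℝ :=
  c • 1 + ∑ i : Fin T, if (i : ℕ) < t then vecMulVec (φ i) (φ i) else 0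

/-- The weighted sum `∑_{i < t} e_i φ_i`. -/
def weightedSum (φ : Fin T → ι → ℝ) (e : Fin T → ℝ) (t : ℕ) : ι → ℝ :=
  ∑ i : Fin T, if (i : ℕ) < t then e i • φ i else 0

theorem design_zero (c : ℝ) (φ : Fin T → ι → ℝ) : design c φ 0 = c • 1 := by
  simp [design]

theorem sum_ite_lt_succ {M : Type*} [AddCommMonoid M] {t : ℕ} (ht : t < T) (g : Fin T → M) :
    ∑ i : Fin T, (if (i : ℕ) < t + 1 then g i else 0) =
      (∑ i : Fin T, if (i : ℕ) < t then g i else 0) + g ⟨t, ht⟩ := by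
  have h : ∀ i : Fin T, (if (i : ℕ) < t + 1 then g i else 0) =
      (if (i : ℕ) < t then g i else 0) + if i = ⟨t, ht⟩ then g i else 0 := by
    intro i
    rcases lt_trichotomy (i : ℕ) t with h | h | h
    · have : i ≠ ⟨t, ht⟩ := fun hc => by rw [hc] at h; exact lt_irrefl _ h
      simp [h, this, h.trans (Nat.lt_succ_self t)]
    · have : i = ⟨t, ht⟩ := Fin.ext h
      simp [this]
    · have : i ≠ ⟨t, ht⟩ := fun hc => by rw [hc] at h; exact lt_irrefl _ h
      simp [this, not_lt.mpr h.le, not_lt.mpr (Nat.succ_le_of_lt h)]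
  simp only [h, Finset.sum_add_distrib, Finset.sum_ite_eq', Finset.mem_univ, if_true]

theorem design_succ (c : ℝ) (φ : Fin T → ι → ℝ) {t : ℕ} (ht : t < T) :
    design c φ (t + 1) = design c φ t + vecMulVec (φ ⟨t, ht⟩) (φ ⟨t, ht⟩) := by
  rw [design, design, sum_ite_lt_succ ht, add_assoc]

theorem weightedSum_succ (φ : Fin T → ι → ℝ) (e : Fin T → ℝ) {t : ℕ} (ht : t < T) :
    weightedSum φ e (t + 1) = weightedSum φ e t + e ⟨t, ht⟩ • φ ⟨t, ht⟩ := by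
  rw [weightedSum, weightedSum, sum_ite_lt_succ ht]

theorem posDef_design {c : ℝ} (hc : 0 < c) (φ : Fin T → ι → ℝ) (t : ℕ) : (design c φ t).PosDef := by
  refine (posDef_smul_one hc).add_posSemidef (posSemidef_sum _ fun i _ => ?_)
  split_ifs
  · exact posSemidef_vecMulVec _
  · exact PosSemidef.zero

/-- The process `√(det V_0 / det V_t) · exp(S_tᵀ V_t⁻¹ S_t / (2ρ²))` is a supermartingale: the
rank-one update formulas put its one-step ratio into the form of `lintegral_exp_quadratic_le`.
Ville's inequality is applied at level `1/δ`. Predictability enters as `hφ`: `φ_i` ignores the noise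
of round `i` and later. -/
theorem measure_selfNormalized_le {ν : Fin T → Measure ℝ} [∀ i, IsProbabilityMeasure (ν i)]
    {ρ : ℝ} (hρ : 0 < ρ) (hν : ∀ i, HasSubgaussianMGF id (Real.toNNReal (ρ ^ 2)) (ν i))
    {φ : (Fin T → ℝ) → Fin T → ι → ℝ} (hφm : ∀ i, Measurable fun e => φ e i)
    (hφ : ∀ (i s : Fin T) (e : Fin T → ℝ) (y : ℝ), i ≤ s → φ (Function.update e s y) i = φ e i)
    {c : ℝ} (hc : 0 < c) {δ : ℝ} (hδ : 0 < δ) :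
    Measure.pi ν {e | ∃ t ≤ T, ρ ^ 2 * (Real.log ((design c (φ e) t).det / (design c (φ e) 0).det) +
        2 * Real.log (1 / δ)) < quad (design c (φ e) t)⁻¹ (weightedSum (φ e) e t)} ≤
      ENNReal.ofReal δ := by
  set W : ℕ → (Fin T → ℝ) → ℝ := fun t e =>
    √((design c (φ e) 0).det / (design c (φ e) t).det) *
      Real.exp (quad (design c (φ e) t)⁻¹ (weightedSum (φ e) e t) / (2 * ρ ^ 2)) with hW
  have hpos : ∀ e t, 0 < (design c (φ e) t).det := fun e t => (posDef_design hc _ t).det_pos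
  have hφdep : ∀ (t s : ℕ) (hs : s < T) (e : Fin T → ℝ) (y : ℝ), t ≤ s →
      design c (φ (Function.update e ⟨s, hs⟩ y)) t = design c (φ e) t ∧
      weightedSum (φ (Function.update e ⟨s, hs⟩ y)) (Function.update e ⟨s, hs⟩ y) t =
        weightedSum (φ e) e t := by
    intro t s hs e y hts
    constructor
    · unfold design
      congr 1
      refine Finset.sum_congr rfl fun i _ => ?_
      split_ifs with hi
      · rw [hφ i ⟨s, hs⟩ e y (hi.le.trans hts)]
      · rfl
    · unfold weightedSum
      refine Finset.sum_congr rfl fun i _ => ?_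
      split_ifs with hi
      · have : i ≠ ⟨s, hs⟩ := fun hcon => by rw [hcon] at hi; exact absurd hi (not_lt.mpr hts)
        rw [hφ i ⟨s, hs⟩ e y (hi.le.trans hts), Function.update_of_ne this]
      · rfl
  have hdm : ∀ t i j, Measurable fun e => design c (φ e) t i j := by
    intro t i j
    simp only [design, Matrix.add_apply, Matrix.sum_apply]
    refine measurable_const.add (Finset.measurable_sum _ fun l _ => ?_)
    split_ifs
    · simp only [vecMulVec_apply]
      exact ((measurable_pi_apply i).comp (hφm l)).mul ((measurable_pi_apply j).comp (hφm l))
    · exact measurable_const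
  have hsm : ∀ t, Measurable fun e => weightedSum (φ e) e t := by
    intro t
    refine Finset.measurable_sum _ fun l _ => ?_
    split_ifs
    · exact (measurable_pi_apply l).smul (hφm l)
    · exact measurable_const
  have hWm : ∀ t, Measurable (W t) := fun t =>
    ((measurable_det (hdm 0)).div (measurable_det (hdm t))).sqrt.mul
      (((measurable_quad_inv (hdm t) (hsm t)).div_const _).exp)
  have hstep : ∀ (t : ℕ) (ht : t < T) (e : Fin T → ℝ),
      ∫⁻ y, ENNReal.ofReal (W (t + 1) (Function.update e ⟨t, ht⟩ y)) ∂(ν ⟨t, ht⟩) ≤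
        ENNReal.ofReal (W t e) := by
    intro t ht e
    set V := design c (φ e) t with hV
    have hVp : V.PosDef := posDef_design hc _ t
    set u := φ e ⟨t, ht⟩ with hu
    set w := quad V⁻¹ u with hw
    have hw0 : 0 ≤ w := quad_nonneg hVp.inv.posSemidef u
    set s := u ⬝ᵥ V⁻¹ *ᵥ weightedSum (φ e) e t with hs
    have hval : ∀ y, W (t + 1) (Function.update e ⟨t, ht⟩ y) = W t e * (√(1 + w))⁻¹ *
        Real.exp ((2 * y * s + y ^ 2 * w - s ^ 2) / (1 + w) / (2 * ρ ^ 2)) := by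
      intro y
      have h1 := hφdep t t ht e y le_rfl
      have h0 := hφdep 0 t ht e y (Nat.zero_le _)
      simp only [hW]
      rw [design_succ _ _ ht, weightedSum_succ _ _ ht, h1.1, h1.2, h0.1,
        hφ ⟨t, ht⟩ ⟨t, ht⟩ e y le_rfl, Function.update_self, ← hV, ← hu,
        det_add_vecMulVec hVp, quad_inv_add_vecMulVec hVp, ← hw, ← hs, ← div_div,
        Real.sqrt_div' _ (by linarith : 0 ≤ 1 + w), add_div, Real.exp_add]
      ring
    have hW0 : 0 ≤ W t e := by simp only [hW]; positivity
    simp only [hval]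
    simp only [ENNReal.ofReal_mul (mul_nonneg hW0 (inv_nonneg.mpr (Real.sqrt_nonneg _)))]
    rw [lintegral_const_mul _ (by fun_prop)]
    refine (mul_le_mul_right (lintegral_exp_quadratic_le hρ (hν _) hw0 s) _).trans (le_of_eq ?_)
    have : √(1 + w) ≠ 0 := (Real.sqrt_pos.mpr (by linarith)).ne'
    rw [← ENNReal.ofReal_mul (mul_nonneg hW0 (inv_nonneg.mpr (Real.sqrt_nonneg _))), mul_assoc,
      inv_mul_cancel₀ this, mul_one]
  have hville := measure_exists_ge_le (ν := ν) (W := fun t e => ENNReal.ofReal (W t e))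
    (fun t => ENNReal.measurable_ofReal.comp (hWm t)) ?_ ?_ hstep
    (c := ENNReal.ofReal (1 / δ)) (by simpa using hδ) ENNReal.ofReal_ne_top
  · refine le_trans (measure_mono fun e he => ?_) (hville.trans (le_of_eq ?_))
    · obtain ⟨t, ht, h⟩ := he
      refine ⟨t, ht, ENNReal.ofReal_le_ofReal ?_⟩
      have hD : 0 < (design c (φ e) t).det / (design c (φ e) 0).det := div_pos (hpos e t) (hpos e 0)
      have h2 : Real.log (1 / δ) ≤ Real.log (W t e) := by
        simp only [hW]
        rw [Real.log_mul (Real.sqrt_pos.mpr (div_pos (hpos e 0) (hpos e t))).ne'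
          (Real.exp_pos _).ne', Real.log_exp, Real.log_sqrt (div_pos (hpos e 0) (hpos e t)).le,
          ← inv_div (design c (φ e) t).det, Real.log_inv]
        have : (Real.log ((design c (φ e) t).det / (design c (φ e) 0).det) + 2 * Real.log (1 / δ)) / 2 ≤
            quad (design c (φ e) t)⁻¹ (weightedSum (φ e) e t) / (2 * ρ ^ 2) := by
          rw [div_le_div_iff₀ (by norm_num) (by positivity)]
          nlinarith
        linarith
      exact (Real.log_le_log_iff (by positivity)
        (mul_pos (Real.sqrt_pos.mpr (div_pos (hpos e 0) (hpos e t))) (Real.exp_pos _))).mp h2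
    · rw [← ENNReal.ofReal_inv_of_pos (by positivity)]
      simp
  · intro e
    have : weightedSum (φ e) e 0 = 0 := by simp [weightedSum]
    simp only [hW, this, div_self (hpos e 0).ne']
    simp [quad]
  · intro t s hs e y hts
    have h1 := hφdep t s hs e y hts
    have h0 := hφdep 0 s hs e y (Nat.zero_le _)
    simp only [hW, h1.1, h1.2, h0.1]

end SelfNormalized

end PrivateGPBandit

end

noncomputable section
namespace PrivateGPBandit
set_option linter.unusedSectionVars false
open Matrix
open scoped ENNReal

/-! ### Concentration of the tree noise -/

namespace Params

variable {d : ℕ} (P : Params d)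

/-- The tree noise dual to the linear functional `u` of the noise of the prefix sum `t`. -/
def noiseDual (t : ℕ) (u : P.Idx ⊕ Unit → P.Idx ⊕ Unit → ℝ) : P.TreeNoise := fun q i j =>
  if P.Selected t q then (u i j + u j i) / √2 else 0

theorem sum_mul_noiseSum (N : P.TreeNoise) (t : ℕ) (u : P.Idx ⊕ Unit → P.Idx ⊕ Unit → ℝ) :
    ∑ i, ∑ j, u i j * P.noiseSum N t i j = P.treeInner (P.noiseDual t u) N := by
  have h1 : ∀ i j, u i j * P.noiseSum N t i j =
      ∑ q : P.Node, if P.Selected t q then u i j / √2 * (N q j i + N q i j) else 0 := by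
    intro i j
    rw [noiseSum, Matrix.sum_apply, Finset.mul_sum]
    refine Finset.sum_congr rfl fun q _ => ?_
    split_ifs
    · simp only [Matrix.smul_apply, Matrix.add_apply, Matrix.transpose_apply, Matrix.of_apply,
        smul_eq_mul]
      ring
    · simp
  simp only [h1]
  have h2 : ∑ i, ∑ j, ∑ q : P.Node,
        (if P.Selected t q then u i j / √2 * (N q j i + N q i j) else 0) =
      ∑ q : P.Node, ∑ i, ∑ j,
        (if P.Selected t q then u i j / √2 * (N q j i + N q i j) else 0) := by
    rw [Finset.sum_comm]
    refine (Finset.sum_congr rfl fun j _ => Finset.sum_comm).trans ?_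
    rw [Finset.sum_comm]
    exact Finset.sum_congr rfl fun q _ => Finset.sum_comm
  rw [h2, treeInner]
  refine Finset.sum_congr rfl fun q _ => ?_
  simp only [noiseDual]
  split_ifs
  · have h3 : ∑ i, ∑ j, u i j / √2 * N q j i = ∑ i, ∑ j, u j i / √2 * N q i j := Finset.sum_comm
    simp only [mul_add, Finset.sum_add_distrib, h3, add_div, add_mul]
    rw [add_comm]
  · simp

theorem treeInner_noiseDual_le (t : ℕ) (u : P.Idx ⊕ Unit → P.Idx ⊕ Unit → ℝ) :
    P.treeInner (P.noiseDual t u) (P.noiseDual t u) ≤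
      P.depth * ∑ i, ∑ j, (u i j + u j i) ^ 2 / 2 := by
  have e4 : (√2 : ℝ) * √2 = 2 := Real.mul_self_sqrt zero_le_two
  have e5 : ∀ a : ℝ, a / √2 * (a / √2) = a ^ 2 / 2 := fun a => by
    rw [div_mul_div_comm, e4, sq]
  have h1 : P.treeInner (P.noiseDual t u) (P.noiseDual t u) =
      ∑ q : P.Node, if P.Selected t q then ∑ i, ∑ j, (u i j + u j i) ^ 2 / 2 else 0 := by
    refine Finset.sum_congr rfl fun q _ => ?_
    simp only [noiseDual]
    split_ifs
    · simp only [e5]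
    · simp
  rw [h1, ← Finset.sum_filter, Finset.sum_const, nsmul_eq_mul]
  refine mul_le_mul_of_nonneg_right (by exact_mod_cast P.card_selected_le t)
    (Finset.sum_nonneg fun i _ => Finset.sum_nonneg fun j _ => by positivity)

theorem lintegral_exp_noiseSum_le (hσ : 0 < P.σ) (t : ℕ)
    (u : P.Idx ⊕ Unit → P.Idx ⊕ Unit → ℝ) :
    ∫⁻ N, ENNReal.ofReal (Real.exp (∑ i, ∑ j, u i j * P.noiseSum N t i j)) ∂P.treeMeasure ≤
      ENNReal.ofReal (Real.exp (P.σ ^ 2 * (P.depth * ∑ i, ∑ j, (u i j + u j i) ^ 2 / 2) / 2)) := by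
  simp only [sum_mul_noiseSum]
  rw [(P.hasGaussianShift_treeMeasure hσ).lintegral_exp (by positivity) P.treeInner_smul_left
    P.treeInner_smul_right]
  refine ENNReal.ofReal_le_ofReal (Real.exp_le_exp.mpr ?_)
  have := P.treeInner_noiseDual_le t u
  gcongr

theorem measurable_noiseSum (t : ℕ) (i j : P.Idx ⊕ Unit) :
    Measurable fun N : P.TreeNoise => P.noiseSum N t i j := by
  simp only [noiseSum, Matrix.sum_apply]
  refine Finset.measurable_sum _ fun q _ => ?_
  split_ifs
  · simp only [Matrix.smul_apply, Matrix.add_apply, Matrix.transpose_apply, Matrix.of_apply,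
      smul_eq_mul]
    fun_prop
  · exact measurable_const

theorem noiseSum_isSymm (N : P.TreeNoise) (t : ℕ) : (P.noiseSum N t)ᵀ = P.noiseSum N t := by
  rw [noiseSum, Matrix.transpose_sum]
  refine Finset.sum_congr rfl fun q _ => ?_
  split_ifs
  · rw [Matrix.transpose_smul, Matrix.transpose_add, Matrix.transpose_transpose, add_comm]
  · simp

/-- The noise of the matrix released before round `t`. -/
def noiseMat (N : P.TreeNoise) (t : ℕ) : Matrix P.Idx P.Idx ℝ := (P.noiseSum N t).toBlocks₁₁

/-- The noise of the vector released before round `t`. -/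
def noiseVec (N : P.TreeNoise) (t : ℕ) : P.Idx → ℝ :=
  fun i => P.noiseSum N t (Sum.inl i) (Sum.inr ())

theorem isHermitian_noiseMat (N : P.TreeNoise) (t : ℕ) : (P.noiseMat N t).IsHermitian := by
  ext i j
  exact congrFun (congrFun (P.noiseSum_isSymm N t) (Sum.inl i)) (Sum.inl j)

theorem quad_noiseMat (N : P.TreeNoise) (t : ℕ) (v : P.Idx → ℝ) :
    quad (P.noiseMat N t) v = ∑ i, ∑ j,
      (Sum.elim v 0 i * Sum.elim v 0 j : ℝ) * P.noiseSum N t i j := by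
  simp only [Fintype.sum_sum_type, Sum.elim_inl, Sum.elim_inr, Pi.zero_apply, mul_zero, zero_mul,
    Finset.sum_const_zero, add_zero, quad, dotProduct, mulVec, Finset.mul_sum]
  refine Finset.sum_congr rfl fun i _ => Finset.sum_congr rfl fun j _ => ?_
  rw [noiseMat, Matrix.toBlocks₁₁, Matrix.of_apply]
  ring

theorem lintegral_exp_quad_noiseMat_le (hσ : 0 < P.σ) (t : ℕ) (c : ℝ) (v : P.Idx → ℝ) :
    ∫⁻ N, ENNReal.ofReal (Real.exp (c * quad (P.noiseMat N t) v)) ∂P.treeMeasure ≤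
      ENNReal.ofReal (Real.exp (c ^ 2 * (P.σ * √P.depth) ^ 2 * (v ⬝ᵥ v) ^ 2)) := by
  have h := P.lintegral_exp_noiseSum_le hσ t
    fun i j => c * (Sum.elim v 0 i * Sum.elim v 0 j : ℝ)
  have h1 : ∀ N, c * quad (P.noiseMat N t) v = ∑ i, ∑ j,
      c * (Sum.elim v 0 i * Sum.elim v 0 j : ℝ) * P.noiseSum N t i j := by
    intro N
    rw [quad_noiseMat]
    simp only [Finset.mul_sum, mul_assoc]
  simp only [h1]
  refine h.trans (le_of_eq ?_)
  congr 2
  have h2 : ∑ i : P.Idx ⊕ Unit, ∑ j : P.Idx ⊕ Unit,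
      (c * (Sum.elim v 0 i * Sum.elim v 0 j : ℝ) + c * (Sum.elim v 0 j * Sum.elim v 0 i)) ^ 2 / 2 =
      2 * c ^ 2 * (v ⬝ᵥ v) ^ 2 := by
    simp only [Fintype.sum_sum_type, Sum.elim_inl, Sum.elim_inr, Pi.zero_apply, mul_zero, zero_mul,
      add_zero, Finset.univ_unique, Finset.sum_singleton]
    rw [sq (v ⬝ᵥ v), dotProduct, Finset.sum_mul_sum]
    simp only [Finset.mul_sum]
    norm_num
    refine Finset.sum_congr rfl fun i _ => Finset.sum_congr rfl fun j _ => ?_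
    ring
  rw [h2, mul_pow, Real.sq_sqrt (Nat.cast_nonneg _)]
  ring

theorem lintegral_exp_dotProduct_noiseVec_le (hσ : 0 < P.σ) (t : ℕ) (w : P.Idx → ℝ) :
    ∫⁻ N, ENNReal.ofReal (Real.exp (w ⬝ᵥ P.noiseVec N t)) ∂P.treeMeasure ≤
      ENNReal.ofReal (Real.exp ((P.σ * √P.depth) ^ 2 * (w ⬝ᵥ w) / 2)) := by
  set u : P.Idx ⊕ Unit → P.Idx ⊕ Unit → ℝ := fun i j =>
    Sum.elim w 0 i * Sum.elim (0 : P.Idx → ℝ) 1 j with hu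
  have h := P.lintegral_exp_noiseSum_le hσ t u
  have h1 : ∀ N, w ⬝ᵥ P.noiseVec N t = ∑ i, ∑ j, u i j * P.noiseSum N t i j := by
    intro N
    simp [hu, Fintype.sum_sum_type, dotProduct, noiseVec]
  simp only [h1]
  refine h.trans (le_of_eq ?_)
  congr 2
  have h2 : ∑ i, ∑ j, (u i j + u j i) ^ 2 / 2 = w ⬝ᵥ w := by
    simp only [hu, Fintype.sum_sum_type, Sum.elim_inl, Sum.elim_inr, Pi.zero_apply, Pi.one_apply,
      mul_zero, zero_mul, mul_one, add_zero, zero_add, Finset.univ_unique, Finset.sum_singleton]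
    norm_num
    rw [← Finset.sum_add_distrib, dotProduct]
    exact Finset.sum_congr rfl fun i _ => by ring
  rw [h2, mul_pow, Real.sq_sqrt (Nat.cast_nonneg _)]
  ring

theorem noiseVec_zero (N : P.TreeNoise) : P.noiseVec N 0 = 0 := by
  ext i
  simp [noiseVec, noiseSum, Selected]

/-- The tree noise is within its nominal bounds in all rounds. -/
def GoodTree (N : P.TreeNoise) : Prop := ∀ t < P.T,
  (∀ v, |quad (P.noiseMat N t) v| ≤ P.Lam * (v ⬝ᵥ v)) ∧
    P.noiseVec N t ⬝ᵥ P.noiseVec N t ≤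
      (P.σ * √P.depth * (√P.m + √(2 * Real.log (2 * P.T / P.ζ)))) ^ 2

/-- Turns the volume ratio `11^m` of the matrix bound into `exp(12m/5)`. -/
theorem exp_twelve_fifths_ge : (11 : ℝ) ≤ Real.exp (12 / 5) := by
  have h1 := Real.exp_one_gt_d9
  have h2 : (1.49 : ℝ) ≤ Real.exp (2 / 5) := by
    have := Real.sum_le_exp_of_nonneg (x := 2 / 5) (by norm_num) 4
    simp [Finset.sum_range_succ, Nat.factorial] at this
    norm_num at this ⊢
    linarith
  have h3 : Real.exp (12 / 5) = Real.exp 1 * Real.exp 1 * Real.exp (2 / 5) := by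
    rw [← Real.exp_add, ← Real.exp_add]; norm_num
  rw [h3]
  nlinarith

theorem two_mul_order_le_m (hd : 0 < d) : 2 * P.order ≤ P.m := by
  rw [m]
  exact Nat.mul_le_mul_left 2 (Nat.le_self_pow hd.ne' _)

/-- The number of features grows at least like `log T`, so a spare `exp(-m)` pays for a union over
rounds. -/
theorem exp_neg_m_le (hd : 0 < d) (hT : 2 ≤ P.T) : Real.exp (-P.m) ≤ 1 / (2 * P.T) := by
  have hT' : (2 : ℝ) ≤ P.T := by exact_mod_cast hT
  have h1 : 2 * Real.log P.T ≤ P.m := by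
    have h2 : (2 * P.order : ℝ) ≤ P.m := by exact_mod_cast P.two_mul_order_le_m hd
    have h3 := P.log_le_order
    have h4 : 0 ≤ Real.log P.T := Real.log_nonneg (by linarith)
    linarith
  calc Real.exp (-P.m) ≤ Real.exp (-(2 * Real.log P.T)) := Real.exp_le_exp.mpr (by linarith)
    _ = 1 / ((P.T : ℝ) * P.T) := by
      rw [Real.exp_neg, two_mul, Real.exp_add, Real.exp_log (by linarith), one_div]
    _ ≤ 1 / (2 * P.T) := by gcongr

/-- Each matrix event costs `ζ/(2T²)`, hence `ζ/(2T)` over all rounds. Each vector event costs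
`ζ/(2T)`, but only in `T - 1` rounds because there is no noise before the first datum. The total is
exactly `ζ/2`. -/
theorem measure_not_goodTree_le (hd : 0 < d) (hT : 2 ≤ P.T) (hσ : 0 < P.σ) (hζ : 0 < P.ζ)
    (hζ1 : P.ζ < 1) : P.treeMeasure {N | ¬ P.GoodTree N} ≤ ENNReal.ofReal (P.ζ / 2) := by
  have hT' : (2 : ℝ) ≤ P.T := by exact_mod_cast hT
  have hT0 : (0 : ℝ) < P.T := by linarith
  set x := Real.log (2 * P.T / P.ζ) with hx
  have hx0 : 0 ≤ x := Real.log_nonneg (by rw [le_div_iff₀ hζ]; linarith)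
  have hexp : Real.exp (-x) = P.ζ / (2 * P.T) := by
    rw [hx, Real.exp_neg, Real.exp_log (by positivity), inv_div]
  have hdep : (0 : ℝ) < P.depth := by rw [depth]; positivity
  set s := P.σ * √P.depth with hs
  have hs0 : 0 < s := by positivity
  have hm0 : 0 < P.m := by
    have := P.two_mul_order_le_m hd
    have := P.order_pos hT
    omega
  have hne : Nonempty P.Idx := by
    rw [← Fintype.card_pos_iff, card_idx]; exact hm0
  have hLam : P.Lam = 2 * √2 * s * (2 * √P.m + √(2 * x)) := by
    rw [Lam, hs, ← hx, Real.sqrt_mul zero_le_two]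
    ring
  have hLam2 : s ^ 2 * (32 * P.m + 16 * x) ≤ P.Lam ^ 2 := by
    have h2 : √2 ^ 2 = (2 : ℝ) := Real.sq_sqrt zero_le_two
    have h3 : √P.m ^ 2 = (P.m : ℝ) := Real.sq_sqrt (Nat.cast_nonneg _)
    have h4 : √(2 * x) ^ 2 = 2 * x := Real.sq_sqrt (by positivity)
    have h5 : P.Lam ^ 2 = s ^ 2 * (4 * √2 ^ 2 * (4 * √P.m ^ 2 + √(2 * x) ^ 2)) +
        s ^ 2 * (16 * √2 ^ 2) * (√P.m * √(2 * x)) := by rw [hLam]; ring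
    have h6 : 0 ≤ s ^ 2 * (16 * √2 ^ 2) * (√P.m * √(2 * x)) := by positivity
    rw [h2, h3, h4] at h5
    nlinarith
  have hLam0 : 0 ≤ P.Lam := by rw [hLam]; positivity
  have hE1 : ∀ t, P.treeMeasure {N | ∃ v, P.Lam * (v ⬝ᵥ v) < |quad (P.noiseMat N t) v|} ≤
      ENNReal.ofReal (P.ζ / (2 * P.T ^ 2)) := by
    intro t
    -- `c` minimizes the quadratic exponent `c² s² (11/10)⁴ - (79/100) c Λ`.
    have h := measure_exists_quad_gt_le (μ := P.treeMeasure) (M := fun N => P.noiseMat N t)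
      (fun i j => P.measurable_noiseSum t _ _) (fun N => P.isHermitian_noiseMat N t)
      (fun c v => P.lintegral_exp_quad_noiseMat_le hσ t c v)
      (c := 79 / 100 * P.Lam / (2 * s ^ 2 * (11 / 10) ^ 4)) (L := P.Lam) (by positivity)
    refine h.trans (ENNReal.ofReal_le_ofReal ?_)
    rw [card_idx, ← hs]
    have h1 : (79 / 100 * P.Lam / (2 * s ^ 2 * (11 / 10) ^ 4)) ^ 2 * s ^ 2 * (11 / 10) ^ 4 -
        79 / 100 * P.Lam / (2 * s ^ 2 * (11 / 10) ^ 4) * (79 / 100 * P.Lam) =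
        -((79 / 100) ^ 2 / (4 * (11 / 10) ^ 4)) * (P.Lam ^ 2 / s ^ 2) := by
      field_simp
      ring
    have h2 : 32 * P.m + 16 * x ≤ P.Lam ^ 2 / s ^ 2 := by
      rw [le_div_iff₀ (by positivity)]; linarith
    have h3 : -((79 / 100) ^ 2 / (4 * (11 / 10) ^ 4)) * (P.Lam ^ 2 / s ^ 2) ≤
        -(17 / 5 * P.m) + -x := by
      -- `0.10625 · 32 = 17/5` and `0.10625 · 16 ≥ 1`. Of the `17/5`, `12/5` cancels `11^m` and `1`
      -- is left as `exp(-m)`.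
      have h4 : (0.10625 : ℝ) ≤ (79 / 100) ^ 2 / (4 * (11 / 10) ^ 4) := by norm_num
      have h5 : (0 : ℝ) ≤ P.m := Nat.cast_nonneg _
      nlinarith
    rw [h1]
    calc 2 * 11 ^ P.m * Real.exp (-((79 / 100) ^ 2 / (4 * (11 / 10) ^ 4)) * (P.Lam ^ 2 / s ^ 2))
        ≤ 2 * Real.exp (12 / 5) ^ P.m * Real.exp (-(17 / 5 * P.m) + -x) := by
          have := exp_twelve_fifths_ge
          gcongr
      _ = 2 * Real.exp (-P.m) * Real.exp (-x) := by
          rw [← Real.exp_nat_mul, Real.exp_add, ← mul_assoc, mul_assoc 2, ← Real.exp_add]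
          congr 3
          ring_nf
      _ ≤ 2 * (1 / (2 * P.T)) * (P.ζ / (2 * P.T)) := by
          rw [hexp]
          have := P.exp_neg_m_le hd hT
          gcongr
      _ = P.ζ / (2 * P.T ^ 2) := by field_simp
  have hE2 : ∀ t, P.treeMeasure {N | (s * (√P.m + √(2 * x))) ^ 2 <
      P.noiseVec N t ⬝ᵥ P.noiseVec N t} ≤ ENNReal.ofReal (P.ζ / (2 * P.T)) := by
    intro t
    have h := measure_dotProduct_self_gt_le (μ := P.treeMeasure) (η := fun N => P.noiseVec N t)
      (measurable_pi_lambda _ fun i => P.measurable_noiseSum t _ _) hs0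
      (P.lintegral_exp_dotProduct_noiseVec_le hσ t) hx0
    rw [card_idx, hexp] at h
    exact h
  have hsub : {N | ¬ P.GoodTree N} ⊆
      (⋃ t ∈ Finset.range P.T, {N | ∃ v, P.Lam * (v ⬝ᵥ v) < |quad (P.noiseMat N t) v|}) ∪
      ⋃ t ∈ Finset.Ico 1 P.T, {N | (s * (√P.m + √(2 * x))) ^ 2 <
        P.noiseVec N t ⬝ᵥ P.noiseVec N t} := by
    intro N hN
    by_contra hcon
    rw [Set.mem_union, not_or] at hcon
    simp only [Set.mem_iUnion, not_exists] at hcon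
    refine hN fun t ht => ⟨fun v => ?_, ?_⟩
    · by_contra hv
      exact hcon.1 t (Finset.mem_range.mpr ht) ⟨v, not_le.mp hv⟩
    · rcases Nat.eq_zero_or_pos t with rfl | h0
      · rw [noiseVec_zero, zero_dotProduct]; positivity
      · exact not_lt.mp fun hv => hcon.2 t (Finset.mem_Ico.mpr ⟨h0, ht⟩) hv
  refine (measure_mono hsub).trans ((measure_union_le _ _).trans ?_)
  refine (add_le_add (measure_biUnion_finset_le _ _) (measure_biUnion_finset_le _ _)).trans ?_
  refine (add_le_add (Finset.sum_le_sum fun t _ => hE1 t)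
    (Finset.sum_le_sum fun t _ => hE2 t)).trans ?_
  rw [Finset.sum_const, Finset.sum_const, nsmul_eq_mul, nsmul_eq_mul, Finset.card_range,
    Nat.card_Ico, ← ENNReal.ofReal_natCast, ← ENNReal.ofReal_natCast,
    ← ENNReal.ofReal_mul (Nat.cast_nonneg _), ← ENNReal.ofReal_mul (Nat.cast_nonneg _),
    ← ENNReal.ofReal_add (by positivity) (by positivity), Nat.cast_sub (by omega), Nat.cast_one]
  refine ENNReal.ofReal_le_ofReal (le_of_eq ?_)
  field_simp
  ring

end Params
end PrivateGPBandit

end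

noncomputable section
namespace PrivateGPBandit
set_option linter.unusedSectionVars false
open Matrix
open scoped ENNReal

/-! ### The good event of a run -/

namespace Params

variable {d : ℕ} (P : Params d)

theorem actionAt_update (R : P.ArgmaxRule) (S : Fin P.T → User d) (N : P.TreeNoise)
    (e : Fin P.T → ℝ) (s : Fin P.T) (y : ℝ) (i : Fin P.T) (hi : i ≤ s) :
    P.actionAt R S N (Function.update e s y) i = P.actionAt R S N e i := by
  obtain ⟨n, hn⟩ := i
  induction n using Nat.strong_induction_on with
  | _ n ih =>
    have hh : P.history R S N (Function.update e s y) n hn.le = P.history R S N e n hn.le := by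
      funext j
      have hj : Fin.castLE hn.le j < s := lt_of_lt_of_le (show (j : ℕ) < n from j.2) hi
      rw [P.history_apply, P.history_apply, Function.update_of_ne hj.ne]
      have := ih j j.2 (j.2.trans hn) hj.le
      rw [show Fin.castLE hn.le j = ⟨j, j.2.trans hn⟩ from rfl, this]
    rw [actionAt, actionAt]
    change P.action R N (P.history R S N (Function.update e s y) n hn.le) _ =
      P.action R N (P.history R S N e n hn.le) _
    rw [hh]

/-- The features of the actions of a run. -/
def runFeat (R : P.ArgmaxRule) (S : Fin P.T → User d) (N : P.TreeNoise) (e : Fin P.T → ℝ)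
    (i : Fin P.T) : P.Idx → ℝ := P.feat (P.actionAt R S N e i)

/-- The regularized design matrix of a run. -/
def runDesign (R : P.ArgmaxRule) (S : Fin P.T → User d) (N : P.TreeNoise) (e : Fin P.T → ℝ)
    (t : ℕ) : Matrix P.Idx P.Idx ℝ := design (P.reg + P.Lam) (P.runFeat R S N e) t

/-- The tree noise is within its bounds, and so is the accumulated reward noise. -/
def GoodRun (R : P.ArgmaxRule) (S : Fin P.T → User d) (N : P.TreeNoise) (e : Fin P.T → ℝ) : Prop :=
  P.GoodTree N ∧ ∀ t ≤ P.T,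
    quad (P.runDesign R S N e t)⁻¹ (weightedSum (P.runFeat R S N e) e t) ≤
      P.ρ ^ 2 * (Real.log ((P.runDesign R S N e t).det / (P.runDesign R S N e 0).det) +
        2 * Real.log (2 / P.ζ))

theorem measurable_runFeat {Ω : Type*} [MeasurableSpace Ω] (R : P.ArgmaxRule)
    (S : Fin P.T → User d) {N : Ω → P.TreeNoise}
    (hN : Measurable N) {e : Ω → Fin P.T → ℝ} (he : Measurable e) (i : Fin P.T) :
    Measurable fun ω => P.runFeat R S (N ω) (e ω) i :=
  P.measurable_feat.comp (P.measurable_actionAt R S hN he i)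

theorem measurable_runDesign (R : P.ArgmaxRule) (S : Fin P.T → User d) (t : ℕ) (i j : P.Idx) :
    Measurable fun ω : P.Sample => P.runDesign R S ω.1 ω.2 t i j := by
  simp only [runDesign, design, Matrix.add_apply, Matrix.sum_apply]
  refine measurable_const.add (Finset.measurable_sum _ fun l _ => ?_)
  have h := P.measurable_runFeat R S (Ω := P.Sample) measurable_fst measurable_snd l
  split_ifs
  · simp only [vecMulVec_apply]
    exact ((measurable_pi_apply i).comp h).mul ((measurable_pi_apply j).comp h)
  · exact measurable_const

/-- Half of `ζ` goes to the tree noise. For the other half the tree noise is held fixed: the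
features are then predictable functions of the independent reward noise alone, and the
self-normalized bound applies. -/
theorem measure_not_goodRun_le (hd : 0 < d) (hT : 2 ≤ P.T) (hσ : 0 < P.σ) (hζ : 0 < P.ζ)
    (hζ1 : P.ζ < 1) (hρ : 0 < P.ρ) (hc : 0 < P.reg + P.Lam) (R : P.ArgmaxRule)
    {S : Fin P.T → User d}
    (hS : ∀ i, (S i).SubGaussianNoise P.ρ) :
    P.sampleMeasure S {ω | ¬ P.GoodRun R S ω.1 ω.2} ≤ ENNReal.ofReal P.ζ := by
  set A : Set P.TreeNoise := {N | ¬ P.GoodTree N} with hA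
  set q : ℕ → P.Sample → ℝ := fun t ω =>
    quad (P.runDesign R S ω.1 ω.2 t)⁻¹ (weightedSum (P.runFeat R S ω.1 ω.2) ω.2 t) with hq
  set b : ℕ → P.Sample → ℝ := fun t ω =>
    P.ρ ^ 2 * (Real.log ((P.runDesign R S ω.1 ω.2 t).det / (P.runDesign R S ω.1 ω.2 0).det) +
        2 * Real.log (2 / P.ζ)) with hb
  set D : Set P.Sample := ⋃ t ∈ Finset.range (P.T + 1), {ω | b t ω < q t ω} with hD
  have hqm : ∀ t, Measurable (q t) := fun t => by
    refine measurable_quad_inv (P.measurable_runDesign R S t) ?_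
    refine Finset.measurable_sum _ fun l _ => ?_
    have h := P.measurable_runFeat R S (Ω := P.Sample) measurable_fst measurable_snd l
    split_ifs
    · exact ((measurable_pi_apply l).comp measurable_snd).smul h
    · exact measurable_const
  have hbm : ∀ t, Measurable (b t) := fun t =>
    ((((measurable_det (P.measurable_runDesign R S t)).div
      (measurable_det (P.measurable_runDesign R S 0))).log).add_const _).const_mul _
  have hDm : MeasurableSet D :=
    Finset.measurableSet_biUnion _ fun t _ => measurableSet_lt (hbm t) (hqm t)
  have hsub : {ω : P.Sample | ¬ P.GoodRun R S ω.1 ω.2} ⊆ (A ×ˢ Set.univ) ∪ D := by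
    intro ω hω
    by_contra hcon
    rw [Set.mem_union, not_or] at hcon
    refine hω ⟨?_, fun t ht => ?_⟩
    · by_contra h
      exact hcon.1 ⟨h, Set.mem_univ _⟩
    · by_contra h
      refine hcon.2 ?_
      rw [hD]
      simp only [Set.mem_iUnion]
      exact ⟨t, Finset.mem_range.mpr (Nat.lt_succ_of_le ht), not_le.mp h⟩
  have hDle : P.sampleMeasure S D ≤ ENNReal.ofReal (P.ζ / 2) := by
    rw [sampleMeasure_eq, Measure.prod_apply hDm]
    calc ∫⁻ N, (Measure.pi fun i => ((S i).noise : Measure ℝ)) (Prod.mk N ⁻¹' D) ∂P.treeMeasure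
        ≤ ∫⁻ _, ENNReal.ofReal (P.ζ / 2) ∂P.treeMeasure := by
          refine lintegral_mono fun N => ?_
          have h := measure_selfNormalized_le (ν := fun i => ((S i).noise : Measure ℝ)) hρ hS
            (φ := fun e => P.runFeat R S N e)
            (fun i => P.measurable_runFeat R S measurable_const measurable_id i)
            (fun i s e y his => by
              simp only [runFeat]
              rw [P.actionAt_update R S N e s y i his])
            hc (δ := P.ζ / 2) (by positivity)
          refine (measure_mono fun e he => ?_).trans h
          have he' : (N, e) ∈ D := he
          rw [hD] at he'
          simp only [Set.mem_iUnion] at he'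
          obtain ⟨t, ht, h2⟩ := he'
          refine ⟨t, Nat.le_of_lt_succ (Finset.mem_range.mp ht), ?_⟩
          rw [one_div_div]
          exact h2
      _ = ENNReal.ofReal (P.ζ / 2) := by simp
  have hAle : P.sampleMeasure S (A ×ˢ Set.univ) ≤ ENNReal.ofReal (P.ζ / 2) := by
    rw [sampleMeasure_eq, Measure.prod_prod, measure_univ, mul_one]
    exact P.measure_not_goodTree_le hd hT hσ hζ hζ1
  refine (measure_mono hsub).trans ((measure_union_le _ _).trans
    ((add_le_add hAle hDle).trans (le_of_eq ?_)))
  rw [← ENNReal.ofReal_add (by positivity) (by positivity), add_halves]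

end Params

/-! ### Approximation of functions of the RKHS by features -/

section Ridge

variable {d : ℕ} {k : (Fin d → ℝ) → (Fin d → ℝ) → ℝ} {H : Type*} [NormedAddCommGroup H]
  [InnerProductSpace ℝ H] [CompleteSpace H] [RKHS ℝ H (Cube d) ℝ]

theorem inner_kerFun_sum (hH : ∀ x y : Cube d, RKHS.kernel H x y 1 = k x y) {ι : Type*} [Fintype ι]
    [DecidableEq ι] (p : ι → Cube d) (α : ι → ℝ) :
    ‖∑ i, α i • RKHS.kerFun H (p i) (1 : ℝ)‖ ^ 2 = quad (kernelMatrix k p) α := by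
  rw [← real_inner_self_eq_norm_sq, sum_inner]
  simp only [inner_sum, real_inner_smul_left, real_inner_smul_right, quad, dotProduct, mulVec]
  refine Finset.sum_congr rfl fun i _ => ?_
  rw [Finset.mul_sum]
  refine Finset.sum_congr rfl fun j _ => ?_
  rw [RKHS.kerFun_inner, RKHS.kerFun_apply, hH]
  simp only [kernelMatrix, Matrix.of_apply, RCLike.inner_apply, conj_trivial, mul_one]
  ring

theorem isHermitian_kernelMatrix (hH : ∀ x y : Cube d, RKHS.kernel H x y 1 = k x y) {ι : Type*}
    (p : ι → Cube d) : (kernelMatrix k p).IsHermitian := by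
  ext i j
  simp only [kernelMatrix, Matrix.conjTranspose_apply, Matrix.of_apply, star_trivial]
  rw [← hH, ← hH, ← RKHS.kerFun_apply, ← RKHS.kerFun_apply]
  have h1 := RKHS.kerFun_inner (p j) (1 : ℝ) (RKHS.kerFun H (p i) (1 : ℝ))
  have h2 := RKHS.kerFun_inner (p i) (1 : ℝ) (RKHS.kerFun H (p j) (1 : ℝ))
  rw [real_inner_comm, h2] at h1
  simpa using h1.symm

theorem posSemidef_kernelMatrix (hH : ∀ x y : Cube d, RKHS.kernel H x y 1 = k x y) {ι : Type*}
    [Fintype ι] [DecidableEq ι] (p : ι → Cube d) : (kernelMatrix k p).PosSemidef := by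
  have h := posSemidef_sub_of_quad_le (A := 0) isHermitian_zero (isHermitian_kernelMatrix hH p)
    fun α => by
      rw [← inner_kerFun_sum hH]
      simp only [quad, zero_mulVec, dotProduct_zero]
      positivity
  simpa using h

theorem quad_le_of_entries_le {ι : Type*} [Fintype ι] [DecidableEq ι] {A : Matrix ι ι ℝ} {ε : ℝ}
    (hA : ∀ i j, |A i j| ≤ ε) (α : ι → ℝ) :
    quad A α ≤ ε * (Fintype.card ι * (α ⬝ᵥ α)) := by
  rcases isEmpty_or_nonempty ι with hι | hι
  · simp [quad, dotProduct]
  have hε : 0 ≤ ε := (abs_nonneg _).trans (hA (Classical.arbitrary ι) (Classical.arbitrary ι))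
  have h1 : quad A α ≤ ε * (∑ i, |α i|) ^ 2 := by
    rw [sq, Finset.sum_mul_sum, Finset.mul_sum, quad, dotProduct]
    refine Finset.sum_le_sum fun i _ => ?_
    rw [mulVec, dotProduct, Finset.mul_sum, Finset.mul_sum]
    refine Finset.sum_le_sum fun j _ => ?_
    refine (le_abs_self _).trans ?_
    rw [abs_mul, abs_mul]
    calc |α i| * (|A i j| * |α j|) = |A i j| * (|α i| * |α j|) := by ring
      _ ≤ ε * (|α i| * |α j|) := mul_le_mul_of_nonneg_right (hA i j) (by positivity)
  refine h1.trans (mul_le_mul_of_nonneg_left ?_ hε)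
  have h2 := sq_sum_le_card_mul_sum_sq (s := Finset.univ) (f := fun i => |α i|)
  refine h2.trans (le_of_eq ?_)
  simp only [sq_abs, Finset.card_univ, dotProduct]
  simp only [sq]

/-- Kernel ridge regression with the features in place of the kernel. -/
theorem exists_approx (hH : ∀ x y : Cube d, RKHS.kernel H x y 1 = k x y) {J : Type*} [Fintype J]
    {Φ : Cube d → J → ℝ} {ε : ℝ} (hε : ∀ x y : Cube d, |k x y - Φ x ⬝ᵥ Φ y| ≤ ε)
    {B : ℝ} {f : H} (hf : ‖f‖ ≤ B) {ι : Type*} [Fintype ι] [DecidableEq ι] (p : ι → Cube d)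
    {μ : ℝ} (hμ : 0 < μ) :
    ∃ θ : J → ℝ, θ ⬝ᵥ θ ≤ B ^ 2 * (1 + ε * Fintype.card ι / μ) ∧
      ∀ i, |f (p i) - θ ⬝ᵥ Φ (p i)| ≤ B * (√μ + ε * Fintype.card ι / √μ) := by
  have hB : 0 ≤ B := (norm_nonneg f).trans hf
  set K := kernelMatrix k p with hK
  have hKp : K.PosSemidef := posSemidef_kernelMatrix hH p
  set V := K + μ • (1 : Matrix ι ι ℝ) with hV
  have hVp : V.PosDef := (posDef_smul_one hμ).posSemidef_add hKp
  set α := V⁻¹ *ᵥ (fun i => f (p i)) with hα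
  have hVα : V *ᵥ α = fun i => f (p i) := mulVec_inv_mulVec hVp _
  -- `g` is the kernel ridge regressor of `f`. Pairing the normal equations with `α` gives `‖g‖² + μ
  -- |α|² = ⟨g, f⟩ ≤ B ‖g‖`, which bounds both `‖g‖` and `|α|`. Replacing the kernel sections in `g`
  -- by features gives the witness.
  set g := ∑ i, α i • RKHS.kerFun H (p i) (1 : ℝ) with hg
  have hg2 : ‖g‖ ^ 2 = quad K α := inner_kerFun_sum hH p α
  have hgf : α ⬝ᵥ V *ᵥ α = inner ℝ g f := by
    rw [hVα, hg, sum_inner, dotProduct]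
    refine Finset.sum_congr rfl fun i _ => ?_
    rw [real_inner_smul_left, RKHS.kerFun_inner]
    simp
  have hsum : ‖g‖ ^ 2 + μ * (α ⬝ᵥ α) ≤ ‖g‖ * B := by
    have h1 : α ⬝ᵥ V *ᵥ α = quad K α + μ * (α ⬝ᵥ α) := by
      change quad V α = _
      rw [hV, quad_add_left, quad_smul_one]
    rw [hg2, ← h1, hgf]
    exact (real_inner_le_norm _ _).trans (mul_le_mul_of_nonneg_left hf (norm_nonneg _))
  have hαα : 0 ≤ α ⬝ᵥ α := Finset.sum_nonneg fun i _ => mul_self_nonneg _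
  have hgB : ‖g‖ ≤ B := by
    by_contra hcon
    have := not_le.mp hcon
    nlinarith [norm_nonneg g, mul_nonneg hμ.le hαα]
  have hαB : α ⬝ᵥ α ≤ B ^ 2 / μ := by
    rw [le_div_iff₀ hμ]
    nlinarith [norm_nonneg g, sq_nonneg (‖g‖ - B)]
  have hαi : ∀ i, |α i| ≤ B / √μ := by
    intro i
    have h1 : α i ^ 2 ≤ α ⬝ᵥ α := by
      rw [dotProduct, sq]
      exact Finset.single_le_sum (f := fun i => α i * α i) (fun j _ => mul_self_nonneg _)
        (Finset.mem_univ i)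
    refine abs_le_of_sq_le_sq (h1.trans (hαB.trans (le_of_eq ?_))) (by positivity)
    rw [div_pow, Real.sq_sqrt hμ.le]
  have hΦ : ∀ z : Cube d, (∑ j, α j • Φ (p j)) ⬝ᵥ Φ z = ∑ j, α j * (Φ (p j) ⬝ᵥ Φ z) := by
    intro z
    rw [sum_dotProduct]
    exact Finset.sum_congr rfl fun j _ => by rw [smul_dotProduct, smul_eq_mul]
  have hsym : ∀ i j, K i j = K j i := fun i j =>
    (congrFun (congrFun (isHermitian_kernelMatrix hH p) i) j).symm.trans (by simp [hK])
  refine ⟨∑ j, α j • Φ (p j), ?_, fun i => ?_⟩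
  · set G : Matrix ι ι ℝ := Matrix.of fun i j => Φ (p i) ⬝ᵥ Φ (p j) with hG
    have h1 : (∑ j, α j • Φ (p j)) ⬝ᵥ (∑ j, α j • Φ (p j)) = quad G α := by
      rw [dotProduct_sum, quad, dotProduct]
      refine Finset.sum_congr rfl fun i _ => ?_
      rw [dotProduct_smul, hΦ, mulVec, dotProduct, smul_eq_mul]
      congr 1
      refine Finset.sum_congr rfl fun j _ => ?_
      rw [hG, Matrix.of_apply, dotProduct_comm (Φ (p i)), mul_comm]
    have h2 : quad G α = quad K α + quad (G - K) α := by rw [quad_sub_left]; ring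
    have h3 := quad_le_of_entries_le (A := G - K) (ε := ε) (fun i j => by
      rw [Matrix.sub_apply, hG, hK, abs_sub_comm]
      exact hε (p i) (p j)) α
    have hKB : quad K α ≤ B ^ 2 := by
      rw [← hg2]; exact pow_le_pow_left₀ (norm_nonneg _) hgB 2
    have hεn : 0 ≤ ε := (abs_nonneg _).trans (hε ⟨0, by simp⟩ ⟨0, by simp⟩)
    rw [h1, h2]
    calc quad K α + quad (G - K) α ≤ B ^ 2 + ε * (Fintype.card ι * (B ^ 2 / μ)) := by
          refine add_le_add hKB (h3.trans ?_)
          gcongr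
      _ = _ := by ring
  · have h1 : f (p i) = ∑ j, α j * k (p j) (p i) + μ * α i := by
      have := congrFun hVα i
      simp only [hV, Matrix.add_mulVec, Matrix.smul_mulVec, Matrix.one_mulVec, Pi.add_apply,
        Pi.smul_apply, smul_eq_mul] at this
      rw [← this, mulVec, dotProduct]
      congr 1
      refine Finset.sum_congr rfl fun j _ => ?_
      rw [hsym i j, mul_comm]
      rfl
    rw [h1, hΦ, show ∑ j, α j * k (p j) (p i) + μ * α i - ∑ j, α j * (Φ (p j) ⬝ᵥ Φ (p i)) =
      ∑ j, α j * (k (p j) (p i) - Φ (p j) ⬝ᵥ Φ (p i)) + μ * α i by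
        simp only [mul_sub, Finset.sum_sub_distrib]; ring]
    have h2 : |∑ j, α j * (k (p j) (p i) - Φ (p j) ⬝ᵥ Φ (p i))| ≤
        Fintype.card ι * (B / √μ * ε) := by
      refine (Finset.abs_sum_le_sum_abs _ _).trans ?_
      refine (Finset.sum_le_card_nsmul _ _ (B / √μ * ε) fun j _ => ?_).trans (le_of_eq ?_)
      · rw [abs_mul]
        exact mul_le_mul (hαi j) (hε _ _) (abs_nonneg _) (by positivity)
      · rw [nsmul_eq_mul, Finset.card_univ]
    have h3 : |μ * α i| ≤ B * √μ := by
      rw [abs_mul, abs_of_pos hμ]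
      refine (mul_le_mul_of_nonneg_left (hαi i) hμ.le).trans (le_of_eq ?_)
      have : √μ ≠ 0 := (Real.sqrt_pos.mpr hμ).ne'
      field_simp
      rw [Real.sq_sqrt hμ.le, mul_comm]
    refine (abs_add_le _ _).trans ((add_le_add h2 h3).trans (le_of_eq ?_))
    ring

end Ridge

end PrivateGPBandit

end

noncomputable section
namespace PrivateGPBandit
set_option linter.unusedSectionVars false
open Matrix
open scoped ENNReal

/-! ### Regret on the good event -/

theorem sum_castLE_eq {M : Type*} [AddCommMonoid M] {T t : ℕ} (ht : t ≤ T) (g : Fin T → M) :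
    ∑ i : Fin t, g (Fin.castLE ht i) = ∑ i : Fin T, if (i : ℕ) < t then g i else 0 := by
  induction t with
  | zero => simp
  | succ t ih =>
    rw [Fin.sum_univ_castSucc, sum_ite_lt_succ ht, ← ih (Nat.le_of_succ_le ht)]
    rfl

namespace Params

variable {d : ℕ} (P : Params d)

/-- The unregularized design matrix of a run. -/
def runGram (R : P.ArgmaxRule) (S : Fin P.T → User d) (N : P.TreeNoise) (e : Fin P.T → ℝ)
    (t : ℕ) : Matrix P.Idx P.Idx ℝ :=
  ∑ i : Fin P.T, if (i : ℕ) < t then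
    vecMulVec (P.runFeat R S N e i) (P.runFeat R S N e i) else 0

/-- The regularized released matrix of round `t`. -/
def runV (R : P.ArgmaxRule) (S : Fin P.T → User d) (N : P.TreeNoise) (e : Fin P.T → ℝ)
    (t : Fin P.T) : Matrix P.Idx P.Idx ℝ :=
  P.privSigma N (P.history R S N e t t.2.le) + P.reg • 1

/-- The difference between the released and the true design matrix. -/
def runH (N : P.TreeNoise) (t : ℕ) : Matrix P.Idx P.Idx ℝ :=
  P.noiseMat N t + (2 * P.Lam + P.reg) • 1

variable (R : P.ArgmaxRule) (S : Fin P.T → User d) (N : P.TreeNoise) (e : Fin P.T → ℝ)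

theorem runV_eq (t : Fin P.T) : P.runV R S N e t = P.runGram R S N e t + P.runH N t := by
  have h1 : (P.treeSum N (P.history R S N e t t.2.le)).toBlocks₁₁ =
      P.runGram R S N e t + P.noiseMat N t := by
    rw [P.treeSum_eq N t.2, runGram, ← sum_castLE_eq t.2.le
      (fun i => vecMulVec (P.runFeat R S N e i) (P.runFeat R S N e i))]
    ext i j
    simp only [toBlocks₁₁, Matrix.of_apply, Matrix.add_apply, Matrix.sum_apply, vecMulVec_apply,
      noiseMat, datum, Sum.elim_inl, P.history_apply, runFeat]
  rw [runV, privSigma, h1, runH, add_smul]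
  abel

theorem privU_eq (t : Fin P.T) : P.privU N (P.history R S N e t t.2.le) =
    (∑ i : Fin P.T, if (i : ℕ) < t then
      ((S i).meanReward (P.actionAt R S N e i) + e i) • P.runFeat R S N e i else 0) +
      P.noiseVec N t := by
  rw [← sum_castLE_eq t.2.le (fun i => ((S i).meanReward (P.actionAt R S N e i) + e i) •
    P.runFeat R S N e i)]
  ext i
  rw [privU, P.treeSum_eq N t.2]
  simp only [Matrix.add_apply, Matrix.sum_apply, vecMulVec_apply, datum, Sum.elim_inl, Sum.elim_inr,
    P.history_apply, Pi.add_apply, Finset.sum_apply, Pi.smul_apply, smul_eq_mul, noiseVec, runFeat]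
  congr 1
  exact Finset.sum_congr rfl fun j _ => mul_comm _ _

variable {R S N e}

theorem quad_runGram_nonneg (t : ℕ) (x : P.Idx → ℝ) : 0 ≤ quad (P.runGram R S N e t) x := by
  refine quad_nonneg (posSemidef_sum _ fun i _ => ?_) x
  split_ifs
  · exact posSemidef_vecMulVec _
  · exact PosSemidef.zero

theorem isHermitian_runH (t : ℕ) : (P.runH N t).IsHermitian :=
  (P.isHermitian_noiseMat N t).add (isHermitian_one.smul (by simp [IsSelfAdjoint]))

theorem quad_runH_le (hN : P.GoodTree N) {t : ℕ} (ht : t < P.T) (x : P.Idx → ℝ) :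
    quad (P.runH N t) x ≤ (3 * P.Lam + P.reg) * (x ⬝ᵥ x) := by
  rw [runH, quad_add_left, quad_smul_one]
  have := (abs_le.mp ((hN t ht).1 x)).2
  linarith

theorem le_quad_runH (hN : P.GoodTree N) {t : ℕ} (ht : t < P.T) (x : P.Idx → ℝ) :
    (P.reg + P.Lam) * (x ⬝ᵥ x) ≤ quad (P.runH N t) x := by
  rw [runH, quad_add_left, quad_smul_one]
  have := (abs_le.mp ((hN t ht).1 x)).1
  linarith

theorem dotProduct_self_nonneg' {ι : Type*} [Fintype ι] (x : ι → ℝ) : 0 ≤ x ⬝ᵥ x :=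
  Finset.sum_nonneg fun i _ => mul_self_nonneg (x i)

theorem posSemidef_runH (hN : P.GoodTree N) (hc : 0 < P.reg + P.Lam) {t : ℕ} (ht : t < P.T) :
    (P.runH N t).PosSemidef := by
  have h := posSemidef_sub_of_quad_le (A := 0) isHermitian_zero (P.isHermitian_runH (N := N) t)
    fun x => by
      have := P.le_quad_runH hN ht x
      have h2 := mul_nonneg hc.le (dotProduct_self_nonneg' x)
      simp only [quad, zero_mulVec, dotProduct_zero] at this ⊢
      linarith
  simpa using h

theorem quad_runDesign_le_quad_runV (hN : P.GoodTree N) (t : Fin P.T) (x : P.Idx → ℝ) :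
    quad (P.runDesign R S N e t) x ≤ quad (P.runV R S N e t) x := by
  rw [runV_eq, quad_add_left, runDesign, design, quad_add_left, quad_smul_one]
  have h := P.le_quad_runH hN t.2 x
  have : quad (∑ i : Fin P.T, if (i : ℕ) < t then
    vecMulVec (P.runFeat R S N e i) (P.runFeat R S N e i) else 0) x =
      quad (P.runGram R S N e t) x := rfl
  linarith

theorem isHermitian_runV (t : Fin P.T) : (P.runV R S N e t).IsHermitian := by
  rw [runV_eq]
  refine IsHermitian.add (PosSemidef.isHermitian (posSemidef_sum _ fun i _ => ?_))
    (P.isHermitian_runH t)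
  split_ifs
  · exact posSemidef_vecMulVec _
  · exact PosSemidef.zero

theorem posSemidef_runV_sub (hN : P.GoodTree N) (t : Fin P.T) (hc : 0 < P.reg + P.Lam) :
    (P.runV R S N e t - P.runDesign R S N e t).PosSemidef :=
  posSemidef_sub_of_quad_le (posDef_design hc _ _).isHermitian (P.isHermitian_runV t)
    (P.quad_runDesign_le_quad_runV hN t)

theorem posDef_runV (hN : P.GoodTree N) (t : Fin P.T) (hc : 0 < P.reg + P.Lam) :
    (P.runV R S N e t).PosDef := by
  have := (posDef_design hc (P.runFeat R S N e) t).add_posSemidef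
    (P.posSemidef_runV_sub (R := R) (S := S) (e := e) hN t hc)
  rwa [runDesign, add_sub_cancel] at this

theorem le_quad_runV (hN : P.GoodTree N) (t : Fin P.T) (x : P.Idx → ℝ) :
    (P.reg + P.Lam) * (x ⬝ᵥ x) ≤ quad (P.runV R S N e t) x := by
  rw [runV_eq, quad_add_left]
  have h := P.le_quad_runH hN t.2 x
  have := P.quad_runGram_nonneg (R := R) (S := S) (N := N) (e := e) t x
  linarith

/-- The logarithmic determinant in the confidence width. -/
def runLogDet (R : P.ArgmaxRule) (S : Fin P.T → User d) (N : P.TreeNoise) (e : Fin P.T → ℝ)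
    (t : Fin P.T) : ℝ :=
  Real.log ((P.reg + P.Lam)⁻¹ • P.runV R S N e t).det

/-- The self-normalized bound speaks of the true design, which the algorithm does not observe. The
released matrix dominates it, so the observed determinant may be used in the confidence width. -/
theorem log_det_runDesign_le (hN : P.GoodTree N) (hc : 0 < P.reg + P.Lam) (t : Fin P.T) :
    Real.log ((P.runDesign R S N e t).det / (P.runDesign R S N e 0).det) ≤
      P.runLogDet R S N e t := by
  have h0 : (P.runDesign R S N e 0).det = (P.reg + P.Lam) ^ Fintype.card P.Idx := by
    rw [runDesign, design_zero, det_smul, det_one, mul_one]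
  have hp := (posDef_design hc (P.runFeat R S N e) t).det_pos
  refine Real.log_le_log (div_pos hp (h0 ▸ by positivity)) ?_
  rw [det_smul, h0, inv_pow, div_eq_inv_mul]
  exact mul_le_mul_of_nonneg_left
    (det_le_det_of_posSemidef_sub (posDef_design hc _ _) (P.posSemidef_runV_sub hN t hc))
    (by positivity)

/-- Deterministically `V_t ≤ (T + 3Λ + λ) I`, and `Λ ≥ 1` makes this at most `(λ + Λ)(T + 3) I`. -/
theorem runLogDet_le (hN : P.GoodTree N) (hreg : 0 < P.reg) (hΛ : 1 ≤ P.Lam)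
    (hfeat : ∀ x, P.feat x ⬝ᵥ P.feat x ≤ 1) (t : Fin P.T) :
    P.runLogDet R S N e t ≤ P.m * Real.log (P.T + 3) := by
  have hc : 0 < P.reg + P.Lam := by linarith
  have hV := P.posDef_runV (R := R) (S := S) (e := e) hN t hc
  set a := (P.reg + P.Lam) * (P.T + 3) with ha
  have hgram : ∀ x, quad (P.runGram R S N e t) x ≤ P.T * (x ⬝ᵥ x) := by
    intro x
    rw [runGram, quad_sum]
    calc ∑ i : Fin P.T, quad (if (i : ℕ) < t then
          vecMulVec (P.runFeat R S N e i) (P.runFeat R S N e i) else 0) x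
        ≤ ∑ _i : Fin P.T, x ⬝ᵥ x := by
          refine Finset.sum_le_sum fun i _ => ?_
          split_ifs
          · rw [quad_vecMulVec]
            have h1 := abs_dotProduct_mulVec_le (A := (1 : Matrix P.Idx P.Idx ℝ)) PosSemidef.one
              (P.runFeat R S N e i) x
            simp only [quad, one_mulVec] at h1
            have h2 : (P.runFeat R S N e i ⬝ᵥ x) ^ 2 ≤
                (P.runFeat R S N e i ⬝ᵥ P.runFeat R S N e i) * (x ⬝ᵥ x) := by
              rw [← sq_abs]
              refine (pow_le_pow_left₀ (abs_nonneg _) h1 2).trans (le_of_eq ?_)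
              rw [mul_pow, Real.sq_sqrt (dotProduct_self_nonneg' _),
                Real.sq_sqrt (dotProduct_self_nonneg' _)]
            refine h2.trans ?_
            have := mul_le_mul_of_nonneg_right (hfeat (P.actionAt R S N e i))
              (dotProduct_self_nonneg' x)
            rw [one_mul] at this
            exact this
          · simp only [quad, zero_mulVec, dotProduct_zero]
            exact dotProduct_self_nonneg' x
      _ = P.T * (x ⬝ᵥ x) := by simp
  have hle : (P.runV R S N e t).det ≤ (a • (1 : Matrix P.Idx P.Idx ℝ)).det := by
    refine det_le_det_of_posSemidef_sub hV (posSemidef_sub_of_quad_le hV.isHermitian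
      (isHermitian_one.smul (by simp [IsSelfAdjoint])) fun x => ?_)
    rw [runV_eq, quad_add_left, quad_smul_one]
    have h1 := hgram x
    have h2 := P.quad_runH_le hN t.2 x
    have h3 : (P.T + (3 * P.Lam + P.reg) : ℝ) ≤ a := by
      rw [ha]
      have : (0 : ℝ) ≤ P.T := Nat.cast_nonneg _
      nlinarith
    have := mul_le_mul_of_nonneg_right h3 (dotProduct_self_nonneg' x)
    linarith
  have hT0 : (0 : ℝ) < P.T + 3 := by positivity
  rw [runLogDet, ← P.card_idx, ← Real.log_pow]
  refine Real.log_le_log ?_ ?_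
  · rw [det_smul]; exact mul_pos (by positivity) hV.det_pos
  · rw [det_smul]
    rw [det_smul, det_one, mul_one, ha, mul_pow] at hle
    calc (P.reg + P.Lam)⁻¹ ^ Fintype.card P.Idx * (P.runV R S N e t).det
        ≤ (P.reg + P.Lam)⁻¹ ^ Fintype.card P.Idx *
          ((P.reg + P.Lam) ^ Fintype.card P.Idx * (P.T + 3) ^ Fintype.card P.Idx) := by gcongr
      _ = _ := by rw [← mul_assoc, ← mul_pow, inv_mul_cancel₀ hc.ne', one_pow, one_mul]

/-- The error of the private ridge estimator in the norm of the released matrix. -/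
theorem sqrt_quad_estimate_sub_le (hG : P.GoodRun R S N e) (hreg : 0 < P.reg) (hΛ : 1 ≤ P.Lam)
    (hρ : 0 < P.ρ) (hσ : 0 ≤ P.σ) (hfeat : ∀ x, P.feat x ⬝ᵥ P.feat x ≤ 1) (t : Fin P.T)
    {θ : P.Idx → ℝ} {δ : ℝ}
    (hθ : ∀ i, |(S i).meanReward (P.actionAt R S N e i) - θ ⬝ᵥ P.runFeat R S N e i| ≤ δ) :
    √(quad (P.runV R S N e t) ((P.runV R S N e t)⁻¹ *ᵥ
        P.privU N (P.history R S N e t t.2.le) - θ)) ≤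
      √(3 * P.Lam + P.reg) * √(θ ⬝ᵥ θ) + P.T * δ + P.κ +
        P.ρ * √(P.runLogDet R S N e t + 2 * Real.log (2 / P.ζ)) := by
  have hc : 0 < P.reg + P.Lam := by linarith
  have hN := hG.1
  set V := P.runV R S N e t with hV
  have hVp : V.PosDef := P.posDef_runV hN t hc
  have hVi : V⁻¹.PosSemidef := hVp.inv.posSemidef
  set u := P.privU N (P.history R S N e t t.2.le) with hu
  set z1 := P.runH N t *ᵥ (-θ) with hz1
  set z2 : P.Idx → ℝ := ∑ i : Fin P.T, if (i : ℕ) < t then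
    ((S i).meanReward (P.actionAt R S N e i) - θ ⬝ᵥ P.runFeat R S N e i) • P.runFeat R S N e i
      else 0 with hz2
  set z3 := P.noiseVec N t with hz3
  set z4 := weightedSum (P.runFeat R S N e) e t with hz4
  -- Four sources of error: the bias from regularizer and matrix noise, the misspecification of `f`
  -- by `θ`, the vector noise and the reward noise. They are bounded in this order, in the norm of
  -- `V⁻¹`.
  have hdecomp : u - V *ᵥ θ = z1 + z2 + z3 + z4 := by
    have h1 : P.runGram R S N e t *ᵥ θ = ∑ i : Fin P.T, if (i : ℕ) < t then
        (θ ⬝ᵥ P.runFeat R S N e i) • P.runFeat R S N e i else 0 := by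
      rw [runGram, sum_mulVec]
      refine Finset.sum_congr rfl fun i _ => ?_
      split_ifs
      · rw [vecMulVec_mulVec, dotProduct_comm]
        ext j
        simp [mul_comm]
      · simp
    have h2 : u - P.runGram R S N e t *ᵥ θ = z2 + z3 + z4 := by
      rw [hu, privU_eq, h1, hz2, hz4, weightedSum, add_sub_right_comm, ← Finset.sum_sub_distrib,
        add_right_comm, ← Finset.sum_add_distrib]
      congr 1
      refine Finset.sum_congr rfl fun i _ => ?_
      split_ifs
      · rw [← sub_smul, ← add_smul]; congr 1; ring
      · simp
    rw [hV, runV_eq, add_mulVec, ← sub_sub, h2, hz1, mulVec_neg]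
    abel
  have hest : V⁻¹ *ᵥ u - θ = V⁻¹ *ᵥ (u - V *ᵥ θ) := by
    rw [mulVec_sub, inv_mulVec_eq_iff hVp rfl]
  rw [hest, quad_inv_mulVec hVp, hdecomp]
  have hb1 : √(quad V⁻¹ z1) ≤ √(3 * P.Lam + P.reg) * √(θ ⬝ᵥ θ) := by
    rw [← Real.sqrt_mul (by linarith)]
    refine Real.sqrt_le_sqrt ?_
    refine (quad_inv_mulVec_le hVp (P.posSemidef_runH hN hc t.2) (fun x => ?_) _).trans ?_
    · rw [hV, runV_eq, quad_add_left]
      have := P.quad_runGram_nonneg (R := R) (S := S) (N := N) (e := e) t x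
      linarith
    · have := P.quad_runH_le hN t.2 (-θ)
      rwa [neg_dotProduct_neg] at this
  have hinv : ∀ x, quad V⁻¹ x ≤ (x ⬝ᵥ x) / (P.reg + P.Lam) :=
    quad_inv_le_div hVp hc (P.le_quad_runV hN t)
  have hδ : ∀ i : Fin P.T, 0 ≤ δ := fun i => (abs_nonneg _).trans (hθ i)
  have hb2 : √(quad V⁻¹ z2) ≤ P.T * δ := by
    refine (sqrt_quad_sum_le hVi _ _).trans ?_
    calc _ ≤ ∑ _i : Fin P.T, δ := by
          refine Finset.sum_le_sum fun i _ => ?_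
          split_ifs
          · rw [quad_smul, Real.sqrt_mul (sq_nonneg _), Real.sqrt_sq_eq_abs]
            have h1 : √(quad V⁻¹ (P.runFeat R S N e i)) ≤ 1 := by
              rw [Real.sqrt_le_left zero_le_one, one_pow]
              refine (hinv _).trans ?_
              rw [div_le_one hc]
              exact (hfeat _).trans (by linarith)
            calc _ ≤ δ * 1 := mul_le_mul (hθ i) h1 (Real.sqrt_nonneg _) (hδ i)
              _ = δ := mul_one δ
          · simpa [quad] using hδ i
      _ = P.T * δ := by simp
  have hb3 : √(quad V⁻¹ z3) ≤ P.κ := by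
    have h1 := (hN t t.2).2
    have hκ : P.κ = P.σ * √P.depth * (√P.m + √(2 * Real.log (2 * P.T / P.ζ))) / √P.Lam := by
      rw [κ, Real.sqrt_div (Nat.cast_nonneg _)]; ring
    rw [hκ, Real.sqrt_le_left (by positivity), div_pow, Real.sq_sqrt (by linarith)]
    refine (hinv _).trans ?_
    exact div_le_div₀ (sq_nonneg _) h1 (by linarith) (by linarith)
  have hb4 : √(quad V⁻¹ z4) ≤ P.ρ * √(P.runLogDet R S N e t + 2 * Real.log (2 / P.ζ)) := by
    have h1 := hG.2 t t.2.le
    have h2 := P.log_det_runDesign_le (R := R) (S := S) (e := e) hN hc t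
    have h3 : quad V⁻¹ z4 ≤ P.ρ ^ 2 * (P.runLogDet R S N e t + 2 * Real.log (2 / P.ζ)) := by
      refine (quad_inv_le_quad_inv hVp (posDef_design hc (P.runFeat R S N e) t)
        (P.quad_runDesign_le_quad_runV hN t) _).trans (h1.trans ?_)
      gcongr
    refine (Real.sqrt_le_sqrt h3).trans (le_of_eq ?_)
    rw [Real.sqrt_mul (sq_nonneg _), Real.sqrt_sq hρ.le]
  have t1 := sqrt_quad_add_le hVi (z1 + z2 + z3) z4
  have t2 := sqrt_quad_add_le hVi (z1 + z2) z3
  have t3 := sqrt_quad_add_le hVi z1 z2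
  linarith

end Params
end PrivateGPBandit

end

noncomputable section
namespace PrivateGPBandit
set_option linter.unusedSectionVars false
open Matrix
open scoped ENNReal

/-! ### The sum of the confidence widths -/

section Potential

variable {ι : Type*} [Fintype ι] [DecidableEq ι] {T : ℕ}

/-- Elliptical potential: each round multiplies the determinant by `1 + w`, and `c ≥ 1` forces `w ≤
1`, where `w ≤ 2 log(1 + w)`. -/
theorem sum_quad_inv_design_le {c : ℝ} (hc : 1 ≤ c) {φ : Fin T → ι → ℝ}
    (hφ : ∀ i, φ i ⬝ᵥ φ i ≤ 1) :
    ∑ i : Fin T, quad (design c φ i)⁻¹ (φ i) ≤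
      2 * Real.log ((design c φ T).det / (design c φ 0).det) := by
  have hc0 : 0 < c := by linarith
  have hpos : ∀ t, 0 < (design c φ t).det := fun t => (posDef_design hc0 φ t).det_pos
  have key : ∀ t ≤ T, ∑ i : Fin T, (if (i : ℕ) < t then quad (design c φ i)⁻¹ (φ i) else 0) ≤
      2 * Real.log ((design c φ t).det / (design c φ 0).det) := by
    intro t
    induction t with
    | zero => intro _; simp [div_self (hpos 0).ne']
    | succ t ih =>
      intro ht
      rw [sum_ite_lt_succ ht, design_succ c φ ht, det_add_vecMulVec (posDef_design hc0 φ t)]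
      set w := quad (design c φ t)⁻¹ (φ ⟨t, ht⟩) with hw
      have hw0 : 0 ≤ w := quad_nonneg (posDef_design hc0 φ t).inv.posSemidef _
      have hw1 : w ≤ 1 := by
        refine (quad_inv_le_div (posDef_design hc0 φ t) hc0 (fun x => ?_) _).trans ?_
        · rw [design, quad_add_left, quad_smul_one, le_add_iff_nonneg_right]
          refine quad_nonneg (posSemidef_sum _ fun i _ => ?_) x
          split_ifs
          · exact posSemidef_vecMulVec _
          · exact PosSemidef.zero
        · rw [div_le_one hc0]
          exact (hφ _).trans hc
      have hlog : w ≤ 2 * Real.log (1 + w) := by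
        have h1 := Real.one_sub_inv_le_log_of_pos (x := 1 + w) (by linarith)
        have h2 : w / 2 ≤ 1 - (1 + w)⁻¹ := by
          rw [show 1 - (1 + w)⁻¹ = w / (1 + w) by field_simp; ring]
          exact div_le_div_of_nonneg_left hw0 (by linarith) (by linarith)
        linarith
      rw [mul_div_right_comm, Real.log_mul (div_pos (hpos t) (hpos 0)).ne' (by linarith)]
      have := ih (Nat.le_of_succ_le ht)
      linarith
  have := key T le_rfl
  simpa using this

/-- Sylvester's identity rewrites the ratio as `det(1 + G/c)` with `G` the Gram matrix of the
features, and `c ≥ 1`. This replaces the feature dimension by the number of rounds, as the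
information gain requires. -/
theorem det_design_div_le {c : ℝ} (hc : 1 ≤ c) (φ : Fin T → ι → ℝ) :
    (design c φ T).det / (design c φ 0).det ≤
      (1 + Matrix.of fun i j => φ i ⬝ᵥ φ j : Matrix (Fin T) (Fin T) ℝ).det := by
  have hc0 : 0 < c := by linarith
  set A : Matrix (Fin T) ι ℝ := Matrix.of φ with hA
  set G : Matrix (Fin T) (Fin T) ℝ := Matrix.of fun i j => φ i ⬝ᵥ φ j with hG
  have hGA : G = A * Aᵀ := by
    ext i j
    simp [hG, hA, Matrix.mul_apply, dotProduct]
  have hGp : G.PosSemidef := by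
    rw [hGA]
    have := posSemidef_self_mul_conjTranspose A
    rwa [conjTranspose_eq_transpose_of_trivial] at this
  have h1 : design c φ T = c • (1 + (c⁻¹ • Aᵀ) * A) := by
    rw [design, smul_add, smul_mul, smul_smul, mul_inv_cancel₀ hc0.ne', one_smul]
    congr 1
    ext i j
    simp [Matrix.sum_apply, vecMulVec_apply, Matrix.mul_apply, hA]
  have h2 : (design c φ T).det / (design c φ 0).det = (1 + c⁻¹ • G).det := by
    rw [h1, design_zero, det_smul, det_smul, det_one, mul_one, det_one_add_mul_comm,
      Matrix.mul_smul, ← hGA]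
    field_simp
  rw [h2]
  have hp : (1 + c⁻¹ • G).PosDef := PosDef.one.add_posSemidef (hGp.smul (by positivity))
  refine det_le_det_of_posSemidef_sub hp ?_
  have : 1 + G - (1 + c⁻¹ • G) = (1 - c⁻¹) • G := by rw [sub_smul, one_smul]; abel
  rw [this]
  exact hGp.smul (by rw [sub_nonneg]; exact inv_le_one_of_one_le₀ hc)

/-- Entrywise closeness gives `G ≤ K + Tε I` as forms, hence `1 + G ≤ (1 + Tε)(1 + K)`. -/
theorem log_det_one_add_le_of_entries {G K : Matrix (Fin T) (Fin T) ℝ} (hG : G.PosSemidef)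
    (hK : K.PosSemidef) {ε : ℝ} (hε : 0 ≤ ε) (h : ∀ i j, |G i j - K i j| ≤ ε) :
    Real.log (1 + G).det ≤ T * (T * ε) + Real.log (1 + K).det := by
  have hGp : (1 + G).PosDef := PosDef.one.add_posSemidef hG
  have hKp : (1 + K).PosDef := PosDef.one.add_posSemidef hK
  have hle : (1 + G).det ≤ ((1 + T * ε) • (1 + K)).det := by
    refine det_le_det_of_posSemidef_sub hGp (posSemidef_sub_of_quad_le hGp.isHermitian
      (hKp.isHermitian.smul (by simp [IsSelfAdjoint])) fun x => ?_)
    have h1 : quad (1 + G) x = x ⬝ᵥ x + quad K x + quad (G - K) x := by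
      rw [quad_add_left, quad_sub_left, show quad (1 : Matrix (Fin T) (Fin T) ℝ) x = x ⬝ᵥ x by
        simp [quad]]
      ring
    have h2 : quad ((1 + T * ε) • (1 + K)) x = (1 + T * ε) * (x ⬝ᵥ x + quad K x) := by
      simp only [quad, smul_mulVec, add_mulVec, one_mulVec, dotProduct_smul, dotProduct_add,
        smul_eq_mul]
    have h3 := quad_le_of_entries_le (A := G - K) (fun i j => h i j) x
    have h4 := mul_nonneg (mul_nonneg (Nat.cast_nonneg T) hε) (quad_nonneg hK x)
    rw [Fintype.card_fin] at h3
    rw [h1, h2]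
    nlinarith
  have hT : 0 < 1 + T * ε := by positivity
  calc Real.log (1 + G).det ≤ Real.log ((1 + T * ε) • (1 + K)).det :=
        Real.log_le_log hGp.det_pos hle
    _ = T * Real.log (1 + T * ε) + Real.log (1 + K).det := by
        rw [det_smul, Fintype.card_fin, Real.log_mul (by positivity) hKp.det_pos.ne', Real.log_pow]
    _ ≤ T * (T * ε) + Real.log (1 + K).det := by
        have := Real.log_le_sub_one_of_pos hT
        gcongr
        linarith

end Potential

/-! ### Regret of one round and its sum over rounds. -/

namespace Params

variable {d : ℕ} (P : Params d) {R : P.ArgmaxRule} {S : Fin P.T → User d} {N : P.TreeNoise}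
  {e : Fin P.T → ℝ}

/-- A bound for `ρ` times the confidence multiplier. -/
def widthBound : ℝ :=
  P.B * √(3 * P.Lam + P.reg) + P.T * P.B * P.ε / √P.Lam + P.κ +
    P.ρ * √(P.m * Real.log (P.T + 3) + 2 * Real.log (2 / P.ζ))

theorem rho_mul_sqrtBeta (hρ : 0 < P.ρ) (t : Fin P.T) :
    P.ρ * P.sqrtBeta (t + 1) (P.privSigma N (P.history R S N e t t.2.le)) =
      P.B * √(3 * P.Lam + P.reg) + (t + 1 : ℕ) * P.B * P.ε / √P.Lam + P.κ +
        P.ρ * √(P.runLogDet R S N e t + 2 * Real.log (2 / P.ζ)) := by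
  have h1 : √((3 * P.Lam + P.reg) / P.ρ ^ 2) = √(3 * P.Lam + P.reg) / P.ρ := by
    rw [Real.sqrt_div' _ (sq_nonneg _), Real.sqrt_sq hρ.le]
  rw [sqrtBeta, h1, runLogDet, runV, mul_add, mul_add, mul_add]
  congr 1
  congr 1
  · congr 1
    · field_simp
    · rw [mul_comm P.ρ √P.Lam, ← div_div]
      field_simp
  · field_simp

theorem rho_mul_sqrtBeta_le (hG : P.GoodRun R S N e) (hreg : 0 < P.reg) (hΛ : 1 ≤ P.Lam)
    (hρ : 0 < P.ρ) (hB : 0 ≤ P.B) (hfeat : ∀ x, P.feat x ⬝ᵥ P.feat x ≤ 1) (t : Fin P.T) :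
    P.ρ * P.sqrtBeta (t + 1) (P.privSigma N (P.history R S N e t t.2.le)) ≤ P.widthBound := by
  rw [P.rho_mul_sqrtBeta hρ, widthBound]
  have h1 := P.runLogDet_le (R := R) (S := S) (e := e) hG.1 hreg hΛ hfeat t
  have h2 : ((t + 1 : ℕ) : ℝ) ≤ P.T := by exact_mod_cast t.2
  have h3 := P.ε_nonneg
  gcongr

/-- One round of regret against `x`, given a linear approximation `θ` of the mean reward. -/
theorem round_regret_le (hG : P.GoodRun R S N e) (hreg : 0 < P.reg) (hΛ : 1 ≤ P.Lam)
    (hρ : 0 < P.ρ) (hσ : 0 ≤ P.σ) (hB : 0 ≤ P.B) (hfeat : ∀ x, P.feat x ⬝ᵥ P.feat x ≤ 1)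
    (t : Fin P.T) {x : Cube d} (hx : x ∈ (S t).decisionSet) {θ : P.Idx → ℝ} {δ r : ℝ}
    (hθ : ∀ i, |(S i).meanReward (P.actionAt R S N e i) - θ ⬝ᵥ P.runFeat R S N e i| ≤ δ)
    (hθx : |(S t).meanReward x - θ ⬝ᵥ P.feat x| ≤ δ)
    (hr0 : 0 ≤ r) (hr : √(θ ⬝ᵥ θ) ≤ P.B + r) :
    (S t).meanReward x - (S t).meanReward (P.actionAt R S N e t) ≤
      2 * P.widthBound * √(quad (P.runDesign R S N e t)⁻¹ (P.runFeat R S N e t)) +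
        2 * (√(3 * P.Lam + P.reg) * r + P.T * δ) + 2 * δ := by
  have hc : 0 < P.reg + P.Lam := by linarith
  set V := P.runV R S N e t with hV
  have hVp : V.PosDef := P.posDef_runV hG.1 t hc
  set u := V⁻¹ *ᵥ P.privU N (P.history R S N e t t.2.le) with hu
  set b := P.sqrtBeta (t + 1) (P.privSigma N (P.history R S N e t t.2.le)) with hb
  set w := √(quad V⁻¹ (P.runFeat R S N e t)) with hw
  set y := √(quad V⁻¹ (P.feat x)) with hy
  have hδ : 0 ≤ δ := (abs_nonneg _).trans hθx
  -- `s` is the amount by which the ellipsoid must be enlarged to contain the surrogate `θ`, whose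
  -- norm may exceed `B` by `r` and which misses `f` by `δ`. The feature norms in `V⁻¹` are at most
  -- one, so it costs at most `s` at each of the two compared points.
  set s := √(3 * P.Lam + P.reg) * r + P.T * δ with hs
  have hs0 : 0 ≤ s := by positivity
  have hconf : √(quad V (u - θ)) ≤ P.ρ * b + s := by
    have h1 := P.sqrt_quad_estimate_sub_le hG hreg hΛ hρ hσ hfeat t hθ
    have h2 := P.rho_mul_sqrtBeta (R := R) (S := S) (N := N) (e := e) hρ t
    have h3 : 0 ≤ ((t + 1 : ℕ) : ℝ) * P.B * P.ε / √P.Lam := by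
      have := P.ε_nonneg
      positivity
    have h4 := mul_le_mul_of_nonneg_left hr (Real.sqrt_nonneg (3 * P.Lam + P.reg))
    rw [h2]
    refine h1.trans ?_
    rw [hs]
    linarith
  have hcs : ∀ z : P.Idx → ℝ, |(u - θ) ⬝ᵥ z| ≤ (P.ρ * b + s) * √(quad V⁻¹ z) := by
    intro z
    have h1 := abs_dotProduct_mulVec_le hVp.posSemidef (u - θ) (V⁻¹ *ᵥ z)
    rw [mulVec_inv_mulVec hVp, quad_inv_mulVec hVp] at h1
    exact h1.trans (mul_le_mul_of_nonneg_right hconf (Real.sqrt_nonneg _))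
  have hle1 : ∀ z : Cube d, √(quad V⁻¹ (P.feat z)) ≤ 1 := by
    intro z
    rw [Real.sqrt_le_left zero_le_one, one_pow]
    refine (quad_inv_le_div hVp hc (P.le_quad_runV hG.1 t) _).trans ?_
    rw [div_le_one hc]
    exact (hfeat _).trans (by linarith)
  have hucb : P.ucb u V b x ≤ P.ucb u V b (P.actionAt R S N e t) :=
    R.pick_max (S t).decisionSet u V b x hx
  have hucb' : u ⬝ᵥ P.feat x + b * (P.ρ * y) ≤ u ⬝ᵥ P.runFeat R S N e t + b * (P.ρ * w) := hucb
  have h1 := (abs_le.mp (hcs (P.feat x))).1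
  have h2 := (abs_le.mp (hcs (P.runFeat R S N e t))).2
  rw [sub_dotProduct] at h1 h2
  have h3 := (abs_le.mp hθx).2
  have h4 := (abs_le.mp (hθ t)).1
  have hy1 : s * y ≤ s := mul_le_of_le_one_right hs0 (hle1 x)
  have hw1 : s * w ≤ s := mul_le_of_le_one_right hs0 (hle1 _)
  have hww : w ≤ √(quad (P.runDesign R S N e t)⁻¹ (P.runFeat R S N e t)) :=
    Real.sqrt_le_sqrt (quad_inv_le_quad_inv hVp (posDef_design hc (P.runFeat R S N e) t)
      (P.quad_runDesign_le_quad_runV hG.1 t) _)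
  have hρb := P.rho_mul_sqrtBeta_le hG hreg hΛ hρ hB hfeat t
  have h5 : P.ρ * b * w ≤
      P.widthBound * √(quad (P.runDesign R S N e t)⁻¹ (P.runFeat R S N e t)) := by
    have hw0 : 0 ≤ w := Real.sqrt_nonneg _
    have hρb0 : 0 ≤ P.ρ * b := by
      rw [P.rho_mul_sqrtBeta hρ t]
      have := P.ε_nonneg
      have : 0 ≤ P.κ := by unfold κ; positivity
      positivity
    exact mul_le_mul hρb hww hw0 (hρb0.trans hρb)
  simp only [add_mul] at h1 h2
  nlinarith

/-- For every round and competitor the surrogate is fitted to the `T` played points and the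
competitor, whence the `T + 1`. It depends on the whole run, which is harmless because the
confidence bound holds on the good event for all `θ` at once. The widths are then summed by
Cauchy–Schwarz and compared with the information gain. -/
theorem regret_le_of_goodRun {H : Type*} [NormedAddCommGroup H]
    [InnerProductSpace ℝ H] [CompleteSpace H] [RKHS ℝ H (Cube d) ℝ]
    (hH : ∀ x y : Cube d, RKHS.kernel H x y 1 = P.k x y)
    (hk : IsDecomposable P.k (gaussianSpectrum P.a P.ν)) (hd : 0 < d)
    (ha : ∀ j, 0 < P.a j) (hν : ∀ j, 0 < P.ν j) (hT : 2 ≤ P.T)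
    (hG : P.GoodRun R S N e) (hreg : 0 < P.reg) (hΛ : 1 ≤ P.Lam)
    (hρ : 0 < P.ρ) (hσ : 0 ≤ P.σ) (hB : 0 ≤ P.B)
    {f : H} (hf : ‖f‖ ≤ P.B) (hS : ∀ i x, (S i).meanReward x = f x) {μ : ℝ} (hμ : 0 < μ) :
    P.regret R S f (N, e) ≤
      2 * P.widthBound * √(P.T * (2 * (P.T * (P.T * P.ε) + 2 * maxInfoGain P.k P.ρ P.T))) +
      P.T * (2 * (√(3 * P.Lam + P.reg) * (P.B * (P.ε * (P.T + 1) / μ)) +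
        P.T * (P.B * (√μ + P.ε * (P.T + 1) / √μ))) + 2 * (P.B * (√μ + P.ε * (P.T + 1) / √μ))) := by
  have hfeat := P.feat_dotProduct_self_le hk ha hν hT
  have hε0 := P.ε_nonneg
  have hε : ∀ x y : Cube d, |P.k x y - P.feat x ⬝ᵥ P.feat y| ≤ P.ε := fun x y =>
    le_ciSup (P.bddAbove_kernel_sub_feat hk ha hν hT) (x, y)
  have hκ : 0 ≤ P.κ := by unfold κ; positivity
  have hwb : 0 ≤ P.widthBound := by unfold widthBound; positivity
  set δ := P.B * (√μ + P.ε * (P.T + 1) / √μ) with hδ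
  set r := P.B * (P.ε * (P.T + 1) / μ) with hr
  have hr0 : 0 ≤ r := by positivity
  set w : Fin P.T → ℝ := fun t => quad (P.runDesign R S N e t)⁻¹ (P.runFeat R S N e t) with hw
  set c := 2 * (√(3 * P.Lam + P.reg) * r + P.T * δ) + 2 * δ with hc
  have hround : ∀ t : Fin P.T, sSup (f '' ((S t).decisionSet : Set (Cube d))) -
      f (P.actions R S (N, e) t) ≤ 2 * P.widthBound * √(w t) + c := by
    intro t
    rw [P.actions_eq_actionAt, sub_le_iff_le_add]
    refine csSup_le ((S t).decisionSet.nonempty.image _) ?_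
    rintro _ ⟨x, hx, rfl⟩
    obtain ⟨θ, hθ1, hθ2⟩ := exists_approx hH hε hf
      (fun i : Option (Fin P.T) => i.elim x (P.actionAt R S N e)) hμ
    rw [Fintype.card_option, Fintype.card_fin, Nat.cast_add, Nat.cast_one] at hθ1 hθ2
    have hθr : √(θ ⬝ᵥ θ) ≤ P.B + r := by
      rw [Real.sqrt_le_left (by positivity)]
      refine hθ1.trans ?_
      set z := P.ε * (P.T + 1) / μ with hz
      have hz0 : 0 ≤ z := by positivity
      rw [hr, ← mul_one_add, mul_pow]
      refine mul_le_mul_of_nonneg_left ?_ (sq_nonneg _)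
      nlinarith
    have := P.round_regret_le hG hreg hΛ hρ hσ hB hfeat t hx (θ := θ) (δ := δ) (r := r)
      (fun i => by rw [hS]; exact hθ2 (some i)) (by rw [hS]; exact hθ2 none) hr0 hθr
    rw [hS, hS] at this
    simp only
    linarith
  have hw0 : ∀ t, 0 ≤ w t := fun t =>
    quad_nonneg (posDef_design (by linarith) (P.runFeat R S N e) t).inv.posSemidef _
  have hsum : ∑ t, w t ≤ 2 * (P.T * (P.T * P.ε) + 2 * maxInfoGain P.k P.ρ P.T) := by
    refine (sum_quad_inv_design_le (c := P.reg + P.Lam) (by linarith)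
      (φ := P.runFeat R S N e) fun i => hfeat _).trans ?_
    refine mul_le_mul_of_nonneg_left ?_ zero_le_two
    have h1 := det_design_div_le (c := P.reg + P.Lam) (by linarith) (P.runFeat R S N e)
    have hpos : ∀ t, 0 < (design (P.reg + P.Lam) (P.runFeat R S N e) t).det := fun t =>
      (posDef_design (by linarith) _ t).det_pos
    refine (Real.log_le_log (div_pos (hpos _) (hpos _)) h1).trans ?_
    have hKp := posSemidef_kernelMatrix hH (P.actionAt R S N e)
    have hGp : (Matrix.of fun i j => P.runFeat R S N e i ⬝ᵥ P.runFeat R S N e j :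
        Matrix (Fin P.T) (Fin P.T) ℝ).PosSemidef := by
      have := posSemidef_self_mul_conjTranspose (Matrix.of (P.runFeat R S N e))
      rw [conjTranspose_eq_transpose_of_trivial] at this
      convert this using 1
      ext i j
      simp [Matrix.mul_apply, dotProduct]
    refine (log_det_one_add_le_of_entries hGp hKp hε0 fun i j => ?_).trans ?_
    · rw [abs_sub_comm]; exact hε _ _
    · have := log_det_le_maxInfoGain (k := P.k) (fun {ι} _ x => by
        classical exact posSemidef_kernelMatrix hH x) (fun x y => hk.le_one x y) hd
        (hk.continuous hν) hρ (P.actionAt R S N e)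
      linarith
  have hcs : ∑ t, √(w t) ≤ √(P.T * ∑ t, w t) := by
    refine Real.le_sqrt_of_sq_le ?_
    have := sq_sum_le_card_mul_sum_sq (s := (Finset.univ : Finset (Fin P.T))) (f := fun t => √(w t))
    simp only [Real.sq_sqrt (hw0 _), Finset.card_univ, Fintype.card_fin] at this
    exact this
  calc P.regret R S f (N, e) ≤ ∑ t, (2 * P.widthBound * √(w t) + c) :=
        Finset.sum_le_sum fun t _ => hround t
    _ = 2 * P.widthBound * ∑ t, √(w t) + P.T * c := by
        rw [Finset.sum_add_distrib, ← Finset.mul_sum]; simp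
    _ ≤ _ := by
        have h3 : ∑ t, √(w t) ≤
            √(P.T * (2 * (P.T * (P.T * P.ε) + 2 * maxInfoGain P.k P.ρ P.T))) :=
          hcs.trans (Real.sqrt_le_sqrt (mul_le_mul_of_nonneg_left hsum (Nat.cast_nonneg _)))
        have := mul_le_mul_of_nonneg_left h3 (mul_nonneg zero_le_two hwb)
        linarith

end Params
end PrivateGPBandit

end

noncomputable section
namespace PrivateGPBandit
set_option linter.unusedSectionVars false
open Matrix
open scoped ENNReal

/-! ### Rates -/

/-- The factor `(log T)^{(d+2)/4} (α⁻¹ log(1/β) log(1/ζ))^{1/2}` of the regret bound. -/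
def privateRate (d T : ℕ) (α β ζ : ℝ) : ℝ :=
  Real.log T ^ (((d : ℝ) + 2) / 4) *
    (1 / α * Real.log (1 / β) * Real.log (1 / ζ)) ^ ((1 : ℝ) / 2)

/-- The factor `(log T)^{(d+1)/2}` of the regret bound. -/
def nonprivateRate (d T : ℕ) : ℝ := Real.log T ^ (((d : ℝ) + 1) / 2)

theorem privateRate_sq {d T : ℕ} {α β ζ : ℝ} (hT : 1 ≤ T) (hα : 0 < α) (hβ : 0 ≤ Real.log (1 / β))
    (hζ : 0 ≤ Real.log (1 / ζ)) : privateRate d T α β ζ ^ 2 =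
      Real.log T * √(Real.log T ^ d) * (1 / α * Real.log (1 / β) * Real.log (1 / ζ)) := by
  have hL : 0 ≤ Real.log T := Real.log_nonneg (by exact_mod_cast hT)
  have h0 : 0 ≤ 1 / α * Real.log (1 / β) * Real.log (1 / ζ) := by positivity
  rw [privateRate, mul_pow]
  congr 1
  · rw [Real.sqrt_eq_rpow, ← Real.rpow_natCast (Real.log T) d, ← Real.rpow_mul hL,
      ← Real.rpow_natCast, ← Real.rpow_mul hL]
    nth_rewrite 2 [← Real.rpow_one (Real.log T)]
    rw [← Real.rpow_add_of_nonneg hL zero_le_one (by positivity)]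
    congr 1
    push_cast
    ring
  · rw [← Real.sqrt_eq_rpow, Real.sq_sqrt h0]

theorem nonprivateRate_sq {d T : ℕ} (hT : 1 ≤ T) :
    nonprivateRate d T ^ 2 = Real.log T ^ (d + 1) := by
  have hL : 0 ≤ Real.log T := Real.log_nonneg (by exact_mod_cast hT)
  rw [nonprivateRate, ← Real.rpow_natCast, ← Real.rpow_natCast, ← Real.rpow_mul hL]
  congr 1
  push_cast
  ring

theorem privateRate_nonneg {d T : ℕ} {α β ζ : ℝ} (hT : 1 ≤ T) (hα : 0 < α)
    (hβ : 0 ≤ Real.log (1 / β)) (hζ : 0 ≤ Real.log (1 / ζ)) : 0 ≤ privateRate d T α β ζ := by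
  have hL : 0 ≤ Real.log T := Real.log_nonneg (by exact_mod_cast hT)
  exact mul_nonneg (Real.rpow_nonneg hL _) (Real.rpow_nonneg (by positivity) _)

theorem nonprivateRate_nonneg {d T : ℕ} (hT : 1 ≤ T) : 0 ≤ nonprivateRate d T :=
  Real.rpow_nonneg (Real.log_nonneg (by exact_mod_cast hT)) _

theorem log_two_le_log {T : ℕ} (hT : 2 ≤ T) : Real.log 2 ≤ Real.log T :=
  Real.log_le_log two_pos (by exact_mod_cast hT)

theorem clog_succ_le {T : ℕ} (hT : 2 ≤ T) :
    ((1 + Nat.clog 2 T : ℕ) : ℝ) ≤ 3 / Real.log 2 * Real.log T := by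
  have h2 : 0 < Real.log 2 := Real.log_pos one_lt_two
  have hL := log_two_le_log hT
  have h1 : (Nat.clog 2 T : ℝ) ≤ Real.log T / Real.log 2 + 1 := by
    have h3 : Nat.clog 2 T = ⌈Real.logb 2 T⌉₊ := by
      have := Real.natCeil_logb_natCast 2 T
      exact_mod_cast this.symm
    rw [h3]
    have h4 : 0 ≤ Real.logb 2 T := Real.logb_nonneg one_lt_two (by exact_mod_cast (by omega : 1 ≤ T))
    have := (Nat.ceil_lt_add_one h4).le
    rwa [Real.logb] at this
  have h5 : 1 ≤ Real.log T / Real.log 2 := by rw [le_div_iff₀ h2]; linarith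
  push_cast
  have : 3 / Real.log 2 * Real.log T = 3 * (Real.log T / Real.log 2) := by ring
  rw [this]
  linarith

/-- Used to absorb numerical constants: `log(1/β)` is bounded away from zero by `l`, so `log 10` is
a multiple of it. -/
theorem log_div_le {c β l : ℝ} (hc : 1 ≤ c) (hc' : c ≤ 10) (hβ : 0 < β) (hl : 0 < l)
    (h : l ≤ Real.log (1 / β)) : Real.log (c / β) ≤ (Real.log 10 / l + 1) * Real.log (1 / β) := by
  have h1 : Real.log (c / β) = Real.log c + Real.log (1 / β) := by
    rw [← Real.log_mul (by positivity) (by positivity)]; congr 1; ring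
  have h2 : Real.log c ≤ Real.log 10 := Real.log_le_log (by linarith) hc'
  have h3 : Real.log 10 ≤ Real.log 10 / l * Real.log (1 / β) := by
    rw [div_mul_eq_mul_div, le_div_iff₀ hl]
    exact mul_le_mul_of_nonneg_left h (Real.log_nonneg (by norm_num))
  rw [h1]
  linarith

theorem log_two_mul_div_le {T : ℕ} (hT : 2 ≤ T) {ζ l : ℝ} (hζ : 0 < ζ) (hl : 0 < l)
    (h : l ≤ Real.log (1 / ζ)) : Real.log (2 * T / ζ) ≤
      (2 / l + 1 / Real.log 2) * (Real.log T * Real.log (1 / ζ)) := by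
  have h2 : 0 < Real.log 2 := Real.log_pos one_lt_two
  have hL := log_two_le_log hT
  have hT0 : (0 : ℝ) < T := by exact_mod_cast (by omega : 0 < T)
  have h1 : Real.log (2 * T / ζ) = Real.log 2 + Real.log T + Real.log (1 / ζ) := by
    rw [← Real.log_mul (by positivity) (by positivity), ← Real.log_mul (by positivity)
      (by positivity)]
    congr 1; ring
  set L := Real.log T
  set Z := Real.log (1 / ζ)
  have h3 : 2 * L ≤ 2 / l * (L * Z) := by
    rw [div_mul_eq_mul_div, le_div_iff₀ hl]
    have := mul_le_mul_of_nonneg_left h (by linarith : 0 ≤ L)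
    linarith
  have h4 : Z ≤ 1 / Real.log 2 * (L * Z) := by
    rw [div_mul_eq_mul_div, le_div_iff₀ h2]
    have := mul_le_mul_of_nonneg_right hL (by linarith : 0 ≤ Z)
    linarith
  rw [h1, add_mul]
  linarith

namespace Params

variable {d : ℕ} (P : Params d)

theorem order_le (hT : 2 ≤ P.T) : (P.order : ℝ) ≤ (6 + 1 / Real.log 2) * Real.log P.T := by
  have h2 : 0 < Real.log 2 := Real.log_pos one_lt_two
  have hL := log_two_le_log hT
  have h1 := (Nat.ceil_lt_add_one (a := 6 * Real.log P.T) (by linarith)).le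
  have h5 : 1 ≤ 1 / Real.log 2 * Real.log P.T := by
    rw [div_mul_eq_mul_div, le_div_iff₀ h2]; linarith
  rw [order, add_mul]
  linarith

theorem m_le (hT : 2 ≤ P.T) :
    (P.m : ℝ) ≤ 2 * (6 + 1 / Real.log 2) ^ d * Real.log P.T ^ d := by
  rw [m]
  push_cast
  rw [mul_assoc, ← mul_pow]
  have := P.order_le hT
  gcongr

/-- The vector noise is dominated by the matrix noise: `Λ` contains every term of `κ √Λ` with a
larger coefficient. -/
theorem kappa_le (hσ : 0 ≤ P.σ) (hΛ : 0 < P.Lam) : P.κ ≤ √P.Lam := by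
  have h1 : P.σ * √P.depth * (√P.m + √(2 * Real.log (2 * P.T / P.ζ))) ≤ P.Lam := by
    rw [Lam, Real.sqrt_mul zero_le_two (P.depth : ℝ)]
    have h2 : (1 : ℝ) ≤ √2 := Real.one_le_sqrt.mpr one_le_two
    set s := P.σ * √P.depth with hs
    set y := √(2 * Real.log (2 * P.T / P.ζ)) with hy
    have hy0 : 0 ≤ y := Real.sqrt_nonneg _
    have hs0 : 0 ≤ s := by positivity
    have hm0 : 0 ≤ √(P.m : ℝ) := Real.sqrt_nonneg _
    calc s * (√P.m + y) ≤ s * (√2 * (4 * √P.m + 2 * y)) := by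
          refine mul_le_mul_of_nonneg_left ?_ hs0
          nlinarith
      _ = _ := by rw [hs]; ring
  rw [κ, Real.sqrt_div (Nat.cast_nonneg _)]
  have h3 : 0 < √P.Lam := Real.sqrt_pos.mpr hΛ
  calc P.σ * (√P.depth / √P.Lam) * (√P.m + √(2 * Real.log (2 * P.T / P.ζ)))
      = P.σ * √P.depth * (√P.m + √(2 * Real.log (2 * P.T / P.ζ))) / √P.Lam := by ring
    _ ≤ P.Lam / √P.Lam := by gcongr
    _ = √P.Lam := Real.div_sqrt

end Params

/-! ### Sizes of the privacy noise and of the confidence width. -/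

theorem privacyScale_ge_one {T : ℕ} {B ρ α β : ℝ} (hα : 0 < α) (hα1 : α ≤ 1)
    (hβ : 0 < β) (hβ1 : β < 1) : 1 ≤ privacyScale T B ρ α β := by
  have h1 : 1 ≤ Real.log (10 / β) := by
    rw [Real.le_log_iff_exp_le (by positivity)]
    have := Real.exp_one_lt_d9
    rw [le_div_iff₀ hβ]
    nlinarith
  have h2 : 0 ≤ Real.log (8 / β) := Real.log_nonneg (by rw [le_div_iff₀ hβ]; linarith)
  have h3 : (1 : ℝ) ≤ (1 + Nat.clog 2 T : ℕ) := by exact_mod_cast Nat.le_add_right 1 _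
  have h4 : 1 ≤ 1 + B ^ 2 + 2 * ρ ^ 2 * Real.log (8 / β) := by
    have : 0 ≤ B ^ 2 + 2 * ρ ^ 2 * Real.log (8 / β) := by positivity
    linarith
  rw [privacyScale, le_div_iff₀ hα]
  have h5 : 1 ≤ √(((1 + Nat.clog 2 T : ℕ) : ℝ) * (1 + B ^ 2 + 2 * ρ ^ 2 * Real.log (8 / β)) *
      Real.log (10 / β)) := by
    rw [Real.one_le_sqrt]
    exact one_le_mul_of_one_le_of_one_le (one_le_mul_of_one_le_of_one_le h3 h4) h1
  linarith

theorem privacyScale_le {T : ℕ} (hT : 2 ≤ T) {B ρ α β l : ℝ} (hα : 0 < α)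
    (hβ : 0 < β) (hl : 0 < l) (h : l ≤ Real.log (1 / β)) :
    privacyScale T B ρ α β ≤ 4 * √(3 / Real.log 2 *
      ((1 + B ^ 2) / l + 2 * ρ ^ 2 * (Real.log 10 / l + 1)) * (Real.log 10 / l + 1)) *
      (√(Real.log T) * (Real.log (1 / β) / α)) := by
  set b := Real.log (1 / β) with hb
  have hb0 : 0 < b := hl.trans_le h
  have h2 : 0 < Real.log 2 := Real.log_pos one_lt_two
  have h10 : 0 < Real.log 10 := Real.log_pos (by norm_num)
  have hL : 0 < Real.log T := h2.trans_le (log_two_le_log hT)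
  set Q := Real.log 10 / l + 1 with hQ
  have hQ0 : 0 < Q := by positivity
  have h8 := log_div_le (c := 8) (by norm_num) (by norm_num) hβ hl h
  have h9 := log_div_le (c := 10) (by norm_num) (by norm_num) hβ hl h
  have hdep := clog_succ_le hT
  rw [← hb, ← hQ] at h8 h9
  have h4 : 1 + B ^ 2 + 2 * ρ ^ 2 * Real.log (8 / β) ≤
      ((1 + B ^ 2) / l + 2 * ρ ^ 2 * Q) * b := by
    have h5 : 1 + B ^ 2 ≤ (1 + B ^ 2) / l * b := by
      rw [div_mul_eq_mul_div, le_div_iff₀ hl]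
      exact mul_le_mul_of_nonneg_left h (by positivity)
    have h6 := mul_le_mul_of_nonneg_left h8 (by positivity : 0 ≤ 2 * ρ ^ 2)
    rw [add_mul]
    linarith
  have hβ1 : β ≤ 1 := by
    by_contra hcon
    have : Real.log (1 / β) < 0 := Real.log_neg (by positivity) (by
      rw [div_lt_one hβ]; exact not_le.mp hcon)
    linarith
  have h80 : 0 ≤ Real.log (8 / β) := Real.log_nonneg (by rw [le_div_iff₀ hβ]; linarith)
  have h90 : 0 ≤ Real.log (10 / β) := Real.log_nonneg (by rw [le_div_iff₀ hβ]; linarith)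
  have hprod : ((1 + Nat.clog 2 T : ℕ) : ℝ) * (1 + B ^ 2 + 2 * ρ ^ 2 * Real.log (8 / β)) *
      Real.log (10 / β) ≤ 3 / Real.log 2 * ((1 + B ^ 2) / l + 2 * ρ ^ 2 * Q) * Q *
        (Real.log T * b ^ 2) := by
    calc _ ≤ (3 / Real.log 2 * Real.log T) * (((1 + B ^ 2) / l + 2 * ρ ^ 2 * Q) * b) * (Q * b) := by
          refine mul_le_mul (mul_le_mul hdep h4 (by positivity) (by positivity)) h9 h90
            (by positivity)
      _ = _ := by ring
  have hs := Real.sqrt_le_sqrt hprod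
  rw [Real.sqrt_mul (x := 3 / Real.log 2 * ((1 + B ^ 2) / l + 2 * ρ ^ 2 * Q) * Q) (by positivity),
    Real.sqrt_mul hL.le, Real.sqrt_sq hb0.le] at hs
  rw [privacyScale, div_le_iff₀ hα]
  calc _ ≤ 4 * (√(3 / Real.log 2 * ((1 + B ^ 2) / l + 2 * ρ ^ 2 * Q) * Q) *
        (√(Real.log T) * b)) := mul_le_mul_of_nonneg_left hs (by norm_num)
    _ = _ := by field_simp

/-- The scale of the tree noise is bounded by the square of the private rate. -/
theorem exists_Lam_le {d : ℕ} (hd : 0 < d) (k : (Fin d → ℝ) → (Fin d → ℝ) → ℝ) (a ν : Fin d → ℝ)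
    (B ρ reg : ℝ) {l : ℝ} (hl : 0 < l) :
    ∃ C : ℝ, 0 < C ∧ ∀ (T : ℕ) (α β ζ : ℝ), 2 ≤ T → 0 < α → 0 < β → 0 < ζ →
      l ≤ Real.log (1 / β) → l ≤ Real.log (1 / ζ) →
      (Params.mk T k a ν B ρ reg (privacyScale T B ρ α β) ζ).Lam ≤
        C * privateRate d T α β ζ ^ 2 := by
  have h2 : 0 < Real.log 2 := Real.log_pos one_lt_two
  set c1 := 4 * √(3 / Real.log 2 *
      ((1 + B ^ 2) / l + 2 * ρ ^ 2 * (Real.log 10 / l + 1)) * (Real.log 10 / l + 1)) with hc1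
  set c2 := √(2 * (3 / Real.log 2)) with hc2
  set c3 := 2 * (6 + 1 / Real.log 2) ^ d / l ^ 2 with hc3
  set c4 := (2 / l + 1 / Real.log 2) / Real.log 2 ^ (d - 1) / l with hc4
  have hc3' : 0 < c3 := by positivity
  have hc4' : 0 < c4 := by positivity
  refine ⟨c1 * c2 * (4 * √c3 + 2 * √(2 * c4)) + 1, by positivity, ?_⟩
  intro T α β ζ hT hα hβ hζ hb hz
  set P := Params.mk T k a ν B ρ reg (privacyScale T B ρ α β) ζ with hP
  set L := Real.log T with hLdef
  have hL2 : Real.log 2 ≤ L := log_two_le_log hT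
  have hL : 0 < L := h2.trans_le hL2
  set b := Real.log (1 / β) with hbdef
  set Z := Real.log (1 / ζ) with hZdef
  have hb0 : 0 < b := hl.trans_le hb
  have hZ0 : 0 < Z := hl.trans_le hz
  have hσ : P.σ ≤ c1 * (√L * (b / α)) := privacyScale_le hT hα hβ hl hb
  have hdep : √(2 * (P.depth : ℝ)) ≤ c2 * √L := by
    rw [hc2, ← Real.sqrt_mul (by positivity)]
    refine Real.sqrt_le_sqrt ?_
    have := clog_succ_le hT
    have h3 : (P.depth : ℝ) = ((1 + Nat.clog 2 T : ℕ) : ℝ) := rfl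
    rw [h3]
    linarith
  -- The squared rate carries `log(1/ζ)` as a factor, whereas `√m` is free of `ζ`. The bound `Z ≥ l`
  -- supplies the missing factor at the price of `1/l`.
  have hZl : 1 ≤ Z ^ 2 / l ^ 2 := by
    rw [one_le_div (by positivity)]
    exact pow_le_pow_left₀ hl.le hz 2
  have hm : √(P.m : ℝ) ≤ √c3 * (√(L ^ d) * Z) := by
    have h3 : (P.m : ℝ) ≤ c3 * (L ^ d * Z ^ 2) := by
      have h4 : (P.m : ℝ) ≤ 2 * (6 + 1 / Real.log 2) ^ d * L ^ d := P.m_le hT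
      calc (P.m : ℝ) ≤ 2 * (6 + 1 / Real.log 2) ^ d * L ^ d * 1 := by linarith
        _ ≤ 2 * (6 + 1 / Real.log 2) ^ d * L ^ d * (Z ^ 2 / l ^ 2) :=
            mul_le_mul_of_nonneg_left hZl (by positivity)
        _ = c3 * (L ^ d * Z ^ 2) := by rw [hc3]; ring
    refine (Real.sqrt_le_sqrt h3).trans (le_of_eq ?_)
    rw [Real.sqrt_mul hc3'.le, Real.sqrt_mul (by positivity), Real.sqrt_sq hZ0.le]
  have hx : √(2 * Real.log (2 * T / ζ)) ≤ √(2 * c4) * (√(L ^ d) * Z) := by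
    have h3 : Real.log (2 * T / ζ) ≤ c4 * (L ^ d * Z ^ 2) := by
      have h4 := log_two_mul_div_le hT hζ hl hz
      have h5 : Real.log 2 ^ (d - 1) * L ≤ L ^ d := by
        calc Real.log 2 ^ (d - 1) * L ≤ L ^ (d - 1) * L := by gcongr
          _ = L ^ d := by rw [← pow_succ, Nat.sub_add_cancel hd]
      have h6 : l * Z ≤ Z ^ 2 := by nlinarith
      have h7 : Real.log 2 ^ (d - 1) * L * (l * Z) ≤ L ^ d * Z ^ 2 :=
        mul_le_mul h5 h6 (by positivity) (by positivity)
      refine h4.trans ?_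
      rw [← hLdef, ← hZdef, hc4]
      calc (2 / l + 1 / Real.log 2) * (L * Z)
          = (2 / l + 1 / Real.log 2) / Real.log 2 ^ (d - 1) / l *
            (Real.log 2 ^ (d - 1) * L * (l * Z)) := by field_simp
        _ ≤ _ := mul_le_mul_of_nonneg_left h7 (by positivity)
    refine (Real.sqrt_le_sqrt (mul_le_mul_of_nonneg_left h3 zero_le_two)).trans (le_of_eq ?_)
    rw [← mul_assoc, Real.sqrt_mul (x := 2 * c4) (by positivity),
      Real.sqrt_mul (x := L ^ d) (by positivity), Real.sqrt_sq hZ0.le]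
  have hσ0 : 0 ≤ P.σ := by
    change 0 ≤ privacyScale T B ρ α β
    unfold privacyScale
    positivity
  have hLam : P.Lam ≤ c1 * (√L * (b / α)) * (c2 * √L) *
      (4 * (√c3 * (√(L ^ d) * Z)) + 2 * (√(2 * c4) * (√(L ^ d) * Z))) := by
    rw [Params.Lam]
    have hc10 : 0 ≤ c1 := by positivity
    refine mul_le_mul (mul_le_mul hσ hdep (Real.sqrt_nonneg _) (by positivity)) ?_ (by positivity)
      (by positivity)
    exact add_le_add (mul_le_mul_of_nonneg_left hm (by norm_num))
      (mul_le_mul_of_nonneg_left hx (by norm_num))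
  rw [privateRate_sq (by omega) hα hb0.le hZ0.le]
  refine hLam.trans ?_
  have hLL : √L * √L = L := Real.mul_self_sqrt hL.le
  calc c1 * (√L * (b / α)) * (c2 * √L) *
      (4 * (√c3 * (√(L ^ d) * Z)) + 2 * (√(2 * c4) * (√(L ^ d) * Z)))
      = c1 * c2 * (4 * √c3 + 2 * √(2 * c4)) * ((√L * √L) * √(L ^ d) * (1 / α * b * Z)) := by ring
    _ ≤ (c1 * c2 * (4 * √c3 + 2 * √(2 * c4)) + 1) * ((√L * √L) * √(L ^ d) * (1 / α * b * Z)) := by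
        refine mul_le_mul_of_nonneg_right (by linarith) (by positivity)
    _ = _ := by rw [hLL]

/-- `m log(T+3)` is of order `(log T)^{d+1}`, the square of the nonprivate rate. The term `log(2/ζ)`
is charged to the private rate instead, using `α ≤ 1` and the lower bounds for `log(1/β)` and `log
T`. -/
theorem exists_sqrt_le_rate (d : ℕ) (k : (Fin d → ℝ) → (Fin d → ℝ) → ℝ) (a ν : Fin d → ℝ)
    (B ρ reg : ℝ) {l : ℝ} (hl : 0 < l) :
    ∃ C : ℝ, 0 < C ∧ ∀ (T : ℕ) (σ α β ζ : ℝ), 2 ≤ T → 0 < α → α ≤ 1 → 0 < β → 0 < ζ →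
      l ≤ Real.log (1 / β) → l ≤ Real.log (1 / ζ) →
      √((Params.mk T k a ν B ρ reg σ ζ).m * Real.log (T + 3) + 2 * Real.log (2 / ζ)) ≤
        C * (privateRate d T α β ζ + nonprivateRate d T) := by
  have h2 : 0 < Real.log 2 := Real.log_pos one_lt_two
  have h10 : 0 < Real.log 10 := Real.log_pos (by norm_num)
  set c1 := 6 * (6 + 1 / Real.log 2) ^ d with hc1
  set c2 := 2 * (Real.log 10 / l + 1) / (Real.log 2 * √(Real.log 2 ^ d) * l) with hc2
  have hc10 : 0 < c1 := by positivity
  have hc20 : 0 < c2 := by positivity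
  refine ⟨√c1 + √c2, by positivity, ?_⟩
  intro T σ α β ζ hT hα hα1 hβ hζ hb hz
  set L := Real.log T with hLdef
  have hL2 : Real.log 2 ≤ L := log_two_le_log hT
  have hL : 0 < L := h2.trans_le hL2
  have hb0 := hl.trans_le hb
  have hZ0 := hl.trans_le hz
  set U := privateRate d T α β ζ with hU
  set W := nonprivateRate d T with hW
  have hU0 : 0 ≤ U := privateRate_nonneg (by omega) hα hb0.le hZ0.le
  have hW0 : 0 ≤ W := nonprivateRate_nonneg (by omega)
  have hU2 : U ^ 2 = L * √(L ^ d) * (1 / α * Real.log (1 / β) * Real.log (1 / ζ)) :=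
    privateRate_sq (by omega) hα hb0.le hZ0.le
  have hW2 : W ^ 2 = L ^ (d + 1) := nonprivateRate_sq (by omega)
  have hT' : (2 : ℝ) ≤ T := by exact_mod_cast hT
  have h1 : ((Params.mk T k a ν B ρ reg σ ζ).m : ℝ) * Real.log (T + 3) ≤ c1 * W ^ 2 := by
    have h3 : Real.log (T + 3) ≤ 3 * L := by
      have : (3 : ℝ) * L = Real.log (T ^ 3) := by rw [Real.log_pow]; norm_num [hLdef]
      rw [this]
      exact Real.log_le_log (by linarith) (by nlinarith [sq_nonneg ((T : ℝ) - 2)])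
    have h4 : ((Params.mk T k a ν B ρ reg σ ζ).m : ℝ) ≤
        2 * (6 + 1 / Real.log 2) ^ d * L ^ d := Params.m_le _ hT
    have h5 : 0 ≤ Real.log ((T : ℝ) + 3) := Real.log_nonneg (by linarith)
    calc _ ≤ 2 * (6 + 1 / Real.log 2) ^ d * L ^ d * (3 * L) :=
          mul_le_mul h4 h3 h5 (by positivity)
      _ = c1 * W ^ 2 := by rw [hW2, hc1]; ring
  have h3 : 2 * Real.log (2 / ζ) ≤ c2 * U ^ 2 := by
    have h4 := log_div_le (c := 2) (by norm_num) (by norm_num) hζ hl hz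
    have h5 : Real.log 2 * √(Real.log 2 ^ d) * l * Real.log (1 / ζ) ≤ U ^ 2 := by
      rw [hU2]
      have h6 : l ≤ 1 / α * Real.log (1 / β) := by
        have : 1 ≤ 1 / α := by rw [le_div_iff₀ hα]; linarith
        nlinarith
      have h7 : Real.log 2 * √(Real.log 2 ^ d) ≤ L * √(L ^ d) := by gcongr
      have := mul_le_mul h7 (mul_le_mul_of_nonneg_right h6 hZ0.le) (by positivity) (by positivity)
      linarith
    calc 2 * Real.log (2 / ζ) ≤ 2 * ((Real.log 10 / l + 1) * Real.log (1 / ζ)) := by linarith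
      _ = c2 * (Real.log 2 * √(Real.log 2 ^ d) * l * Real.log (1 / ζ)) := by
          rw [hc2]; field_simp
      _ ≤ c2 * U ^ 2 := mul_le_mul_of_nonneg_left h5 hc20.le
  calc _ ≤ √(c1 * W ^ 2 + c2 * U ^ 2) := Real.sqrt_le_sqrt (add_le_add h1 h3)
    _ ≤ √(c1 * W ^ 2) + √(c2 * U ^ 2) := by
        rw [Real.sqrt_le_left (by positivity), add_sq, Real.sq_sqrt (by positivity),
          Real.sq_sqrt (by positivity)]
        have : 0 ≤ 2 * √(c1 * W ^ 2) * √(c2 * U ^ 2) := by positivity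
        linarith
    _ = √c1 * W + √c2 * U := by
        rw [Real.sqrt_mul hc10.le, Real.sqrt_mul hc20.le, Real.sqrt_sq hW0, Real.sqrt_sq hU0]
    _ ≤ (√c1 + √c2) * (U + W) := by
        have := mul_nonneg (Real.sqrt_nonneg c1) hU0
        have := mul_nonneg (Real.sqrt_nonneg c2) hW0
        nlinarith

end PrivateGPBandit

end

noncomputable section
namespace PrivateGPBandit
set_option linter.unusedSectionVars false
open Matrix
open scoped ENNReal

/-! ### The regret bound -/

namespace Params

variable {d : ℕ} (P : Params d)

/-- Since `T ε ≤ E` and `Λ ≥ 1`, every term except the log-determinant is of order `√Λ`. -/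
theorem widthBound_le (hT : 2 ≤ P.T) (hB : 0 ≤ P.B) (hreg : 0 ≤ P.reg) (hσ : 0 ≤ P.σ)
    (hΛ : 1 ≤ P.Lam) {E : ℝ} (hE : 0 ≤ E) (hε : P.ε ≤ E / (P.T : ℝ) ^ 12) :
    P.widthBound ≤ (P.B * √(3 + P.reg) + P.B * E + 1) * √P.Lam +
      P.ρ * √(P.m * Real.log (P.T + 3) + 2 * Real.log (2 / P.ζ)) := by
  have hT' : (1 : ℝ) ≤ P.T := by exact_mod_cast (by omega : 1 ≤ P.T)
  have hs1 : 1 ≤ √P.Lam := Real.one_le_sqrt.mpr hΛ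
  have h1 : √(3 * P.Lam + P.reg) ≤ √(3 + P.reg) * √P.Lam := by
    rw [← Real.sqrt_mul (by linarith)]
    exact Real.sqrt_le_sqrt (by nlinarith)
  have h2 : P.T * P.B * P.ε / √P.Lam ≤ P.B * E * √P.Lam := by
    have h3 : P.T * P.ε ≤ E := by
      have : (P.T : ℝ) ≤ (P.T : ℝ) ^ 12 := le_self_pow₀ hT' (by norm_num)
      calc P.T * P.ε ≤ P.T * (E / (P.T : ℝ) ^ 12) :=
            mul_le_mul_of_nonneg_left hε (by linarith)
        _ ≤ (P.T : ℝ) ^ 12 * (E / (P.T : ℝ) ^ 12) :=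
            mul_le_mul_of_nonneg_right this (by positivity)
        _ = E := by field_simp
    have h4 := P.ε_nonneg
    calc P.T * P.B * P.ε / √P.Lam ≤ P.T * P.B * P.ε := div_le_self (by positivity) hs1
      _ = P.B * (P.T * P.ε) := by ring
      _ ≤ P.B * E := mul_le_mul_of_nonneg_left h3 hB
      _ ≤ P.B * E * √P.Lam := le_mul_of_one_le_right (by positivity) hs1
  have h5 := P.kappa_le hσ (by linarith)
  have h6 := mul_le_mul_of_nonneg_left h1 hB
  rw [widthBound]
  linarith

/-- Ridge parameter `μ = T⁻⁴`: then `√μ = T⁻²` survives the factor `T²` from misspecification summed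
over rounds, while `ε = O(T⁻¹²)` outweighs the division by `μ`. -/
theorem slack_le (hT : 2 ≤ P.T) (hB : 0 ≤ P.B) (hreg : 0 ≤ P.reg)
    (hΛ : 1 ≤ P.Lam) {E : ℝ} (hE : 0 ≤ E) (hε : P.ε ≤ E / (P.T : ℝ) ^ 12) :
    P.T * (2 * (√(3 * P.Lam + P.reg) * (P.B * (P.ε * (P.T + 1) / ((P.T : ℝ) ^ 4)⁻¹)) +
        P.T * (P.B * (√((P.T : ℝ) ^ 4)⁻¹ + P.ε * (P.T + 1) / √((P.T : ℝ) ^ 4)⁻¹))) +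
        2 * (P.B * (√((P.T : ℝ) ^ 4)⁻¹ + P.ε * (P.T + 1) / √((P.T : ℝ) ^ 4)⁻¹))) ≤
      (4 * E * P.B * √(3 + P.reg) + 4 * P.B * (1 + 2 * E)) * √P.Lam := by
  have hT' : (1 : ℝ) ≤ P.T := by exact_mod_cast (by omega : 1 ≤ P.T)
  set T : ℝ := (P.T : ℝ) with hTdef
  have hT0 : 0 < T := by linarith
  have hs1 : 1 ≤ √P.Lam := Real.one_le_sqrt.mpr hΛ
  have h1 : √(3 * P.Lam + P.reg) ≤ √(3 + P.reg) * √P.Lam := by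
    rw [← Real.sqrt_mul (by linarith)]
    exact Real.sqrt_le_sqrt (by nlinarith)
  have hsq : √(T ^ 4)⁻¹ = (T ^ 2)⁻¹ := by
    rw [Real.sqrt_inv, show T ^ 4 = (T ^ 2) ^ 2 by ring, Real.sqrt_sq (by positivity)]
  rw [hsq, div_inv_eq_mul, div_inv_eq_mul]
  have hε0 := P.ε_nonneg
  have hεT : P.ε * (T + 1) ≤ 2 * E / T ^ 11 := by
    calc P.ε * (T + 1) ≤ E / T ^ 12 * (2 * T) := by
          refine mul_le_mul hε (by linarith) (by linarith) (by positivity)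
      _ = 2 * E / T ^ 11 := by field_simp
  have ha : T * (P.ε * (T + 1) * T ^ 4) ≤ 2 * E := by
    calc T * (P.ε * (T + 1) * T ^ 4) ≤ T * (2 * E / T ^ 11 * T ^ 4) := by gcongr
      _ = 2 * E / T ^ 6 := by field_simp
      _ ≤ 2 * E := div_le_self (by positivity) (one_le_pow₀ hT')
  have hb : T * (T * ((T ^ 2)⁻¹ + P.ε * (T + 1) * T ^ 2)) ≤ 1 + 2 * E := by
    calc T * (T * ((T ^ 2)⁻¹ + P.ε * (T + 1) * T ^ 2))
        ≤ T * (T * ((T ^ 2)⁻¹ + 2 * E / T ^ 11 * T ^ 2)) := by gcongr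
      _ = 1 + 2 * E / T ^ 7 := by field_simp
      _ ≤ 1 + 2 * E := by
          have := div_le_self (by positivity : 0 ≤ 2 * E) (one_le_pow₀ hT' : 1 ≤ T ^ 7)
          linarith
  set y := (T ^ 2)⁻¹ + P.ε * (T + 1) * T ^ 2 with hy
  have hy0 : 0 ≤ y := by positivity
  have hc : T * y ≤ 1 + 2 * E := by
    refine le_trans ?_ hb
    exact le_mul_of_one_le_left (by positivity) hT'
  calc T * (2 * (√(3 * P.Lam + P.reg) * (P.B * (P.ε * (T + 1) * T ^ 4)) + T * (P.B * y)) +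
        2 * (P.B * y))
      = 2 * P.B * √(3 * P.Lam + P.reg) * (T * (P.ε * (T + 1) * T ^ 4)) +
        2 * P.B * (T * (T * y)) + 2 * P.B * (T * y) := by ring
    _ ≤ 2 * P.B * (√(3 + P.reg) * √P.Lam) * (2 * E) + 2 * P.B * (1 + 2 * E) +
        2 * P.B * (1 + 2 * E) := by
        gcongr
    _ = 4 * E * P.B * √(3 + P.reg) * √P.Lam + 4 * P.B * (1 + 2 * E) := by ring
    _ ≤ _ := by
        rw [add_mul]
        have := le_mul_of_one_le_right (by positivity : 0 ≤ 4 * P.B * (1 + 2 * E)) hs1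
        linarith

theorem one_le_Lam (hd : 0 < d) (hT : 2 ≤ P.T) (hσ : 1 ≤ P.σ) : 1 ≤ P.Lam := by
  have h1 : (1 : ℝ) ≤ √(2 * P.depth) := by
    rw [Real.one_le_sqrt, depth]
    push_cast
    have : (0 : ℝ) ≤ Nat.clog 2 P.T := Nat.cast_nonneg _
    linarith
  have h2 : (1 : ℝ) ≤ √P.m := by
    rw [Real.one_le_sqrt]
    have := P.two_mul_order_le_m hd
    have := P.order_pos hT
    exact_mod_cast (by omega : 1 ≤ P.m)
  have h3 : 0 ≤ √(2 * Real.log (2 * P.T / P.ζ)) := Real.sqrt_nonneg _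
  rw [Lam]
  exact one_le_mul_of_one_le_of_one_le (one_le_mul_of_one_le_of_one_le hσ h1) (by linarith)

theorem regret_le_of_ε_le (hd : 0 < d) {H : Type*} [NormedAddCommGroup H]
    [InnerProductSpace ℝ H] [CompleteSpace H] [RKHS ℝ H (Cube d) ℝ]
    (hH : ∀ x y : Cube d, RKHS.kernel H x y 1 = P.k x y)
    (hk : IsDecomposable P.k (gaussianSpectrum P.a P.ν))
    (ha : ∀ j, 0 < P.a j) (hν : ∀ j, 0 < P.ν j) (hT : 2 ≤ P.T)
    {R : P.ArgmaxRule} {S : Fin P.T → User d} {N : P.TreeNoise} {e : Fin P.T → ℝ}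
    (hG : P.GoodRun R S N e) (hreg : 0 < P.reg) (hΛ : 1 ≤ P.Lam)
    (hρ : 0 < P.ρ) (hσ : 0 ≤ P.σ) (hB : 0 ≤ P.B)
    {f : H} (hf : ‖f‖ ≤ P.B) (hS : ∀ i x, (S i).meanReward x = f x)
    {E : ℝ} (hE : 0 ≤ E) (hε : P.ε ≤ E / (P.T : ℝ) ^ 12) :
    P.regret R S f (N, e) ≤
      2 * P.widthBound * √(P.T * (2 * (P.T * (P.T * P.ε) + 2 * maxInfoGain P.k P.ρ P.T))) +
      (4 * E * P.B * √(3 + P.reg) + 4 * P.B * (1 + 2 * E)) * √P.Lam := by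
  have hT' : (0 : ℝ) < P.T := by exact_mod_cast (by omega : 0 < P.T)
  have hmain := P.regret_le_of_goodRun hH hk hd ha hν hT hG hreg hΛ hρ hσ hB hf hS
    (μ := ((P.T : ℝ) ^ 4)⁻¹) (by positivity)
  have hslack := P.slack_le hT hB hreg.le hΛ hE hε
  exact hmain.trans (add_le_add le_rfl hslack)

end Params

theorem exists_regret_bound {d : ℕ} (hd : 0 < d)
    (k : (Fin d → ℝ) → (Fin d → ℝ) → ℝ) (a ν : Fin d → ℝ)
    (ha : ∀ j, 0 < a j) (hν : ∀ j, 0 < ν j)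
    (hk : IsDecomposable k (gaussianSpectrum a ν))
    {H : Type*} [NormedAddCommGroup H] [InnerProductSpace ℝ H] [CompleteSpace H]
    [RKHS ℝ H (Cube d) ℝ] (hH : ∀ x y : Cube d, RKHS.kernel H x y 1 = k x y)
    (B ρ reg : ℝ) (hB : 0 ≤ B) (hρ : 0 < ρ) (hreg : 0 < reg) {l : ℝ} (hl : 0 < l) :
    ∃ C : ℝ, 0 < C ∧ ∀ (T : ℕ) (α β ζ : ℝ), 2 ≤ T → 0 < α → α ≤ 1 → 0 < β → β < 1 → 0 < ζ →
      l ≤ Real.log (1 / β) → l ≤ Real.log (1 / ζ) →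
      ∀ (R : (Params.mk T k a ν B ρ reg (privacyScale T B ρ α β) ζ).ArgmaxRule) (f : H)
        (S : Fin T → User d) (N : (Params.mk T k a ν B ρ reg (privacyScale T B ρ α β) ζ).TreeNoise)
        (e : Fin T → ℝ), ‖f‖ ≤ B → (∀ i x, (S i).meanReward x = f x) →
        (Params.mk T k a ν B ρ reg (privacyScale T B ρ α β) ζ).GoodRun R S N e →
        (Params.mk T k a ν B ρ reg (privacyScale T B ρ α β) ζ).regret R S f (N, e) ≤
          C * (√(T * maxInfoGain k ρ T) * (privateRate d T α β ζ + nonprivateRate d T)) := by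
  obtain ⟨CA, hCA0, hCA⟩ := exists_Lam_le hd k a ν B ρ reg hl
  obtain ⟨CB, hCB0, hCB⟩ := exists_sqrt_le_rate d k a ν B ρ reg hl
  set E := epsConst ν with hE
  have hE0 : 0 ≤ E := epsConst_nonneg ν
  set x0 : Cube d := ⟨0, by simp⟩ with hx0
  have hk0 : 0 < k x0 x0 := by
    rw [hk.self_eq hν]
    exact Finset.prod_pos fun j _ => mul_pos (div_pos (ha j) (hν j))
      (Real.sqrt_pos.mpr (by positivity))
  -- A lower bound for `γ_T` independent of `T`, positive because `k(0,0) > 0`. It absorbs the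
  -- quadrature error in the potential and the additive slack.
  set γ0 := Real.log (1 + k x0 x0) / 2 with hγ0
  have hγ0pos : 0 < γ0 := by
    have := Real.log_pos (x := 1 + k x0 x0) (by linarith)
    positivity
  set c1 := B * √(3 + reg) + B * E + 1 with hc1
  set c3 := 4 * E * B * √(3 + reg) + 4 * B * (1 + 2 * E) with hc3
  set g := 2 * (E / γ0 + 2) with hg
  have hc10 : 0 < c1 := by positivity
  have hc30 : 0 ≤ c3 := by positivity
  have hg0 : 0 < g := by positivity
  refine ⟨2 * (c1 * √CA + ρ * CB) * √g + c3 * √CA / √γ0, by positivity, ?_⟩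
  intro T α β ζ hT hα hα1 hβ hβ1 hζ hb hz
  set P := Params.mk T k a ν B ρ reg (privacyScale T B ρ α β) ζ with hP
  intro R f S N e hf hS hG
  have hσ1 : 1 ≤ P.σ := privacyScale_ge_one hα hα1 hβ hβ1
  have hσ : 0 ≤ P.σ := by linarith
  have hΛ : 1 ≤ P.Lam := P.one_le_Lam hd hT hσ1
  have hε : P.ε ≤ E / (P.T : ℝ) ^ 12 := P.ε_le hk ha hν hT
  have hT' : (1 : ℝ) ≤ T := by exact_mod_cast (by omega : 1 ≤ T)
  have hb0 := hl.trans_le hb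
  have hZ0 := hl.trans_le hz
  set U := privateRate d T α β ζ with hU
  set W := nonprivateRate d T with hW
  have hU0 : 0 ≤ U := privateRate_nonneg (by omega) hα hb0.le hZ0.le
  have hW0 : 0 ≤ W := nonprivateRate_nonneg (by omega)
  have hsΛ : √P.Lam ≤ √CA * (U + W) := by
    have h1 := Real.sqrt_le_sqrt (hCA T α β ζ hT hα hβ hζ hb hz)
    rw [Real.sqrt_mul hCA0.le, Real.sqrt_sq hU0] at h1
    refine h1.trans (mul_le_mul_of_nonneg_left (by linarith) (Real.sqrt_nonneg _))
  have hB2 := hCB T (privacyScale T B ρ α β) α β ζ hT hα hα1 hβ hζ hb hz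
  have hwb : P.widthBound ≤ (c1 * √CA + ρ * CB) * (U + W) := by
    have h1 := P.widthBound_le hT hB hreg.le hσ hΛ hE0 hε
    have h2 := mul_le_mul_of_nonneg_left hsΛ hc10.le
    have h3 := mul_le_mul_of_nonneg_left hB2 hρ.le
    calc P.widthBound ≤ c1 * √P.Lam +
          ρ * √(P.m * Real.log (T + 3) + 2 * Real.log (2 / ζ)) := h1
      _ ≤ c1 * (√CA * (U + W)) + ρ * (CB * (U + W)) := add_le_add h2 h3
      _ = _ := by ring
  set γ := maxInfoGain k ρ T with hγ
  have hγγ : γ0 ≤ γ := by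
    have := log_le_maxInfoGain (k := k) (fun {ι} _ x => by
        classical exact posSemidef_kernelMatrix hH x) (fun x y => hk.le_one x y) hd
        (hk.continuous hν) hρ (by omega : 0 < T) x0 hk0.le
    rw [hγ0]
    linarith
  have hγpos : 0 < γ := hγ0pos.trans_le hγγ
  have hmain : P.regret R S f (N, e) ≤
      2 * P.widthBound * √(T * (2 * (T * (T * P.ε) + 2 * γ))) + c3 * √P.Lam :=
    P.regret_le_of_ε_le hd hH hk ha hν hT hG hreg hΛ hρ hσ hB hf hS hE0 hε
  have hsum : (T : ℝ) * (2 * (T * (T * P.ε) + 2 * γ)) ≤ g * (T * γ) := by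
    have h1 : (T : ℝ) * (T * P.ε) ≤ E := by
      calc (T : ℝ) * (T * P.ε) = T ^ 2 * P.ε := by ring
        _ ≤ (T : ℝ) ^ 2 * (E / (T : ℝ) ^ 12) := mul_le_mul_of_nonneg_left hε (by positivity)
        _ = E / (T : ℝ) ^ 10 := by field_simp
        _ ≤ E := div_le_self hE0 (one_le_pow₀ hT')
    have h2 : E ≤ E / γ0 * γ := by
      rw [div_mul_eq_mul_div, le_div_iff₀ hγ0pos]
      exact mul_le_mul_of_nonneg_left hγγ hE0
    calc (T : ℝ) * (2 * (T * (T * P.ε) + 2 * γ)) ≤ T * (2 * (E / γ0 * γ + 2 * γ)) := by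
          refine mul_le_mul_of_nonneg_left ?_ (by linarith)
          linarith
      _ = g * (T * γ) := by rw [hg]; ring
  have hsq := Real.sqrt_le_sqrt hsum
  rw [Real.sqrt_mul hg0.le] at hsq
  set G := √(T * γ) with hGdef
  have hGγ : √γ0 ≤ G := Real.sqrt_le_sqrt (by nlinarith)
  have hsγ : 0 < √γ0 := Real.sqrt_pos.mpr hγ0pos
  have hUW : 0 ≤ U + W := by linarith
  have hfirst : 2 * P.widthBound * √(T * (2 * (T * (T * P.ε) + 2 * γ))) ≤
      2 * ((c1 * √CA + ρ * CB) * (U + W)) * (√g * G) :=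
    mul_le_mul (mul_le_mul_of_nonneg_left hwb zero_le_two) hsq (Real.sqrt_nonneg _) (by positivity)
  have hsecond : c3 * √P.Lam ≤ c3 * √CA / √γ0 * (G * (U + W)) := by
    calc c3 * √P.Lam ≤ c3 * (√CA * (U + W)) := mul_le_mul_of_nonneg_left hsΛ hc30
      _ = c3 * √CA / √γ0 * (√γ0 * (U + W)) := by field_simp
      _ ≤ _ := by gcongr
  have hfinal : (2 * (c1 * √CA + ρ * CB) * √g + c3 * √CA / √γ0) * (G * (U + W)) =
      2 * ((c1 * √CA + ρ * CB) * (U + W)) * (√g * G) + c3 * √CA / √γ0 * (G * (U + W)) := by ring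
  rw [hfinal]
  linarith

theorem one_sub_le_measureReal {Ω : Type*} [MeasurableSpace Ω] {μ : Measure Ω}
    [IsProbabilityMeasure μ] {s t : Set Ω} {ζ : ℝ} (hζ : 0 ≤ ζ) (hs : μ s ≤ ENNReal.ofReal ζ)
    (h : ∀ ω, ω ∉ s → ω ∈ t) : 1 - ζ ≤ μ.real t := by
  have h1 : (1 : ℝ) ≤ μ.real s + μ.real t := by
    rw [← probReal_univ (μ := μ)]
    refine (measureReal_mono fun ω _ => ?_).trans (measureReal_union_le s t)
    by_cases hω : ω ∈ s
    · exact Or.inl hω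
    · exact Or.inr (h ω hω)
  have h2 : μ.real s ≤ ζ := ENNReal.toReal_le_of_le_ofReal hζ hs
  linarith

theorem Params.one_sub_le_measureReal {d : ℕ} (P : Params d) (hd : 0 < d) (hT : 2 ≤ P.T)
    (hσ : 0 < P.σ) (hζ : 0 < P.ζ) (hζ1 : P.ζ < 1) (hρ : 0 < P.ρ) (hc : 0 < P.reg + P.Lam)
    (R : P.ArgmaxRule) {S : Fin P.T → User d} (hS : ∀ i, (S i).SubGaussianNoise P.ρ)
    {t : Set P.Sample} (ht : ∀ N e, P.GoodRun R S N e → (N, e) ∈ t) :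
    1 - P.ζ ≤ (P.sampleMeasure S).real t :=
  PrivateGPBandit.one_sub_le_measureReal hζ.le
    (P.measure_not_goodRun_le hd hT hσ hζ hζ1 hρ hc R hS)
    fun ω hω => ht ω.1 ω.2 (not_not.mp hω)

end PrivateGPBandit

end

/-! ### The theorem. -/

theorem mainTheorem1 {d : ℕ} (hd : 0 < d)
    (k : (Fin d → ℝ) → (Fin d → ℝ) → ℝ) (a ν : Fin d → ℝ)
    (ha : ∀ j, 0 < a j) (hν : ∀ j, 0 < ν j)
    (hk : IsDecomposable k (gaussianSpectrum a ν))
    {H : Type*} [NormedAddCommGroup H] [InnerProductSpace ℝ H] [CompleteSpace H]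
    [RKHS ℝ H (Cube d) ℝ] (hH : ∀ x y : Cube d, RKHS.kernel H x y 1 = k x y)
    (B ρ reg : ℝ) (hB : 0 ≤ B) (hρ : 0 < ρ) (hreg : 0 < reg)
    (q : ℝ) (hq : q < 1) :
    ∃ C : ℝ, 0 < C ∧
      ∀ (T : ℕ) (α β ζ : ℝ), 2 ≤ T → 0 < α → α ≤ 1 → 0 < β → β ≤ q → 0 < ζ → ζ ≤ q →
        -- privacy, for every noise scale above the threshold
        (∀ σ : ℝ, privacyScale T B ρ α β ≤ σ →
          ∀ R : (Params.mk T k a ν B ρ reg σ ζ).ArgmaxRule,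
            (Params.mk T k a ν B ρ reg σ ζ).IsJDP R α β) ∧
        -- regret, with the noise scale at the threshold
        (∀ (R : (Params.mk T k a ν B ρ reg (privacyScale T B ρ α β) ζ).ArgmaxRule)
          (f : H) (S : Fin T → User d), ‖f‖ ≤ B →
          (∀ i x, (S i).meanReward x = f x) → (∀ i, (S i).SubGaussianNoise ρ) →
          1 - ζ ≤ ((Params.mk T k a ν B ρ reg (privacyScale T B ρ α β) ζ).sampleMeasure S).real
            {ω | (Params.mk T k a ν B ρ reg (privacyScale T B ρ α β) ζ).regret R S f ω ≤
              C * (√(T * maxInfoGain k ρ T) *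
                (Real.log T ^ (((d : ℝ) + 2) / 4) *
                    (1 / α * Real.log (1 / β) * Real.log (1 / ζ)) ^ ((1 : ℝ) / 2) +
                  Real.log T ^ (((d : ℝ) + 1) / 2)))}) := by
  -- The constants need a positive lower bound for `log(1/β)` and `log(1/ζ)`, and `log(1/q)` need
  -- not be one when `q ≤ 0`. Enlarging `q` to lie in `(0,1)` is harmless.
  set q' := max q (1 / 2) with hq'
  have hq0 : 0 < q' := lt_of_lt_of_le (by norm_num) (le_max_right _ _)
  have hq1 : q' < 1 := max_lt hq (by norm_num)
  have hl : 0 < Real.log (1 / q') := Real.log_pos (by rw [lt_div_iff₀ hq0]; linarith)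
  have hlog : ∀ x, 0 < x → x ≤ q → Real.log (1 / q') ≤ Real.log (1 / x) := fun x hx hxq =>
    Real.log_le_log (by positivity) (one_div_le_one_div_of_le hx (hxq.trans (le_max_left _ _)))
  obtain ⟨C, hC0, hC⟩ := exists_regret_bound hd k a ν ha hν hk hH B ρ reg hB hρ hreg hl
  refine ⟨C, hC0, fun T α β ζ hT hα hα1 hβ hβq hζ hζq => ⟨fun σ hσ R => ?_, ?_⟩⟩
  · have hfeat := (Params.mk T k a ν B ρ reg σ ζ).feat_dotProduct_self_le hk ha hν hT
    exact (Params.mk T k a ν B ρ reg σ ζ).isJDP hfeat hρ hα hα1 hβ (hβq.trans_lt hq) hσ R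
  · intro R f S hf hmean hsub
    have hσ1 : 1 ≤ privacyScale T B ρ α β := privacyScale_ge_one hα hα1 hβ (hβq.trans_lt hq)
    have hΛ := (Params.mk T k a ν B ρ reg (privacyScale T B ρ α β) ζ).one_le_Lam hd hT hσ1
    exact (Params.mk T k a ν B ρ reg (privacyScale T B ρ α β) ζ).one_sub_le_measureReal
      hd hT (by linarith) hζ (hζq.trans_lt hq) hρ (by linarith) R hsub fun N e hG =>
        hC T α β ζ hT hα hα1 hβ (hβq.trans_lt hq) hζ (hlog β hβ hβq) (hlog ζ hζ hζq) R f S N e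
          hf hmean hG
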